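/- **Setting.** A CSS code $Q$ on $n$ qubits is given by full-rank matrices $H^X\in\mathbb F_2^{m_x\times n}$, $H^Z\in\mathbb F_2^{m_z\times n}$ with $H^X(H^Z)^{T}=0$; it encodes $k=n-m_x-m_z$ logical qubits, and its distance $d$ is the least weight of a nontrivial $X$-type or $Z$-type logical operator (with $d:=0$ if $k=0$). It is $\ell$-LDPC if its stabilizer group is generated by some Pauli checks of weight at most $\ell$, at most $\ell$ of which act on any given qubit. Fix any basis of the logical qubits of $Q$ by $X$-type and $Z$-type logical operators. Let $S_X\subseteq\{I,X\}^{\otimes m}$ and $S_Z\subseteq\{I,Z\}^{\otimes m}$ be commuting and independent with $|S_X|+|S_Z|=m$, such that every element of $S_Z$ has weight at most $w$ and every qubit is in the support of at most $w$ elements of $S_Z$. Let $|\psi\rangle$ be the $m$-qubit state that is the joint $+1$ eigenstate of $S_X\cup S_Z$, and let $|\overline\psi\rangle$ be $|\psi\rangle^{\otimes k}$ encoded in $m$ copies of $Q$ (for each $j\le k$, the $j$-th logical qubits of the $m$ copies are in the state $|\psi\rangle$). A random Pauli operator $E$ is *local stochastic of rate $p$* if $\Pr[S\subseteq\mathrm{supp}(E)]\le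 p^{|S|}$ for all sets $S$ of qubits. A *single-shot procedure* with $a$ ancillas starts from $|0\rangle$ on the $mn$ output qubits and the $a$ ancillas, applies a circuit $W$ of layers of disjoint Hadamard, CZ and CNOT gates, measures all ancillas in the Hadamard basis in one round with outcome $s$, and applies a Pauli operator $\mathsf{Rec}(s)$ to the output qubits. In a noisy run a Pauli error acts on all qubits after the initialization and after each layer of $W$ (the last one before the measurement); $E$ denotes the collection of these errors. The noise has rate $p$ if the error at each of these times is local stochastic of rate $p$ (with arbitrary correlations between different times). **Theorem.** For all $\ell,w$ there are constants $p^*\in(0,1)$, $c,c_1,c_2>0$ with $c_1(p^*)^{c_2}<1$, and $A,D\in\mathbb N$, depending only on $\ell$ and $w$, such that for all integers $T\ge1$ and $n,m\ge0$, every $\ell$-LDPC CSS code $Q$ on $n$ qubits and every $|\psi\rangle$ as above, there is a single-shot procedure with at most $A\cdot m\,n\,T$ ancillas (that is, $O(nT)$ for each of the $m$ code blocks) and a circuit of depth at most $D$, together with a function $\mathsf{Rep}$ from error collections $E$ to Pauli operators on the output qubits and a set $\mathcal G$ of error collections (the success event), such that: 1. for every $E$ and every outcome $s$, the unnormalized final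 state of the output qubits is $\gamma_{E,s}\,\mathsf{Rep}(E)|\overline\psi\rangle$ for some $\gamma_{E,s}\in\mathbb C$; 2. for every $0\le p<p^*$ and every noise of rate $p$, $$\Pr[E\in\mathcal G]\ \ge\ 1-m\,n\,T\cdot 2^{-c\min(d,T)},$$ and, conditioned on $E\in\mathcal G$, the residual error $\mathsf{Rep}(E)$ is local stochastic of rate $c_1p^{c_2}$, i.e. $\Pr[S\subseteq\mathrm{supp}(\mathsf{Rep}(E)),\,E\in\mathcal G]\le (c_1p^{c_2})^{|S|}\Pr[E\in\mathcal G]$ for all sets $S$ of output qubits. -/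

import Mathlib

namespace SSPrep

/-! ### States, Pauli operators, gates -/

/-- (Unnormalised) pure states of a register of qubits labelled by `V`, given by their amplitudes in
the computational basis. -/
abbrev State (V : Type) := (V → ZMod 2) → ℂ

/-- Pauli operators on the qubits `V`, up to phase: `P q = (x, z)` means `X^x Z^z` on qubit `q`. -/
abbrev PauliOp (V : Type) := V → ZMod 2 × ZMod 2

/-- The sign `(-1)^b`. -/
def sgn (b : ZMod 2) : ℂ := if b = 0 then 1 else -1

section Circuits

variable {V : Type} [Fintype V] [DecidableEq V]

/-- The action of `∏ q, X_q^(P q).1 Z_q^(P q).2` on a state. -/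
def applyPauli (P : PauliOp V) (φ : State V) : State V := fun x =>
  sgn (∑ q, (P q).2 * (x q + (P q).1)) * φ (fun q => x q + (P q).1)

/-- Elementary gates: Hadamard, controlled-`Z` and controlled-NOT (control first). -/
inductive Gate (V : Type) where
  | H (q : V) : Gate V
  | CZ (q r : V) (h : q ≠ r) : Gate V
  | CNOT (q r : V) (h : q ≠ r) : Gate V

/-- The set of qubits a gate acts on. -/
def Gate.qubits : Gate V → Finset V
  | .H q => {q}
  | .CZ q r _ => {q, r}
  | .CNOT q r _ => {q, r}

/-- The unitary action of a gate on states. -/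
noncomputable def Gate.apply : Gate V → State V → State V
  | .H q, φ => fun x =>
      ((Real.sqrt 2 : ℝ) : ℂ)⁻¹ * ∑ b : ZMod 2, sgn (x q * b) * φ (Function.update x q b)
  | .CZ q r _, φ => fun x => sgn (x q * x r) * φ x
  | .CNOT q r _, φ => fun x => φ (Function.update x r (x r + x q))

/-- One layer of a circuit: gates acting on pairwise disjoint sets of qubits. -/
structure Layer (V : Type) [DecidableEq V] where
  gates : List (Gate V)
  disjoint : gates.Pairwise fun g h => Disjoint g.qubits h.qubits

/-- The action of a layer of gates. -/
noncomputable def Layer.apply (L : Layer V) (φ : State V) : State V :=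
  L.gates.foldl (fun χ g => g.apply χ) φ

/-- The state `|0⟩` on all qubits. -/
def zeroState (V : Type) [Fintype V] [DecidableEq V] : State V := fun x => if x = 0 then 1 else 0

end Circuits

/-! ### Single-shot procedures -/

/-- Projection of the qubits `B` onto the Hadamard-basis state `|±_s⟩`: the (unnormalised) state
`⟨±_s|_B φ` of the remaining qubits `O`. -/
noncomputable def hadamardOutcome {O B : Type} [Fintype B] [DecidableEq B]
    (φ : State (O ⊕ B)) (s : B → ZMod 2) : State O := fun y =>
  ∑ b : B → ZMod 2, (∏ i, ((Real.sqrt 2 : ℝ) : ℂ)⁻¹ * sgn (s i * b i)) * φ (Sum.elim y b)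

/-- A single-shot procedure with output qubits `O` and `a` ancilla qubits: start from `|0⟩` on all
qubits, run the layers one after the other, measure all ancilla qubits in the Hadamard basis, in a
single round, and apply a Pauli operator on `O` computed from the outcome. -/
structure Procedure (O : Type) [DecidableEq O] (a : ℕ) where
  depth : ℕ
  layers : Fin depth → Layer (O ⊕ Fin a)
  recover : (Fin a → ZMod 2) → PauliOp O

namespace Procedure

variable {O : Type} [Fintype O] [DecidableEq O] {a : ℕ}

/-- Error configurations of a noisy run: a Pauli operator on all qubits right after the
initialisation (index `0`) and one right after each layer. The last one precedes the measurement and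
so includes the measurement errors. -/
abbrev Errors (W : Procedure O a) := Fin (W.depth + 1) → PauliOp (O ⊕ Fin a)

/-- The state right before the measurement, in a run with errors `E`. -/
noncomputable def noisyState (W : Procedure O a) (E : W.Errors) : State (O ⊕ Fin a) :=
  Fin.foldl W.depth (fun φ t => applyPauli (E t.succ) ((W.layers t).apply φ))
    (applyPauli (E 0) (zeroState (O ⊕ Fin a)))

/-- In a run with errors `E` and measurement outcome `s`, the output state after the Pauli
correction is always `rep E` applied to the target state, up to a scalar (whose squared modulus is
proportional to the probability of the outcome). -/
def Prepares (W : Procedure O a) (rep : W.Errors → PauliOp O) (target : State O) : Prop :=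
  ∀ (E : W.Errors) (s : Fin a → ZMod 2), ∃ γ : ℂ,
    applyPauli (W.recover s) (hadamardOutcome (W.noisyState E) s) =
      γ • applyPauli (rep E) target

end Procedure

/-! ### Local stochastic noise -/

/-- The probability of an event. -/
noncomputable def prob {Ω : Type} (μ : PMF Ω) (A : Set Ω) : ℝ := (μ.toOuterMeasure A).toReal

/-- Conditioned on the event `G`, the random Pauli operator `F` is local stochastic of rate `p`, i.e.
`ℙ[S ⊆ supp F | G] ≤ p ^ |S|` for every set `S` of qubits (multiplied out by `ℙ[G]`). -/
def LocalStochasticOn {Ω V : Type} (μ : PMF Ω) (G : Set Ω) (F : Ω → PauliOp V) (p : ℝ) : Prop :=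
  ∀ S : Finset V, prob μ {ω | ω ∈ G ∧ ∀ q ∈ S, F ω q ≠ 0} ≤ p ^ S.card * prob μ G

/-- The random Pauli operator `F` is local stochastic of rate `p`. -/
def LocalStochastic {Ω V : Type} (μ : PMF Ω) (F : Ω → PauliOp V) (p : ℝ) : Prop :=
  ∀ S : Finset V, prob μ {ω | ∀ q ∈ S, F ω q ≠ 0} ≤ p ^ S.card

/-! ### CSS codes -/

/-- A CSS code on `n` qubits, given by full-rank parity check matrices. -/
structure CSSCode (n : ℕ) where
  mx : ℕ
  mz : ℕ
  HX : Matrix (Fin mx) (Fin n) (ZMod 2)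
  HZ : Matrix (Fin mz) (Fin n) (ZMod 2)
  fullRankX : LinearIndependent (ZMod 2) HX.row
  fullRankZ : LinearIndependent (ZMod 2) HZ.row
  comm : HX * HZ.transpose = 0

namespace CSSCode

variable {n : ℕ} (Q : CSSCode n)

/-- The supports of the `X`-type stabilizers. -/
def stabX : Submodule (ZMod 2) (Fin n → ZMod 2) := Submodule.span (ZMod 2) (Set.range Q.HX.row)

/-- The supports of the `Z`-type stabilizers. -/
def stabZ : Submodule (ZMod 2) (Fin n → ZMod 2) := Submodule.span (ZMod 2) (Set.range Q.HZ.row)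

/-- The number of logical qubits. -/
def k : ℕ := n - Q.mx - Q.mz

/-- The distance: the least weight of a nontrivial `X`-type or `Z`-type logical operator (and `0` if
there is none, i.e. if `k = 0`). -/
noncomputable def distance : ℕ :=
  sInf {w | ∃ y : Fin n → ZMod 2, hammingNorm y = w ∧
    ((Q.HZ.mulVec y = 0 ∧ y ∉ Q.stabX) ∨ (Q.HX.mulVec y = 0 ∧ y ∉ Q.stabZ))}

/-- `Q` is `ℓ`-LDPC: there is a choice of Pauli checks `X^(A c).1 Z^(A c).2` generating its
stabilizer group, each of weight at most `ℓ`, with at most `ℓ` of them acting on any given qubit. -/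
def IsLDPC (ℓ : ℕ) : Prop :=
  ∃ (r : ℕ) (A : Fin r → (Fin n → ZMod 2) × (Fin n → ZMod 2)),
    Submodule.span (ZMod 2) (Set.range A) = Q.stabX.prod Q.stabZ ∧
    (∀ c, (Finset.univ.filter fun i => (A c).1 i ≠ 0 ∨ (A c).2 i ≠ 0).card ≤ ℓ) ∧
    (∀ i, (Finset.univ.filter fun c => (A c).1 i ≠ 0 ∨ (A c).2 i ≠ 0).card ≤ ℓ)

/-- A choice of the `k` logical qubits: `X`-type and `Z`-type logical Pauli operators with supports
`lx j` and `lz j`, commuting with the stabilizers, with `X̄_i` and `Z̄_j` anticommuting iff `i = j`. -/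
structure LogicalBasis where
  lx : Matrix (Fin Q.k) (Fin n) (ZMod 2)
  lz : Matrix (Fin Q.k) (Fin n) (ZMod 2)
  lx_comm : Q.HZ * lx.transpose = 0
  lz_comm : Q.HX * lz.transpose = 0
  dual : lx * lz.transpose = 1

variable {Q}

open Classical in
/-- The encoded computational basis state `|x̄⟩`: the uniform superposition of the bit strings in the
coset `∑ j, x j • lx j + stabX`. -/
noncomputable def LogicalBasis.basisState (B : Q.LogicalBasis) (x : Fin Q.k → ZMod 2) :
    State (Fin n) := fun y =>
  if y - ∑ j, x j • B.lx.row j ∈ Q.stabX then ((Real.sqrt (Nat.card Q.stabX) : ℝ) : ℂ)⁻¹ else 0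

/-- The state `|ψ⟩^{⊗ k}` of `m * k` qubits encoded in `m` copies of the code: for every `j`, the
`j`-th logical qubits of the `m` blocks are in the state `ψ`. -/
noncomputable def LogicalBasis.encode (B : Q.LogicalBasis) {m : ℕ} (ψ : State (Fin m)) :
    State (Fin m × Fin n) := fun y =>
  ∑ x : Fin m → Fin Q.k → ZMod 2,
    (∏ j, ψ fun i => x i j) * ∏ i, B.basisState (x i) fun q => y (i, q)

end CSSCode

/-! ### CSS stabilizer states -/

/-- A complete set of `m` independent commuting stabilizer generators on `m` qubits, each of `X` type
or of `Z` type. -/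
structure CSSGenerators (m : ℕ) where
  mX : ℕ
  mZ : ℕ
  SX : Matrix (Fin mX) (Fin m) (ZMod 2)
  SZ : Matrix (Fin mZ) (Fin m) (ZMod 2)
  indepX : LinearIndependent (ZMod 2) SX.row
  indepZ : LinearIndependent (ZMod 2) SZ.row
  comm : SX * SZ.transpose = 0
  complete : mX + mZ = m

namespace CSSGenerators

variable {m : ℕ} (S : CSSGenerators m)

/-- The `Z`-type generators have weight at most `w`, and every qubit is in the support of at most `w`
of them. -/
def ZSparse (w : ℕ) : Prop :=
  (∀ c, (Finset.univ.filter fun i => S.SZ c i ≠ 0).card ≤ w) ∧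
  (∀ i, (Finset.univ.filter fun c => S.SZ c i ≠ 0).card ≤ w)

/-- `ψ` is a normalised joint `+1` eigenstate of the generators (so it is unique up to a phase). -/
def IsStabilizerState (ψ : State (Fin m)) : Prop :=
  ∑ x, ‖ψ x‖ ^ 2 = 1 ∧
  (∀ r, applyPauli (fun i => (S.SX r i, 0)) ψ = ψ) ∧
  (∀ c, applyPauli (fun i => (0, S.SZ c i)) ψ = ψ)

end CSSGenerators

end SSPrep

open Matrix Kronecker

set_option linter.unusedSectionVars false
set_option synthInstance.maxSize 1024


namespace SSPrep

/-! ### Pauli operators acting on states -/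

/-! The encoded state is obtained from a cluster state on a bipartite graph of bounded degree: every
qubit is put in `|+⟩`, CZ gates act along the edges, one layer for each of boundedly many edge
colours, and all qubits but the outputs are measured. The biadjacency matrix is the middle
differential of a product of two complexes. One is the time complex `timeMatrix`: a repetition code
on `τ + 1 = T` times for each of the `m` blocks, with the rows of `SZ` as further checks on the bits
at the last time. The other is the complex of the code, with sparse checks `HX`, `HZ`. The outputs
are the code qubits at time 0. For trivial outcomes they are in a uniform superposition of strings
lying blockwise in `ker HZ` whose `SZ`-combinations are `X` stabilizers, which is the encoded state
(`encode_eq`, `exists_foliation_mulVec_eq_zero_iff`). Any other outcome that can occur gives this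
state up to a Pauli operator; the pairs of an outcome and a Pauli operator form the linear relation
`residual`.

Since consecutive differentials compose to zero, the outer ones provide parity checks on the
outcomes (`outcomeChecks`). A CZ gate only turns an `X` error into additional `Z` errors on
neighbours, so all faults together amount to one Pauli operator before the measurement, supported on
the faulty qubits and their neighbours. Its `Z` part flips the outcomes by some `f`. The recovery
subtracts a minimum-weight guess with the same syndrome, which leaves an undetected pattern `g`.

The connected components of `g` are undetected separately. A component with fewer than `min d T`
elements cannot reach both ends of the time direction. If it avoids time 0, it is harmless: summed
over time it becomes a pattern of weight less than `d` on the code, hence a stabilizer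
(`zero_mem_residual_of_hammingNorm_lt`). If it avoids the last time, its effect is the sum of its
flips along the time lines of the outputs (`timelineSum_mem_residual`). So a residual error on an
output requires a component that meets its time line at a height below the component's size
(`exists_residual_of_components`).

By minimality of the guess, at least half of each component consists of actual errors. The noise
stays local stochastic under the union over times and the bounded spread, and the number of
connected sets of given size through a point is at most exponential. A Peierls argument then bounds
both the probability of a large component and that of a residual error covering a given set
(`prob_exists_large_cluster_le`, `prob_exists_candidates_le`). -/

theorem zmod2_eq_zero_or_one (a : ZMod 2) : a = 0 ∨ a = 1 := by
  revert a; decide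

theorem zmod2_eq_one_of_ne_zero {a : ZMod 2} (h : a ≠ 0) : a = 1 :=
  (zmod2_eq_zero_or_one a).resolve_left h

theorem sgn_zero : sgn 0 = 1 := by simp [sgn]

theorem sgn_one : sgn 1 = -1 := by simp [sgn]

theorem sgn_add (a b : ZMod 2) : sgn (a + b) = sgn a * sgn b := by
  have h : (1 : ZMod 2) + 1 = 0 := by decide
  rcases zmod2_eq_zero_or_one a with rfl | rfl <;> rcases zmod2_eq_zero_or_one b with rfl | rfl <;>
    simp [sgn, h]

theorem sgn_ne_zero (a : ZMod 2) : sgn a ≠ 0 := by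
  rcases zmod2_eq_zero_or_one a with rfl | rfl <;> simp [sgn]

/-- `φ` is a scalar multiple of `χ`. -/
def Proportional {V : Type} (φ χ : State V) : Prop := ∃ γ : ℂ, φ = γ • χ

namespace Proportional

variable {V : Type} {φ χ ξ : State V}

theorem trans (h : Proportional φ χ) (h' : Proportional χ ξ) : Proportional φ ξ := by
  obtain ⟨γ, rfl⟩ := h
  obtain ⟨δ, rfl⟩ := h'
  exact ⟨γ * δ, smul_smul _ _ _⟩

theorem of_smul_eq {γ : ℂ} (hγ : γ ≠ 0) (h : φ = γ • χ) : Proportional χ φ :=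
  ⟨γ⁻¹, by rw [h, smul_smul, inv_mul_cancel₀ hγ, one_smul]⟩

end Proportional

section Pauli

variable {V : Type} [Fintype V] [DecidableEq V]

theorem applyPauli_smul (P : PauliOp V) (γ : ℂ) (φ : State V) :
    applyPauli P (γ • φ) = γ • applyPauli P φ := by
  funext x
  simp only [applyPauli, Pi.smul_apply, smul_eq_mul]
  ring

theorem Proportional.applyPauli {φ χ : State V} (P : PauliOp V) (h : Proportional φ χ) :
    Proportional (applyPauli P φ) (SSPrep.applyPauli P χ) := by
  obtain ⟨γ, rfl⟩ := h
  exact ⟨γ, applyPauli_smul _ _ _⟩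

theorem applyPauli_applyPauli (P R : PauliOp V) (φ : State V) :
    applyPauli P (applyPauli R φ) = sgn (∑ q, (P q).2 * (R q).1) • applyPauli (P + R) φ := by
  funext x
  simp only [applyPauli, Pi.smul_apply, smul_eq_mul, Pi.add_apply, Prod.fst_add, Prod.snd_add]
  rw [← mul_assoc, ← mul_assoc, ← sgn_add, ← sgn_add, ← Finset.sum_add_distrib,
    ← Finset.sum_add_distrib]
  congr 2
  · refine Finset.sum_congr rfl fun q _ => ?_
    generalize (P q).1 = a, (P q).2 = b, (R q).1 = c, (R q).2 = d, x q = e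
    revert a b c d e
    decide
  · funext q
    ring

theorem proportional_applyPauli_add (P R : PauliOp V) (φ : State V) :
    Proportional (applyPauli (P + R) φ) (applyPauli P (applyPauli R φ)) :=
  Proportional.of_smul_eq (sgn_ne_zero _) (applyPauli_applyPauli P R φ)

theorem proportional_applyPauli_applyPauli (P R : PauliOp V) (φ : State V) :
    Proportional (applyPauli P (applyPauli R φ)) (applyPauli (P + R) φ) :=
  ⟨_, applyPauli_applyPauli P R φ⟩

end Pauli

/-! ### Preparing all qubits in the `X` eigenstate -/

section Hadamard

variable {V : Type} [Fintype V] [DecidableEq V]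

/-- The qubits in `S` are in Hadamard-basis states, the others in computational basis states, both
labelled by `v`. -/
def mixedState (S : Finset V) (v : V → ZMod 2) : State V := fun x =>
  if ∀ q, q ∉ S → x q = v q then sgn (∑ q ∈ S, v q * x q) else 0

theorem applyPauli_zeroState (P : PauliOp V) :
    Proportional (applyPauli P (zeroState V)) (mixedState ∅ fun q => (P q).1) := by
  refine ⟨1, ?_⟩
  rw [one_smul]
  funext x
  have hx : (fun q => x q + (P q).1) = 0 ↔ ∀ q, q ∉ (∅ : Finset V) → x q = (P q).1 := by
    rw [funext_iff]
    refine forall_congr' fun q => ?_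
    simp [CharTwo.add_eq_zero]
  simp only [applyPauli, zeroState, mixedState, hx]
  split_ifs with h
  · have : ∀ q, x q + (P q).1 = 0 := fun q => congrFun (hx.2 h) q
    simp [this, sgn_zero]
  · simp

theorem Gate.H_apply_mixedState (S : Finset V) (v : V → ZMod 2) {q : V} (hq : q ∉ S) :
    (Gate.H q).apply (mixedState S v) =
      ((Real.sqrt 2 : ℝ) : ℂ)⁻¹ • mixedState (insert q S) v := by
  funext x
  simp only [Gate.apply, Pi.smul_apply, smul_eq_mul]
  congr 1
  have hsum : ∀ b : ZMod 2, ∑ r ∈ S, v r * Function.update x q b r = ∑ r ∈ S, v r * x r := by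
    intro b
    refine Finset.sum_congr rfl fun r hr => ?_
    rw [Function.update_of_ne (ne_of_mem_of_not_mem hr hq)]
  rw [Finset.sum_eq_single (v q)]
  · have hiff : (∀ r, r ∉ S → Function.update x q (v q) r = v r) ↔
        ∀ r, r ∉ insert q S → x r = v r := by
      constructor
      · intro h r hr
        rw [Finset.mem_insert, not_or] at hr
        simpa [Function.update_of_ne hr.1] using h r hr.2
      · intro h r hr
        by_cases hrq : r = q
        · subst hrq; simp
        · rw [Function.update_of_ne hrq]
          exact h r (by simp [hrq, hr])
    simp only [mixedState, hiff, hsum, Finset.sum_insert hq, sgn_add]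
    split_ifs
    · rw [mul_comm (x q)]
    · simp
  · intro b _ hb
    have : ¬ ∀ r, r ∉ S → Function.update x q b r = v r := fun h => hb (by simpa using h q hq)
    simp [mixedState, this]
  · simp

theorem Gate.H_apply_smul (q : V) (γ : ℂ) (φ : State V) :
    (Gate.H q).apply (γ • φ) = γ • (Gate.H q).apply φ := by
  funext x
  simp only [Gate.apply, Pi.smul_apply, smul_eq_mul, Finset.mul_sum]
  refine Finset.sum_congr rfl fun b _ => ?_
  ring

theorem foldl_H_mixedState (v : V → ZMod 2) (l : List V) (S : Finset V) (hl : l.Nodup)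
    (hS : ∀ q ∈ l, q ∉ S) (φ : State V) (hφ : Proportional φ (mixedState S v)) :
    Proportional ((l.map Gate.H).foldl (fun χ g => g.apply χ) φ) (mixedState (S ∪ l.toFinset) v) := by
  induction l generalizing S φ with
  | nil => simpa using hφ
  | cons q l ih =>
    obtain ⟨γ, rfl⟩ := hφ
    rw [List.nodup_cons] at hl
    rw [List.map_cons, List.foldl_cons]
    have := ih (insert q S) hl.2 ?_ ((Gate.H q).apply (γ • mixedState S v)) ?_
    · simpa using this
    · intro r hr
      rw [Finset.mem_insert, not_or]
      exact ⟨fun h => hl.1 (h ▸ hr), hS r (by simp [hr])⟩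
    · rw [Gate.H_apply_smul, Gate.H_apply_mixedState _ _ (hS q (by simp)), smul_smul]
      exact ⟨_, rfl⟩

/-- The layer of Hadamard gates on all qubits. -/
noncomputable def hadamardLayer (V : Type) [Fintype V] [DecidableEq V] : Layer V where
  gates := (Finset.univ : Finset V).toList.map Gate.H
  disjoint := by
    rw [List.pairwise_map]
    refine (Finset.nodup_toList _).imp fun h => ?_
    simpa [Gate.qubits] using h

/-- Hadamard gates turn `X` into `Z`, and `Z` acts trivially on `|0⟩`. Initialisation errors thus
become `Z` errors in place on `|+⟩`, which is the constant function `1` up to normalisation. -/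
theorem hadamardLayer_apply (P : PauliOp V) :
    Proportional ((hadamardLayer V).apply (applyPauli P (zeroState V)))
      (applyPauli (fun q => (0, (P q).1)) fun _ => 1) := by
  have h := foldl_H_mixedState (fun q => (P q).1) (Finset.univ : Finset V).toList ∅
    (Finset.nodup_toList _) (by simp) _ (applyPauli_zeroState P)
  refine h.trans ⟨1, ?_⟩
  rw [one_smul]
  funext x
  simp [mixedState, applyPauli]

end Hadamard

/-! ### Layers of controlled-`Z` gates -/

section ControlledZ

variable {V : Type} [Fintype V] [DecidableEq V]

/-- Conjugation of a Pauli operator by a controlled-`Z` gate. -/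
def czConj (q r : V) (P : PauliOp V) : PauliOp V := fun v =>
  ((P v).1, (P v).2 + ((if v = q then (P r).1 else 0) + if v = r then (P q).1 else 0))

theorem Gate.CZ_applyPauli (q r : V) (h : q ≠ r) (P : PauliOp V) (φ : State V) :
    Proportional ((Gate.CZ q r h).apply (applyPauli P φ))
      (applyPauli (czConj q r P) ((Gate.CZ q r h).apply φ)) := by
  refine ⟨sgn ((P q).1 * (P r).1), ?_⟩
  funext x
  simp only [Gate.apply, applyPauli, czConj, Pi.smul_apply, smul_eq_mul, add_mul,
    Finset.sum_add_distrib, ite_mul, zero_mul, Finset.sum_ite_eq', Finset.mem_univ, if_true]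
  rw [← mul_assoc, ← mul_assoc, ← mul_assoc, ← sgn_add, ← sgn_add, ← sgn_add]
  congr 2
  generalize ∑ v, (P v).2 * (x v + (P v).1) = s
  generalize (P q).1 = a, (P r).1 = b, x q = c, x r = d
  revert a b c d s
  decide

theorem Gate.CZ_apply_smul (q r : V) (h : q ≠ r) (γ : ℂ) (φ : State V) :
    (Gate.CZ q r h).apply (γ • φ) = γ • (Gate.CZ q r h).apply φ := by
  funext x
  simp only [Gate.apply, Pi.smul_apply, smul_eq_mul]
  ring

/-- The errors `P` are supported on `B` and, for the `Z` part, also on the neighbours of `B`. -/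
def SpreadFrom (nb : V → V → Prop) (B : Set V) (P : PauliOp V) : Prop :=
  (∀ v, (P v).1 ≠ 0 → v ∈ B) ∧ ∀ v, (P v).2 ≠ 0 → v ∈ B ∨ ∃ u ∈ B, nb v u

theorem SpreadFrom.add {nb : V → V → Prop} {B : Set V} {P R : PauliOp V} (hP : SpreadFrom nb B P)
    (hR : SpreadFrom nb B R) : SpreadFrom nb B (P + R) := by
  refine ⟨fun v hv => ?_, fun v hv => ?_⟩
  · by_contra hB
    refine hv ?_
    rw [Pi.add_apply, Prod.fst_add, not_not.1 fun h => hB (hP.1 v h),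
      not_not.1 fun h => hB (hR.1 v h), add_zero]
  · by_contra hB
    refine hv ?_
    rw [Pi.add_apply, Prod.snd_add, not_not.1 fun h => hB (hP.2 v h),
      not_not.1 fun h => hB (hR.2 v h), add_zero]

theorem SpreadFrom.czConj {nb : V → V → Prop} {B : Set V} {P : PauliOp V} (hP : SpreadFrom nb B P)
    {q r : V} (hqr : nb q r) (hrq : nb r q) : SpreadFrom nb B (czConj q r P) := by
  refine ⟨hP.1, fun v hv => ?_⟩
  by_contra hB
  refine hv ?_
  have h1 : (P v).2 = 0 := not_not.1 fun h => hB (hP.2 v h)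
  have h2 : (if v = q then (P r).1 else 0) = 0 := by
    split_ifs with h
    · subst h
      exact not_not.1 fun h => hB (Or.inr ⟨r, hP.1 r h, hqr⟩)
    · rfl
  have h3 : (if v = r then (P q).1 else 0) = 0 := by
    split_ifs with h
    · subst h
      exact not_not.1 fun h => hB (Or.inr ⟨q, hP.1 q h, hrq⟩)
    · rfl
  simp [SSPrep.czConj, h1, h2, h3]

variable {U W : Type} [DecidableEq U] [DecidableEq W] (j₁ : U → V) (j₂ : W → V)
  (hj : ∀ u w, j₁ u ≠ j₂ w)

/-- The phase that controlled-`Z` gates on the pairs in `s` give to a basis state. -/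
def czPhase (s : Finset (U × W)) (x : V → ZMod 2) : ZMod 2 := ∑ e ∈ s, x (j₁ e.1) * x (j₂ e.2)

/-- Conjugation by CZ keeps the `X` part and changes the `Z` part only at partners of qubits in the
support of the `X` part. The invariant `SpreadFrom nb B` therefore survives any number of gates:
errors never travel further than one edge. -/
theorem foldl_CZ (l : List (U × W)) (hl : l.Nodup) (P : PauliOp V) (φ χ : State V)
    (hφ : Proportional φ (applyPauli P χ)) (nb : V → V → Prop) (B : Set V)
    (hnb : ∀ e ∈ l, nb (j₁ e.1) (j₂ e.2) ∧ nb (j₂ e.2) (j₁ e.1)) (hP : SpreadFrom nb B P) :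
    ∃ R : PauliOp V, SpreadFrom nb B R ∧
      Proportional ((l.map fun e => Gate.CZ (j₁ e.1) (j₂ e.2) (hj _ _)).foldl
        (fun ξ g => g.apply ξ) φ)
        (applyPauli R fun x => sgn (czPhase j₁ j₂ l.toFinset x) * χ x) := by
  induction l generalizing P φ χ with
  | nil => exact ⟨P, hP, by simpa [czPhase, sgn_zero] using hφ⟩
  | cons e l ih =>
    obtain ⟨γ, rfl⟩ := hφ
    rw [List.nodup_cons] at hl
    rw [List.map_cons, List.foldl_cons]
    have he := hnb e (by simp)
    obtain ⟨R, hR, h⟩ := ih hl.2 _ ((Gate.CZ (j₁ e.1) (j₂ e.2) (hj _ _)).apply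
        (γ • applyPauli P χ)) ((Gate.CZ (j₁ e.1) (j₂ e.2) (hj _ _)).apply χ)
      (Proportional.trans ⟨γ, Gate.CZ_apply_smul _ _ _ _ _⟩ (Gate.CZ_applyPauli _ _ _ _ _))
      (fun e' he' => hnb e' (by simp [he'])) (hP.czConj he.1 he.2)
    refine ⟨R, hR, ?_⟩
    convert h using 3 with x
    have : e ∉ l.toFinset := by simpa using hl.1
    rw [List.toFinset_cons, czPhase, Finset.sum_insert this, Gate.apply, add_comm, sgn_add,
      czPhase, mul_assoc]

/-- A layer of controlled-`Z` gates on disjoint pairs of qubits. -/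
noncomputable def czLayer (s : Finset (U × W))
    (hs : (s : Set (U × W)).Pairwise fun e e' => j₁ e.1 ≠ j₁ e'.1 ∧ j₂ e.2 ≠ j₂ e'.2) :
    Layer V where
  gates := s.toList.map fun e => Gate.CZ (j₁ e.1) (j₂ e.2) (hj _ _)
  disjoint := by
    rw [List.pairwise_map]
    refine (Finset.nodup_toList s).pairwise_of_forall_ne fun e he e' he' hne => ?_
    have h := hs (by simpa using he) (by simpa using he') hne
    simp only [Gate.qubits, Finset.disjoint_insert_left, Finset.disjoint_singleton_left,
      Finset.mem_insert, Finset.mem_singleton, not_or]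
    exact ⟨⟨h.1, hj _ _⟩, (hj _ _).symm, h.2⟩

/-- The gates are diagonal, so their phases add up over the layers, and the errors between the
layers are absorbed by the same invariant. -/
theorem foldl_czLayers (C : ℕ) (s : Fin C → Finset (U × W))
    (hs : ∀ t, (s t : Set (U × W)).Pairwise fun e e' => j₁ e.1 ≠ j₁ e'.1 ∧ j₂ e.2 ≠ j₂ e'.2)
    (E : Fin C → PauliOp V) (P : PauliOp V) (φ χ : State V) (nb : V → V → Prop) (B : Set V)
    (hφ : Proportional φ (applyPauli P χ))
    (hnb : ∀ t, ∀ e ∈ s t, nb (j₁ e.1) (j₂ e.2) ∧ nb (j₂ e.2) (j₁ e.1)) (hP : SpreadFrom nb B P)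
    (hE : ∀ t, SpreadFrom nb B (E t)) :
    ∃ R : PauliOp V, SpreadFrom nb B R ∧
      Proportional (Fin.foldl C
        (fun φ t => applyPauli (E t) ((czLayer j₁ j₂ hj (s t) (hs t)).apply φ)) φ)
        (applyPauli R fun x => sgn (∑ t, czPhase j₁ j₂ (s t) x) * χ x) := by
  induction C generalizing P φ χ with
  | zero => exact ⟨P, hP, by simpa [sgn_zero] using hφ⟩
  | succ C ih =>
    rw [Fin.foldl_succ]
    obtain ⟨R, hR, h⟩ := foldl_CZ j₁ j₂ hj (s 0).toList (Finset.nodup_toList _) P φ χ hφ nb B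
      (by simpa using hnb 0) hP
    rw [Finset.toList_toFinset] at h
    obtain ⟨R', hR', h'⟩ := ih (fun t => s t.succ) (fun t => hs t.succ) (fun t => E t.succ)
      (E 0 + R) (applyPauli (E 0) ((czLayer j₁ j₂ hj (s 0) (hs 0)).apply φ))
      (fun x => sgn (czPhase j₁ j₂ (s 0) x) * χ x)
      ((h.applyPauli (E 0)).trans (proportional_applyPauli_applyPauli _ _ _))
      (fun t => hnb t.succ) ((hE 0).add hR) fun t => hE t.succ
    refine ⟨R', hR', ?_⟩
    convert h' using 3 with x
    rw [Fin.sum_univ_succ, add_comm, sgn_add, mul_assoc]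

end ControlledZ

/-! ### Linear algebra over a field -/

theorem add_eq_zero_iff_eq_of_zmod_two {G : Type} [AddCommGroup G] [Module (ZMod 2) G] {x y : G} :
    x + y = 0 ↔ x = y := by
  rw [add_eq_zero_iff_eq_neg, ZModModule.neg_eq_self]

theorem exists_vecMul_eq_of_forall_mulVec {K α β : Type} [Field K] [Fintype α] [Fintype β]
    [DecidableEq α] [DecidableEq β] (A : Matrix α β K) (s : β → K)
    (h : ∀ k, A *ᵥ k = 0 → s ⬝ᵥ k = 0) : ∃ η : α → K, η ᵥ* A = s := by
  let f : Module.Dual K (β → K) := dotProductBilin K K s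
  have hf : f ∈ LinearMap.range A.mulVecLin.dualMap := by
    rw [LinearMap.range_dualMap_eq_dualAnnihilator_ker, Submodule.mem_dualAnnihilator]
    intro k hk
    exact h k (by simpa using hk)
  obtain ⟨g, hg⟩ := hf
  refine ⟨fun i => g (Pi.single i 1), ?_⟩
  funext j
  have h1 : f (Pi.single j 1) = s j := by simp [f]
  rw [← h1, ← hg, LinearMap.dualMap_apply, LinearMap.pi_apply_eq_sum_univ g]
  simp only [vecMul, dotProduct, mulVecLin_apply, mulVec_single_one, smul_eq_mul, col_apply,
    mul_comm]
  refine Finset.sum_congr rfl fun i _ => ?_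
  congr 2
  funext k
  simp [Pi.single_apply, eq_comm]

/-- A linear relation contains the graph of a linear map over its domain. -/
theorem exists_linearMap_selection {K V W : Type} [Field K] [AddCommGroup V] [Module K V]
    [AddCommGroup W] [Module K W] (R : Submodule K (V × W)) :
    ∃ ρ : V →ₗ[K] W, ∀ v w, (v, w) ∈ R → (v, ρ v) ∈ R := by
  let π : R →ₗ[K] V := LinearMap.fst K V W ∘ₗ R.subtype
  obtain ⟨g, hg⟩ := π.rangeRestrict.exists_rightInverse_of_surjective
    (LinearMap.range_eq_top.2 π.surjective_rangeRestrict)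
  obtain ⟨h, hh⟩ := (LinearMap.snd K V W ∘ₗ R.subtype ∘ₗ g).exists_extend
  refine ⟨h, fun v w hvw => ?_⟩
  have hv : v ∈ LinearMap.range π := ⟨⟨(v, w), hvw⟩, rfl⟩
  have h1 : ((g ⟨v, hv⟩ : R) : V × W).1 = v := by
    have := LinearMap.congr_fun hg ⟨v, hv⟩
    exact congrArg Subtype.val this
  have h2 : h v = ((g ⟨v, hv⟩ : R) : V × W).2 := LinearMap.congr_fun hh ⟨v, hv⟩
  rw [h2]
  convert (g ⟨v, hv⟩).2
  exact h1.symm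

theorem sum_sgn_dotProduct {β : Type} [Fintype β] [DecidableEq β] (v : β → ZMod 2) :
    ∑ b : β → ZMod 2, sgn (b ⬝ᵥ v) = if v = 0 then (Fintype.card (β → ZMod 2) : ℂ) else 0 := by
  split_ifs with hv
  · simp [hv, sgn_zero]
  · obtain ⟨j, hj⟩ := Function.ne_iff.1 hv
    have h := Equiv.sum_comp (Equiv.addRight (Pi.single j 1 : β → ZMod 2))
      fun b => sgn (b ⬝ᵥ v)
    simp only [Equiv.coe_addRight, add_dotProduct, single_dotProduct,
      zmod2_eq_one_of_ne_zero hj, sgn_add, sgn_one, mul_neg, mul_one, Finset.sum_neg_distrib] at h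
    exact self_eq_neg.1 h.symm

/-! ### Measuring the ancillas of a cluster state -/

section Measurement

variable {O B : Type} [Fintype O] [DecidableEq O] [Fintype B] [DecidableEq B]

theorem hadamardOutcome_eq (φ : State (O ⊕ B)) (s : B → ZMod 2) (y : O → ZMod 2) :
    hadamardOutcome φ s y = (((Real.sqrt 2 : ℝ) : ℂ)⁻¹) ^ Fintype.card B *
      ∑ b : B → ZMod 2, sgn (s ⬝ᵥ b) * φ (Sum.elim y b) := by
  rw [hadamardOutcome, Finset.mul_sum]
  refine Finset.sum_congr rfl fun b _ => ?_
  have h : sgn (s ⬝ᵥ b) = ∏ i, sgn (s i * b i) := by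
    rw [dotProduct]
    induction (Finset.univ : Finset B) using Finset.induction_on with
    | empty => simp [sgn_zero]
    | insert i t hi ih => rw [Finset.sum_insert hi, Finset.prod_insert hi, sgn_add, ih]
  rw [Finset.prod_mul_distrib, h, Finset.prod_const, Finset.card_univ, mul_assoc]

theorem hadamardOutcome_smul (γ : ℂ) (φ : State (O ⊕ B)) (s : B → ZMod 2) :
    hadamardOutcome (γ • φ) s = γ • hadamardOutcome φ s := by
  funext y
  simp only [hadamardOutcome, Pi.smul_apply, smul_eq_mul, Finset.mul_sum]
  refine Finset.sum_congr rfl fun b _ => ?_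
  ring

/-- A `Z` error on a measured qubit flips its outcome, while an `X` error there only contributes a
sign. -/
theorem hadamardOutcome_applyPauli (P : PauliOp (O ⊕ B)) (φ : State (O ⊕ B)) (s : B → ZMod 2) :
    Proportional (hadamardOutcome (applyPauli P φ) s)
      (applyPauli (fun o => P (Sum.inl o))
        (hadamardOutcome φ (s + fun b => (P (Sum.inr b)).2))) := by
  refine ⟨sgn (s ⬝ᵥ fun b => (P (Sum.inr b)).1), ?_⟩
  funext y
  simp only [Pi.smul_apply, smul_eq_mul, applyPauli, hadamardOutcome_eq]
  rw [mul_left_comm (sgn (∑ q, _)), mul_left_comm (sgn (s ⬝ᵥ _))]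
  congr 1
  rw [Finset.mul_sum, Finset.mul_sum,
    ← Equiv.sum_comp (Equiv.addRight fun b => (P (Sum.inr b)).1)]
  refine Finset.sum_congr rfl fun b _ => ?_
  simp only [Equiv.coe_addRight, Fintype.sum_sum_type, Sum.elim_inl, Sum.elim_inr, Pi.add_apply,
    dotProduct_add, add_dotProduct, sgn_add]
  have h1 : (fun q => Sum.elim y (b + fun b => (P (Sum.inr b)).1) q + (P q).1) =
      Sum.elim (fun q => y q + (P (Sum.inl q)).1) b := by
    funext q
    rcases q with q | q
    · rfl
    · simp [add_assoc, CharTwo.add_self_eq_zero]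
  have h2 : ∑ i, (P (Sum.inr i)).2 * (b i + (P (Sum.inr i)).1 + (P (Sum.inr i)).1) =
      (fun b => (P (Sum.inr b)).2) ⬝ᵥ b := by
    refine Finset.sum_congr rfl fun i _ => ?_
    rw [add_assoc, CharTwo.add_self_eq_zero, add_zero]
  rw [h1, h2]
  ring

end Measurement

section Cluster

variable {O B₁ B₂ : Type} [Fintype O] [DecidableEq O] [Fintype B₁] [DecidableEq B₁] [Fintype B₂]
  [DecidableEq B₂] (N : Matrix B₂ (O ⊕ B₁) (ZMod 2))

/-- The state of the qubits `O` of the cluster state on the bipartite graph `N` after the outcomes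
`s₁` and `s₂` on the other qubits, up to normalisation. -/
noncomputable def clusterOutcome (s₁ : B₁ → ZMod 2) (s₂ : B₂ → ZMod 2) : State O := fun y =>
  ∑ b : B₁ → ZMod 2, if N *ᵥ Sum.elim y b = s₂ then sgn (s₁ ⬝ᵥ b) else 0

open Classical in
/-- The (unnormalised) state of the qubits `O` of the cluster state after trivial outcomes. -/
noncomputable def clusterTarget : State O := fun y =>
  if ∃ b : B₁ → ZMod 2, N *ᵥ Sum.elim y b = 0 then 1 else 0

/-- The pairs of an outcome of the ancilla measurements and a Pauli operator that the outcome
applies to the output qubits. -/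
def residual : Submodule (ZMod 2) ((B₁ ⊕ B₂ → ZMod 2) × PauliOp O) where
  carrier := {p | (∃ x, N *ᵥ x = p.1 ∘ Sum.inr ∧ ∀ o, x (Sum.inl o) = (p.2 o).1) ∧
    ∃ η, (∀ b, (η ᵥ* N) (Sum.inr b) = p.1 (Sum.inl b)) ∧ ∀ o, (η ᵥ* N) (Sum.inl o) = (p.2 o).2}
  add_mem' := by
    rintro p p' ⟨⟨x, hx, hx'⟩, η, hη, hη'⟩ ⟨⟨z, hz, hz'⟩, ζ, hζ, hζ'⟩
    refine ⟨⟨x + z, ?_, fun o => ?_⟩, η + ζ, fun b => ?_, fun o => ?_⟩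
    · rw [mulVec_add, hx, hz]; rfl
    · simp [hx', hz']
    · simp [add_vecMul, hη, hζ]
    · simp [add_vecMul, hη', hζ']
  zero_mem' := ⟨⟨0, by rw [mulVec_zero]; rfl, fun _ => rfl⟩, 0, by simp, by simp⟩
  smul_mem' := by
    rintro c p ⟨⟨x, hx, hx'⟩, η, hη, hη'⟩
    refine ⟨⟨c • x, ?_, fun o => ?_⟩, c • η, fun b => ?_, fun o => ?_⟩
    · rw [mulVec_smul, hx]; rfl
    · simp [hx']
    · simp [smul_vecMul, hη]
    · simp [smul_vecMul, hη']

theorem sum_elim_dotProduct (v : O ⊕ B₁ → ZMod 2) (y : O → ZMod 2) (b : B₁ → ZMod 2) :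
    v ⬝ᵥ Sum.elim y b = (v ∘ Sum.inl) ⬝ᵥ y + (v ∘ Sum.inr) ⬝ᵥ b := by
  simp [dotProduct, Fintype.sum_sum_type]

variable {N}

/-- Translation by `x` makes the linear system homogeneous, at the cost of the `X` part of `P`. On
homogeneous solutions `η ᵥ* N` vanishes, so the sign given by the first outcomes depends on the
outputs alone and is the `Z` part of `P`. What is left is a number of solutions, the same for all
output strings that have one. -/
theorem clusterOutcome_proportional {s : B₁ ⊕ B₂ → ZMod 2} {P : PauliOp O}
    (h : (s, P) ∈ residual N) :
    Proportional (clusterOutcome N (s ∘ Sum.inl) (s ∘ Sum.inr)) (applyPauli P (clusterTarget N)) := by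
  classical
  obtain ⟨⟨x, hx, hx'⟩, η, hη, hη'⟩ := h
  dsimp only at hx hx' hη hη'
  refine ⟨sgn ((s ∘ Sum.inl) ⬝ᵥ (x ∘ Sum.inr)) *
    (Finset.univ.filter fun b : B₁ → ZMod 2 => N *ᵥ Sum.elim 0 b = 0).card, ?_⟩
  funext y
  have hshift : ∀ b, N *ᵥ Sum.elim y (b + x ∘ Sum.inr) = s ∘ Sum.inr ↔
      N *ᵥ Sum.elim (fun o => y o + (P o).1) b = 0 := by
    intro b
    have : Sum.elim y (b + x ∘ Sum.inr) = Sum.elim (fun o => y o + (P o).1) b + x := by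
      funext q
      rcases q with q | q
      · simp [hx', add_assoc, CharTwo.add_self_eq_zero]
      · rfl
    rw [this, mulVec_add, hx]
    exact add_eq_right
  have hsgn : ∀ y' b, N *ᵥ Sum.elim y' b = 0 →
      sgn ((s ∘ Sum.inl) ⬝ᵥ b) = sgn (∑ o, (P o).2 * y' o) := by
    intro y' b hb
    have h0 : (η ᵥ* N) ⬝ᵥ Sum.elim y' b = 0 := by
      rw [← dotProduct_mulVec, hb, dotProduct_zero]
    rw [sum_elim_dotProduct] at h0
    have h1 : (η ᵥ* N) ∘ Sum.inr = s ∘ Sum.inl := funext hη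
    have h2 : (η ᵥ* N) ∘ Sum.inl = fun o => (P o).2 := funext hη'
    rw [h1, h2, CharTwo.add_eq_zero] at h0
    rw [← h0]
    rfl
  simp only [clusterOutcome, Pi.smul_apply, smul_eq_mul, applyPauli]
  rw [← Equiv.sum_comp (Equiv.addRight (x ∘ Sum.inr))]
  simp only [Equiv.coe_addRight, hshift, dotProduct_add, sgn_add]
  have hy' : ∑ q, (P q).2 * (y q + (P q).1) =
    ∑ q, (P q).2 * (fun o => y o + (P o).1) q := rfl
  rw [hy']
  generalize (fun o => y o + (P o).1) = y' at *
  rw [← Finset.sum_filter]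
  have hsum : ∀ b ∈ Finset.univ.filter (fun b => N *ᵥ Sum.elim y' b = 0),
      sgn ((s ∘ Sum.inl) ⬝ᵥ b) * sgn ((s ∘ Sum.inl) ⬝ᵥ (x ∘ Sum.inr)) =
        sgn (∑ o, (P o).2 * y' o) * sgn ((s ∘ Sum.inl) ⬝ᵥ (x ∘ Sum.inr)) := by
    intro b hb
    rw [hsgn y' b (by simpa using hb)]
  rw [Finset.sum_congr rfl hsum, Finset.sum_const, nsmul_eq_mul]
  by_cases hy : ∃ b : B₁ → ZMod 2, N *ᵥ Sum.elim y' b = 0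
  · obtain ⟨b₀, hb₀⟩ := hy
    have hcard : (Finset.univ.filter fun b : B₁ → ZMod 2 => N *ᵥ Sum.elim y' b = 0).card =
        (Finset.univ.filter fun b : B₁ → ZMod 2 => N *ᵥ Sum.elim 0 b = 0).card := by
      refine Finset.card_equiv (Equiv.addRight b₀) fun b => ?_
      have : Sum.elim y' b = Sum.elim (0 : O → ZMod 2) (b + b₀) + Sum.elim y' b₀ := by
        funext q
        rcases q with q | q
        · simp
        · simp [add_assoc, CharTwo.add_self_eq_zero]
      simp only [Finset.mem_filter, Finset.mem_univ, true_and, Equiv.coe_addRight]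
      rw [this, mulVec_add, hb₀, add_zero]
    rw [hcard, clusterTarget, if_pos ⟨b₀, hb₀⟩]
    ring
  · rw [clusterTarget, if_neg hy, Finset.filter_false_of_mem fun b _ h => hy ⟨b, h⟩]
    simp

/-- If the state does not vanish, some basis state satisfies the linear system. Moreover the first
outcomes vanish on the kernel of the columns `B₁`, since translating the sum by a kernel vector on
which they equal 1 would change its sign; hence they are a combination of rows. -/
theorem exists_mem_residual {s : B₁ ⊕ B₂ → ZMod 2}
    (h : clusterOutcome N (s ∘ Sum.inl) (s ∘ Sum.inr) ≠ 0) : ∃ P, (s, P) ∈ residual N := by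
  have h1 : ∃ y b, N *ᵥ Sum.elim y b = s ∘ Sum.inr := by
    by_contra! hne
    exact h (funext fun y => Finset.sum_eq_zero fun b _ => if_neg (hne y b))
  have h2 : ∀ k, (N.submatrix id Sum.inr) *ᵥ k = 0 → (s ∘ Sum.inl) ⬝ᵥ k = 0 := by
    intro k hk
    by_contra hne
    refine h (funext fun y => self_eq_neg.1 ?_)
    have hk' : N *ᵥ Sum.elim (0 : O → ZMod 2) k = 0 := by
      rw [← hk]
      funext i
      simp [mulVec, dotProduct, Fintype.sum_sum_type]
    have hb : ∀ b, N *ᵥ Sum.elim y (b + k) = N *ᵥ Sum.elim y b := by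
      intro b
      have : Sum.elim y (b + k) = Sum.elim y b + Sum.elim (0 : O → ZMod 2) k := by
        funext q; rcases q with q | q <;> simp
      rw [this, mulVec_add, hk', add_zero]
    conv_lhs => rw [clusterOutcome, ← Equiv.sum_comp (Equiv.addRight k)]
    simp only [Equiv.coe_addRight, hb, dotProduct_add, sgn_add, zmod2_eq_one_of_ne_zero hne,
      sgn_one, mul_neg, mul_one, clusterOutcome]
    rw [← Finset.sum_neg_distrib]
    refine Finset.sum_congr rfl fun b _ => ?_
    split_ifs <;> simp
  obtain ⟨y, b, hyb⟩ := h1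
  obtain ⟨η, hη⟩ := exists_vecMul_eq_of_forall_mulVec _ _ h2
  exact ⟨fun o => (y o, (η ᵥ* N) (Sum.inl o)), ⟨Sum.elim y b, hyb, fun _ => rfl⟩, η,
    fun b => congrFun hη b, fun _ => rfl⟩

theorem applyPauli_clusterTarget {P : PauliOp O} (h : (0, P) ∈ residual N) :
    applyPauli P (clusterTarget N) = clusterTarget N := by
  obtain ⟨⟨x, hx, hx'⟩, η, hη, hη'⟩ := h
  dsimp only at hx hx' hη hη'
  funext y
  have hx0 : N *ᵥ x = 0 := hx
  have hxe : x = Sum.elim (fun o => (P o).1) (x ∘ Sum.inr) := by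
    funext q
    rcases q with q | q
    · exact hx' q
    · rfl
  have hiff : (∃ b, N *ᵥ Sum.elim (fun q => y q + (P q).1) b = 0) ↔
      ∃ b, N *ᵥ Sum.elim y b = 0 := by
    have key : ∀ y' b, N *ᵥ Sum.elim y' b = 0 →
        N *ᵥ Sum.elim (fun q => y' q + (P q).1) (b + x ∘ Sum.inr) = 0 := by
      intro y' b hb
      have : Sum.elim (fun q => y' q + (P q).1) (b + x ∘ Sum.inr) = Sum.elim y' b + x := by
        funext q
        rcases q with q | q
        · simp [hx']
        · rfl
      rw [this, mulVec_add, hb, hx0, add_zero]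
    refine ⟨fun ⟨b, hb⟩ => ⟨b + x ∘ Sum.inr, ?_⟩, fun ⟨b, hb⟩ => ⟨_, key _ _ hb⟩⟩
    · simpa [add_assoc, CharTwo.add_self_eq_zero] using key _ _ hb
  simp only [applyPauli, clusterTarget, hiff]
  split_ifs with hy
  · obtain ⟨b, hb⟩ := hiff.2 hy
    have h0 : (η ᵥ* N) ⬝ᵥ Sum.elim (fun q => y q + (P q).1) b = 0 := by
      rw [← dotProduct_mulVec, hb, dotProduct_zero]
    rw [sum_elim_dotProduct] at h0
    have h1 : (η ᵥ* N) ∘ Sum.inr = 0 := funext hη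
    have h2 : (η ᵥ* N) ∘ Sum.inl = fun o => (P o).2 := funext hη'
    rw [h1, h2, zero_dotProduct, add_zero] at h0
    have h3 : ∑ q, (P q).2 * (y q + (P q).1) = 0 := h0
    rw [h3, sgn_zero, one_mul]
  · simp

/-! ### The single-shot procedure of a cluster state -/

variable (N) {a : ℕ} (e : Fin a ≃ B₁ ⊕ B₂)

/-- The position of the qubits on the first side of the cluster state. -/
def sideOne : O ⊕ B₁ → O ⊕ Fin a := Sum.map id fun b => e.symm (Sum.inl b)

/-- The position of the qubits on the second side of the cluster state. -/
def sideTwo : B₂ → O ⊕ Fin a := fun b => Sum.inr (e.symm (Sum.inr b))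

theorem sideOne_injective : Function.Injective (sideOne (O := O) e) := by
  rintro (u | u) (v | v) h <;> simp_all [sideOne]

theorem sideTwo_injective : Function.Injective (sideTwo (O := O) e) := by
  intro u v h
  simpa [sideTwo] using h

theorem sideOne_ne_sideTwo (u : O ⊕ B₁) (v : B₂) : sideOne e u ≠ sideTwo (O := O) e v := by
  rcases u with u | u <;> simp [sideOne, sideTwo]

/-- The edges of the cluster state. -/
def clusterEdges : Finset ((O ⊕ B₁) × B₂) := Finset.univ.filter fun p => N p.2 p.1 ≠ 0

/-- Adjacency in the cluster state. -/
def ClusterAdj (v u : O ⊕ Fin a) : Prop := ∃ p ∈ clusterEdges N,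
  (v = sideOne e p.1 ∧ u = sideTwo e p.2) ∨ (v = sideTwo e p.2 ∧ u = sideOne e p.1)

/-- The procedure that prepares a cluster state with one layer of Hadamard gates and one layer of
controlled-`Z` gates for each colour of edges. -/
noncomputable def clusterProcedure {C : ℕ} (col : (O ⊕ B₁) × B₂ → Fin C)
    (hcol : ∀ p ∈ clusterEdges N, ∀ p' ∈ clusterEdges N, p ≠ p' → col p = col p' →
      p.1 ≠ p'.1 ∧ p.2 ≠ p'.2) (recover : (Fin a → ZMod 2) → PauliOp O) : Procedure O a where
  depth := C + 1
  layers := Fin.cons (hadamardLayer _) fun t =>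
    czLayer (sideOne e) (sideTwo e) (sideOne_ne_sideTwo e) ((clusterEdges N).filter (col · = t)) (by
      intro p hp p' hp' hne
      simp only [Finset.coe_filter, Set.mem_ofPred_eq] at hp hp'
      have h := hcol p hp.1 p' hp'.1 hne (hp.2.trans hp'.2.symm)
      exact ⟨(sideOne_injective e).ne h.1, (sideTwo_injective e).ne h.2⟩)
  recover := recover

/-- The cluster state, up to normalisation. -/
noncomputable def clusterState : State (O ⊕ Fin a) := fun x =>
  sgn (∑ i, x (sideTwo e i) * (N *ᵥ (x ∘ sideOne e)) i)

theorem czPhase_clusterEdges (x : O ⊕ Fin a → ZMod 2) :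
    czPhase (sideOne e) (sideTwo e) (clusterEdges N) x =
      ∑ i, x (sideTwo e i) * (N *ᵥ (x ∘ sideOne e)) i := by
  rw [czPhase, clusterEdges, Finset.sum_filter, Fintype.sum_prod_type, Finset.sum_comm]
  refine Finset.sum_congr rfl fun i _ => ?_
  rw [mulVec, dotProduct, Finset.mul_sum]
  refine Finset.sum_congr rfl fun u _ => ?_
  dsimp only
  split_ifs with h
  · rw [zmod2_eq_one_of_ne_zero h, one_mul, mul_comm]; rfl
  · rw [not_not.1 h, zero_mul, mul_zero]

theorem noisyState_clusterProcedure {C : ℕ} (col : (O ⊕ B₁) × B₂ → Fin C)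
    (hcol : ∀ p ∈ clusterEdges N, ∀ p' ∈ clusterEdges N, p ≠ p' → col p = col p' →
      p.1 ≠ p'.1 ∧ p.2 ≠ p'.2) (recover : (Fin a → ZMod 2) → PauliOp O)
    (E : (clusterProcedure N e col hcol recover).Errors) :
    ∃ F : PauliOp (O ⊕ Fin a), SpreadFrom (ClusterAdj N e) {v | ∃ t, E t v ≠ 0} F ∧
      Proportional ((clusterProcedure N e col hcol recover).noisyState E)
        (applyPauli F (clusterState N e)) := by
  have hE : ∀ t, SpreadFrom (ClusterAdj N e) {v | ∃ t, E t v ≠ 0} (E t) := fun t =>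
    ⟨fun v hv => ⟨t, fun h => hv (by rw [h]; rfl)⟩,
      fun v hv => Or.inl ⟨t, fun h => hv (by rw [h]; rfl)⟩⟩
  have h0 : SpreadFrom (ClusterAdj N e) {v | ∃ t, E t v ≠ 0}
      (fun q => ((0 : ZMod 2), (E 0 q).1)) :=
    ⟨fun v hv => absurd rfl hv, fun v hv => Or.inl ⟨0, fun h => hv (by
      dsimp only; rw [h]; rfl)⟩⟩
  obtain ⟨R, hR, h⟩ := foldl_czLayers (sideOne e) (sideTwo e) (sideOne_ne_sideTwo e) C
    (fun t => (clusterEdges N).filter (col · = t)) (by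
      intro t p hp p' hp' hne
      simp only [Finset.coe_filter, Set.mem_ofPred_eq] at hp hp'
      have h := hcol p hp.1 p' hp'.1 hne (hp.2.trans hp'.2.symm)
      exact ⟨(sideOne_injective e).ne h.1, (sideTwo_injective e).ne h.2⟩)
    (fun t => E t.succ.succ) (E (Fin.succ (0 : Fin (C + 1))) + fun q => ((0 : ZMod 2), (E 0 q).1)) _ (fun _ => 1)
    (ClusterAdj N e) {v | ∃ t, E t v ≠ 0}
    (((hadamardLayer_apply (E 0)).applyPauli (E (Fin.succ (0 : Fin (C + 1))))).trans
      (proportional_applyPauli_applyPauli _ _ _))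
    (fun t p hp => by
      have hp := (Finset.mem_filter.1 hp).1
      exact ⟨⟨p, hp, Or.inl ⟨rfl, rfl⟩⟩, ⟨p, hp, Or.inr ⟨rfl, rfl⟩⟩⟩)
    ((hE _).add h0) fun t => hE _
  refine ⟨R, hR, ?_⟩
  have hstate : (fun x => sgn (∑ t, czPhase (sideOne e) (sideTwo e)
      ((clusterEdges N).filter (col · = t)) x) * 1) = clusterState N e := by
    funext x
    rw [mul_one, clusterState, ← czPhase_clusterEdges]
    congr 1
    simp only [czPhase]
    exact Finset.sum_fiberwise _ _ _
  rw [hstate] at h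
  have hfold : (clusterProcedure N e col hcol recover).noisyState E = Fin.foldl (C + 1)
      (fun φ t => applyPauli (E t.succ)
        (((clusterProcedure N e col hcol recover).layers t).apply φ))
      (applyPauli (E 0) (zeroState (O ⊕ Fin a))) := rfl
  rw [hfold, Fin.foldl_succ]
  exact h

/-- The second side enters the phase linearly, so by orthogonality of characters its outcomes impose
a linear system on the first side. -/
theorem hadamardOutcome_clusterState (s : Fin a → ZMod 2) :
    Proportional (hadamardOutcome (clusterState N e) s)
      (clusterOutcome N (fun b => s (e.symm (Sum.inl b))) fun b => s (e.symm (Sum.inr b))) := by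
  refine ⟨(((Real.sqrt 2 : ℝ) : ℂ)⁻¹) ^ Fintype.card (Fin a) *
    (Fintype.card (B₂ → ZMod 2) : ℂ), ?_⟩
  funext y
  rw [hadamardOutcome_eq, Pi.smul_apply, smul_eq_mul, mul_assoc]
  congr 1
  let E : (Fin a → ZMod 2) ≃ (B₁ → ZMod 2) × (B₂ → ZMod 2) :=
    (e.arrowCongr (Equiv.refl _)).trans (Equiv.sumArrowEquivProdArrow _ _ _)
  rw [← E.symm.sum_comp, Fintype.sum_prod_type, clusterOutcome, Finset.mul_sum]
  refine Finset.sum_congr rfl fun b₁ _ => ?_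
  have hinl : ∀ b₂ b, E.symm (b₁, b₂) (e.symm (Sum.inl b)) = b₁ b := by intro b₂ b; simp [E]
  have hinr : ∀ b₂ b, E.symm (b₁, b₂) (e.symm (Sum.inr b)) = b₂ b := by intro b₂ b; simp [E]
  have h1 : ∀ b₂, sgn (s ⬝ᵥ E.symm (b₁, b₂)) * clusterState N e (Sum.elim y (E.symm (b₁, b₂))) =
      sgn ((fun b => s (e.symm (Sum.inl b))) ⬝ᵥ b₁) *
        sgn (b₂ ⬝ᵥ ((fun b => s (e.symm (Sum.inr b))) + N *ᵥ Sum.elim y b₁)) := by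
    intro b₂
    have h2 : Sum.elim y (E.symm (b₁, b₂)) ∘ sideOne e = Sum.elim y b₁ := by
      funext q
      rcases q with q | q
      · rfl
      · exact hinl _ _
    rw [clusterState, h2, ← sgn_add, ← sgn_add]
    congr 1
    simp only [dotProduct, sideTwo, Sum.elim_inr, hinr, Pi.add_apply, mul_add,
      Finset.sum_add_distrib]
    rw [← e.symm.sum_comp, Fintype.sum_sum_type]
    simp only [hinl, hinr, mul_comm, add_assoc]
  simp only [h1]
  rw [← Finset.mul_sum, sum_sgn_dotProduct]
  simp only [add_eq_zero_iff_eq_of_zmod_two]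
  by_cases h : (fun b => s (e.symm (Sum.inr b))) = N *ᵥ Sum.elim y b₁
  · rw [if_pos h, if_pos h.symm, mul_comm]
  · rw [if_neg h, if_neg (Ne.symm h), mul_zero, mul_zero]

/-- Decoding: if the recovery applies the Pauli operator `ρ` of the outcome with the errors guessed
from the parity checks `L` removed, then the state is prepared up to a residual error. -/
theorem clusterProcedure_prepares {C : ℕ} (col : (O ⊕ B₁) × B₂ → Fin C)
    (hcol : ∀ p ∈ clusterEdges N, ∀ p' ∈ clusterEdges N, p ≠ p' → col p = col p' →
      p.1 ≠ p'.1 ∧ p.2 ≠ p'.2) {target : State O} (htarget : Proportional (clusterTarget N) target)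
    {Λ : Type} (L : (B₁ ⊕ B₂ → ZMod 2) →ₗ[ZMod 2] (Λ → ZMod 2))
    (hL : ∀ s P, (s, P) ∈ residual N → L s = 0)
    (ρ : (B₁ ⊕ B₂ → ZMod 2) →ₗ[ZMod 2] PauliOp O)
    (hρ : ∀ s P, (s, P) ∈ residual N → (s, ρ s) ∈ residual N)
    (dec : (Λ → ZMod 2) → B₁ ⊕ B₂ → ZMod 2) (res : (B₁ ⊕ B₂ → ZMod 2) → PauliOp O)
    (hres : ∀ f, (0, res f - ρ (f + dec (L f))) ∈ residual N) :
    let W := clusterProcedure N e col hcol fun s =>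
      ρ ((fun b => s (e.symm b)) + dec (L fun b => s (e.symm b)))
    ∃ F : W.Errors → PauliOp (O ⊕ Fin a),
      (∀ E, SpreadFrom (ClusterAdj N e) {v | ∃ t, E t v ≠ 0} (F E)) ∧
      W.Prepares (fun E => (fun o => F E (Sum.inl o)) +
        res fun b => (F E (Sum.inr (e.symm b))).2) target := by
  intro W
  choose F hF hstate using noisyState_clusterProcedure N e col hcol fun s =>
      ρ ((fun b => s (e.symm b)) + dec (L fun b => s (e.symm b)))
  refine ⟨F, hF, fun E s => ?_⟩
  set f : B₁ ⊕ B₂ → ZMod 2 := fun b => (F E (Sum.inr (e.symm b))).2 with hf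
  set s' : B₁ ⊕ B₂ → ZMod 2 := fun b => s (e.symm b) with hs'
  set P : PauliOp O := fun o => F E (Sum.inl o) with hP
  have h1 : Proportional (hadamardOutcome (W.noisyState E) s)
      (applyPauli P (clusterOutcome N ((s' + f) ∘ Sum.inl) ((s' + f) ∘ Sum.inr))) := by
    obtain ⟨γ, hγ⟩ := hstate E
    have h2 : hadamardOutcome (W.noisyState E) s =
        γ • hadamardOutcome (applyPauli (F E) (clusterState N e)) s := by
      rw [← hadamardOutcome_smul, ← hγ]
    refine Proportional.trans ⟨γ, h2⟩ ((hadamardOutcome_applyPauli _ _ _).trans ?_)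
    exact (hadamardOutcome_clusterState N e _).applyPauli _
  have hrec : W.recover s = ρ (s' + dec (L s')) := rfl
  rw [hrec]
  -- An outcome of amplitude zero is covered by the scalar 0. Otherwise `s' + f` occurs in
  -- `residual`, where the checks vanish, so the observed `s'` has the syndrome of the unknown `f`.
  by_cases h0 : clusterOutcome N ((s' + f) ∘ Sum.inl) ((s' + f) ∘ Sum.inr) = 0
  · obtain ⟨γ, hγ⟩ := h1
    refine ⟨0, ?_⟩
    rw [hγ, h0]
    funext y
    simp [applyPauli]
  · obtain ⟨P₀, hP₀⟩ := exists_mem_residual h0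
    have hLs : L s' = L f := by
      have := hL _ _ hP₀
      rw [map_add] at this
      exact add_eq_zero_iff_eq_of_zmod_two.1 this
    -- By linearity of `ρ`, the total Pauli operator differs from `P + res f` by two terms that pair
    -- with the zero outcome in `residual` and so stabilize the target.
    have hsum : ρ (s' + dec (L s')) + (P + P₀) = P + res f +
        (res f - ρ (f + dec (L f)) + (ρ (s' + f) - P₀)) := by
      have h2 : ∀ v : PauliOp O, v + v = 0 := ZModModule.add_self
      have h3 : P + res f + (res f - ρ (f + dec (L f)) + (ρ (s' + f) - P₀)) =
          ρ (s' + dec (L s')) + (P + P₀) + (res f + res f) + (ρ f + ρ f) := by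
        simp only [map_add, hLs, ZModModule.sub_eq_add]
        abel
      rw [h3, h2, h2, add_zero, add_zero]
    have hstab : (0, res f - ρ (f + dec (L f)) + (ρ (s' + f) - P₀)) ∈ residual N := by
      have := (residual N).add_mem (hres f) ((residual N).sub_mem (hρ _ _ hP₀) hP₀)
      simpa using this
    have h2 := ((clusterOutcome_proportional hP₀).applyPauli P).trans
      (proportional_applyPauli_applyPauli _ _ _)
    have h3 := ((h1.trans h2).applyPauli (ρ (s' + dec (L s')))).trans
      (proportional_applyPauli_applyPauli _ _ _)
    rw [hsum] at h3
    have h4 := h3.trans (proportional_applyPauli_add _ _ _)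
    rw [applyPauli_clusterTarget hstab] at h4
    exact h4.trans (htarget.applyPauli _)

end Cluster

/-! ### The encoded state -/

theorem finrank_ker_mulVecLin {a n : ℕ} {A : Matrix (Fin a) (Fin n) (ZMod 2)}
    (h : LinearIndependent (ZMod 2) A.row) :
    a + Module.finrank (ZMod 2) (LinearMap.ker A.mulVecLin) = n := by
  have h1 := A.mulVecLin.finrank_range_add_finrank_ker
  have h2 : Module.finrank (ZMod 2) (LinearMap.range A.mulVecLin) = a := by
    have := h.rank_matrix
    rwa [Fintype.card_fin] at this
  rw [h2, Module.finrank_fin_fun] at h1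
  exact h1

theorem finrank_span_row {a n : ℕ} {A : Matrix (Fin a) (Fin n) (ZMod 2)}
    (h : LinearIndependent (ZMod 2) A.row) :
    Module.finrank (ZMod 2) (Submodule.span (ZMod 2) (Set.range A.row)) = a := by
  rw [finrank_span_eq_card h, Fintype.card_fin]

theorem span_row_le_ker {α β n : Type} [Fintype n] {A : Matrix α n (ZMod 2)}
    {B : Matrix β n (ZMod 2)} (h : B * Aᵀ = 0) :
    Submodule.span (ZMod 2) (Set.range A.row) ≤ LinearMap.ker B.mulVecLin := by
  rw [Submodule.span_le]
  rintro _ ⟨i, rfl⟩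
  funext j
  exact congrFun (congrFun h j) i

theorem mul_transpose_eq_zero_symm {α β n : Type} [Fintype n] {A : Matrix α n (ZMod 2)}
    {B : Matrix β n (ZMod 2)} (h : A * Bᵀ = 0) : B * Aᵀ = 0 := by
  rw [← transpose_transpose (B * Aᵀ), transpose_mul, transpose_transpose, h, transpose_zero]

theorem mem_span_row {α n : Type} [Fintype α] {A : Matrix α n (ZMod 2)} {v : n → ZMod 2} :
    v ∈ Submodule.span (ZMod 2) (Set.range A.row) ↔ ∃ x : α → ZMod 2, x ᵥ* A = v := by
  rw [Submodule.mem_span_range_iff_exists_fun]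
  refine exists_congr fun x => ?_
  rw [vecMul_eq_sum]
  rfl

namespace CSSGenerators

variable {m : ℕ} (S : CSSGenerators m)

/-- Commutation gives one inclusion, and the dimensions agree because the set of generators is
complete. -/
theorem ker_SZ : LinearMap.ker S.SZ.mulVecLin = Submodule.span (ZMod 2) (Set.range S.SX.row) := by
  refine (Submodule.eq_of_le_of_finrank_eq
    (span_row_le_ker (mul_transpose_eq_zero_symm S.comm)) ?_).symm
  have h1 := finrank_ker_mulVecLin S.indepZ
  have h2 := finrank_span_row S.indepX
  have h3 := S.complete
  omega

theorem ker_SX : LinearMap.ker S.SX.mulVecLin = Submodule.span (ZMod 2) (Set.range S.SZ.row) := by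
  refine (Submodule.eq_of_le_of_finrank_eq (span_row_le_ker S.comm) ?_).symm
  have h1 := finrank_ker_mulVecLin S.indepX
  have h2 := finrank_span_row S.indepZ
  have h3 := S.complete
  omega

variable {S}

/-- The `X` generators make the amplitudes constant on cosets of `ker SZ`, and a violated `Z`
generator makes an amplitude equal to its negative. -/
theorem IsStabilizerState.apply_eq {ψ : State (Fin m)} (h : S.IsStabilizerState ψ)
    (x : Fin m → ZMod 2) : ψ x = if S.SZ *ᵥ x = 0 then ψ 0 else 0 := by
  obtain ⟨-, hX, hZ⟩ := h
  split_ifs with hx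
  · have hmem : x ∈ Submodule.span (ZMod 2) (Set.range S.SX.row) := by
      rw [← S.ker_SZ]
      exact hx
    have key : ∀ v ∈ Submodule.span (ZMod 2) (Set.range S.SX.row), ∀ u, ψ (u + v) = ψ u := by
      intro v hv
      induction hv using Submodule.span_induction with
      | mem v hv =>
        obtain ⟨r, rfl⟩ := hv
        intro u
        have := congrFun (hX r) u
        simp only [applyPauli, zero_mul, Finset.sum_const_zero, sgn_zero, one_mul] at this
        exact this
      | zero => intro u; rw [add_zero]
      | add v w _ _ ihv ihw => intro u; rw [← add_assoc, ihw, ihv]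
      | smul c v _ ihv =>
        intro u
        rcases zmod2_eq_zero_or_one c with rfl | rfl
        · rw [zero_smul, add_zero]
        · rw [one_smul, ihv]
    rw [← zero_add x, key x hmem]
  · obtain ⟨c, hc⟩ := Function.ne_iff.1 hx
    have := congrFun (hZ c) x
    simp only [applyPauli, add_zero] at this
    have h1 : ∑ i, S.SZ c i * x i = 1 := zmod2_eq_one_of_ne_zero hc
    rw [h1, sgn_one, neg_one_mul] at this
    exact self_eq_neg.1 this.symm

theorem IsStabilizerState.zero_ne_zero {ψ : State (Fin m)} (h : S.IsStabilizerState ψ) :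
    ψ 0 ≠ 0 := by
  intro h0
  have h1 := h.1
  rw [Finset.sum_eq_zero] at h1
  · exact zero_ne_one h1
  · intro x _
    rw [h.apply_eq x, h0]
    simp

end CSSGenerators

namespace CSSCode

variable {n : ℕ} {Q : CSSCode n}

theorem stabX_le_ker : Q.stabX ≤ LinearMap.ker Q.HZ.mulVecLin :=
  span_row_le_ker (mul_transpose_eq_zero_symm Q.comm)

theorem LogicalBasis.lz_mulVec_of_mem_stabX (B : Q.LogicalBasis) {v : Fin n → ZMod 2}
    (hv : v ∈ Q.stabX) : B.lz *ᵥ v = 0 :=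
  span_row_le_ker (mul_transpose_eq_zero_symm B.lz_comm) hv

theorem LogicalBasis.lz_mulVec_sum (B : Q.LogicalBasis) (x : Fin Q.k → ZMod 2) :
    B.lz *ᵥ (∑ j, x j • B.lx.row j) = x := by
  have h : ∑ j, x j • B.lx.row j = x ᵥ* B.lx := (vecMul_eq_sum _ _).symm
  rw [h, ← mulVec_transpose, mulVec_mulVec]
  have h2 : B.lz * B.lxᵀ = 1 := by
    rw [← transpose_transpose (B.lz * B.lxᵀ), transpose_mul, transpose_transpose, B.dual,
      transpose_one]
  rw [h2, one_mulVec]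

/-- The kernel of `HZ` is the direct sum of the span of `lx` and `stabX`: pairing with `lz` shows
that they are independent, and the dimensions add up. -/
theorem LogicalBasis.sub_mem_stabX (B : Q.LogicalBasis) {v : Fin n → ZMod 2}
    (hv : Q.HZ *ᵥ v = 0) : v - ∑ j, (B.lz *ᵥ v) j • B.lx.row j ∈ Q.stabX := by
  have hle : Submodule.span (ZMod 2) (Set.range B.lx.row) ⊔ Q.stabX ≤
      LinearMap.ker Q.HZ.mulVecLin :=
    sup_le (span_row_le_ker B.lx_comm) stabX_le_ker
  have hind : LinearIndependent (ZMod 2) B.lx.row := by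
    rw [Fintype.linearIndependent_iff]
    intro x hx
    have := B.lz_mulVec_sum x
    rw [hx, mulVec_zero] at this
    exact fun i => (congrFun this i).symm
  have hinf : Submodule.span (ZMod 2) (Set.range B.lx.row) ⊓ Q.stabX = ⊥ := by
    rw [eq_bot_iff]
    rintro v ⟨hv, hv'⟩
    obtain ⟨x, rfl⟩ := (Submodule.mem_span_range_iff_exists_fun _).1 hv
    have h1 := B.lz_mulVec_of_mem_stabX hv'
    rw [B.lz_mulVec_sum] at h1
    simp [h1]
  have heq : Submodule.span (ZMod 2) (Set.range B.lx.row) ⊔ Q.stabX =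
      LinearMap.ker Q.HZ.mulVecLin := by
    refine Submodule.eq_of_le_of_finrank_eq hle ?_
    have h1 := Submodule.finrank_sup_add_finrank_inf_eq
      (Submodule.span (ZMod 2) (Set.range B.lx.row)) Q.stabX
    rw [hinf, finrank_bot, finrank_span_row hind] at h1
    have h2 : Module.finrank (ZMod 2) Q.stabX = Q.mx := finrank_span_row Q.fullRankX
    have h3 := finrank_ker_mulVecLin Q.fullRankZ
    -- This makes the truncated subtraction in the definition of `k` a true one.
    have h4 := Submodule.finrank_mono (stabX_le_ker (Q := Q))
    have h5 : Q.k = n - Q.mx - Q.mz := rfl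
    omega
  have hmem : v ∈ Submodule.span (ZMod 2) (Set.range B.lx.row) ⊔ Q.stabX := by
    rw [heq]
    exact hv
  obtain ⟨u, hu, s, hs, rfl⟩ := Submodule.mem_sup.1 hmem
  obtain ⟨x, rfl⟩ := (Submodule.mem_span_range_iff_exists_fun _).1 hu
  rw [mulVec_add, B.lz_mulVec_sum, B.lz_mulVec_of_mem_stabX hs, add_zero, add_sub_cancel_left]
  exact hs

theorem LogicalBasis.mem_stabX_iff (B : Q.LogicalBasis) {v : Fin n → ZMod 2}
    (hv : Q.HZ *ᵥ v = 0) : v ∈ Q.stabX ↔ B.lz *ᵥ v = 0 := by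
  refine ⟨B.lz_mulVec_of_mem_stabX, fun h => ?_⟩
  have := B.sub_mem_stabX hv
  simpa [h] using this

theorem LogicalBasis.sub_mem_stabX_iff (B : Q.LogicalBasis) {v : Fin n → ZMod 2}
    (x : Fin Q.k → ZMod 2) :
    v - ∑ j, x j • B.lx.row j ∈ Q.stabX ↔ Q.HZ *ᵥ v = 0 ∧ x = B.lz *ᵥ v := by
  constructor
  · intro h
    have h1 : Q.HZ *ᵥ (v - ∑ j, x j • B.lx.row j) = 0 := stabX_le_ker h
    have h2 : Q.HZ *ᵥ (∑ j, x j • B.lx.row j) = 0 := by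
      refine span_row_le_ker B.lx_comm ?_
      exact (Submodule.mem_span_range_iff_exists_fun _).2 ⟨x, rfl⟩
    have h3 := B.lz_mulVec_of_mem_stabX h
    rw [mulVec_sub, sub_eq_zero] at h1 h3
    rw [B.lz_mulVec_sum] at h3
    exact ⟨h1.trans h2, h3.symm⟩
  · rintro ⟨h, rfl⟩
    exact B.sub_mem_stabX h

/-- The `X`-type operators that stabilize the encoded state. -/
def encodedX (Q : CSSCode n) {m : ℕ} (S : CSSGenerators m) : Set (Fin m × Fin n → ZMod 2) :=
  {y | (∀ i, (Q.HZ *ᵥ fun q => y (i, q)) = 0) ∧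
    ∀ c, (∑ i, S.SZ c i • fun q => y (i, q)) ∈ Q.stabX}

-- The string `y` determines the logical label `B.lz *ᵥ y_i` of every block, so the sum over labels
-- has at most one nonzero term. The labels satisfy the `Z` generators exactly when the
-- corresponding combinations of blocks have label zero, that is, lie in `stabX`.
open Classical in
theorem LogicalBasis.encode_eq (B : Q.LogicalBasis) {m : ℕ} {S : CSSGenerators m}
    {ψ : State (Fin m)} (hψ : S.IsStabilizerState ψ) :
    ∃ κ : ℂ, κ ≠ 0 ∧
      B.encode ψ = κ • fun y => if y ∈ encodedX Q S then (1 : ℂ) else 0 := by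
  set K : ℂ := ((Real.sqrt (Nat.card Q.stabX) : ℝ) : ℂ)⁻¹ with hK
  have hK0 : K ≠ 0 := by
    rw [hK]
    refine inv_ne_zero (Complex.ofReal_ne_zero.2 (Real.sqrt_ne_zero'.2 ?_))
    exact_mod_cast Nat.card_pos
  refine ⟨ψ 0 ^ Q.k * K ^ m, mul_ne_zero (pow_ne_zero _ hψ.zero_ne_zero) (pow_ne_zero _ hK0), ?_⟩
  funext y
  simp only [LogicalBasis.encode, basisState, B.sub_mem_stabX_iff, Pi.smul_apply, smul_eq_mul]
  by_cases hy : ∀ i, (Q.HZ *ᵥ fun q => y (i, q)) = 0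
  · rw [Finset.sum_eq_single fun i => B.lz *ᵥ fun q => y (i, q)]
    · have hiff : y ∈ encodedX Q S ↔
          ∀ j, (S.SZ *ᵥ fun i => (B.lz *ᵥ fun q => y (i, q)) j) = 0 := by
        have h2 : ∀ c, (∑ i, S.SZ c i • fun q => y (i, q)) ∈ Q.stabX ↔
            ∀ j, (S.SZ *ᵥ fun i => (B.lz *ᵥ fun q => y (i, q)) j) c = 0 := by
          intro c
          rw [B.mem_stabX_iff, funext_iff]
          · refine forall_congr' fun j => ?_
            rw [mulVec_sum]
            simp [mulVec_smul, mulVec, dotProduct]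
          · rw [mulVec_sum]
            simp [mulVec_smul, hy]
        simp only [encodedX, Set.mem_ofPred_eq, hy, h2, funext_iff, Pi.zero_apply, implies_true,
          true_and]
        exact ⟨fun h j c => h c j, fun h c j => h j c⟩
      simp only [hiff]
      split_ifs with h
      · rw [mul_one]
        congr 1
        · simp [hψ.apply_eq (fun i => (B.lz *ᵥ fun q => y (i, q)) _), h]
        · simp [hy, hK]
      · push Not at h
        obtain ⟨j, hj⟩ := h
        rw [mul_zero, Finset.prod_eq_zero (Finset.mem_univ j), zero_mul]
        rw [hψ.apply_eq, if_neg hj]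
    · intro x _ hx
      obtain ⟨i, hi⟩ := Function.ne_iff.1 hx
      rw [mul_eq_zero]
      right
      exact Finset.prod_eq_zero (Finset.mem_univ i) (if_neg fun h => hi h.2)
    · simp
  · rw [if_neg fun h => hy h.1, mul_zero]
    push Not at hy
    obtain ⟨i, hi⟩ := hy
    refine Finset.sum_eq_zero fun x _ => ?_
    rw [mul_eq_zero]
    right
    exact Finset.prod_eq_zero (Finset.mem_univ i) (if_neg fun h => hi h.1)

end CSSCode

/-! ### Foliation -/

section Kronecker

variable {α β γ δ : Type} [Fintype α] [DecidableEq α] [Fintype β] [Fintype δ]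

theorem kronecker_one_mulVec (A : Matrix γ β (ZMod 2)) (x : β × α → ZMod 2) (i : γ) (k : α) :
    ((A ⊗ₖ (1 : Matrix α α (ZMod 2))) *ᵥ x) (i, k) = (A *ᵥ fun j => x (j, k)) i := by
  simp [mulVec, dotProduct, Fintype.sum_prod_type, one_apply]

theorem one_kronecker_mulVec (A : Matrix γ β (ZMod 2)) (x : α × β → ZMod 2) (i : α) (k : γ) :
    (((1 : Matrix α α (ZMod 2)) ⊗ₖ A) *ᵥ x) (i, k) = (A *ᵥ fun l => x (i, l)) k := by
  simp only [mulVec, dotProduct, Fintype.sum_prod_type, kroneckerMap_apply, one_apply, ite_mul,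
    one_mul, zero_mul]
  rw [Finset.sum_eq_single i]
  · simp
  · intro j _ hj
    simp [Ne.symm hj]
  · simp

end Kronecker

/-! ### The time complex: repetition codes joined by the `Z` generators at the last time. -/

section TimeMatrix

variable {I J : Type} [Fintype I] [DecidableEq I] [Fintype J] [DecidableEq J]
  (SZ : Matrix J I (ZMod 2)) (τ : ℕ)

/-- The parity checks of the repetition codes on `τ + 1` times, one for each element of `I`, with
the checks `SZ` on the bits at the last time. -/
def timeMatrix : Matrix (J ⊕ I × Fin τ) (I × Fin (τ + 1)) (ZMod 2) := fun κ β =>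
  match κ with
  | Sum.inl c => if β.2 = Fin.last τ then SZ c β.1 else 0
  | Sum.inr p => if β.1 = p.1 then
      (if β.2 = p.2.castSucc then 1 else 0) + (if β.2 = p.2.succ then 1 else 0) else 0

variable {τ}

/-- The values of `h` at the checks following each time, where the last time is followed by the
checks `SZ`. -/
def following {G : Type} [AddCommGroup G] [Module (ZMod 2) G] (h : J ⊕ I × Fin τ → G) (i : I) :
    Fin (τ + 1) → G :=
  Fin.snoc (α := fun _ => G) (fun t => h (Sum.inr (i, t))) (∑ c, SZ c i • h (Sum.inl c))

section

variable {G : Type} [AddCommGroup G] [Module (ZMod 2) G] (h : J ⊕ I × Fin τ → G) (i : I)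

theorem following_castSucc (t : Fin τ) : following SZ h i t.castSucc = h (Sum.inr (i, t)) := by
  rw [following, Fin.snoc_castSucc]

theorem following_last : following SZ h i (Fin.last τ) = ∑ c, SZ c i • h (Sum.inl c) := by
  rw [following, Fin.snoc_last]

end

theorem following_apply {Λ : Type} (h : J ⊕ I × Fin τ → Λ → ZMod 2) (i : I) (t : Fin (τ + 1))
    (a : Λ) : following SZ h i t a = following SZ (fun κ => h κ a) i t := by
  refine Fin.lastCases ?_ (fun t => ?_) t
  · simp [following_last]
  · simp [following_castSucc]

theorem timeMatrix_mulVec_inl (x : I × Fin (τ + 1) → ZMod 2) (c : J) :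
    (timeMatrix SZ τ *ᵥ x) (Sum.inl c) = ∑ i, SZ c i * x (i, Fin.last τ) := by
  simp [timeMatrix, mulVec, dotProduct, Fintype.sum_prod_type]

theorem timeMatrix_mulVec_inr (x : I × Fin (τ + 1) → ZMod 2) (i : I) (t : Fin τ) :
    (timeMatrix SZ τ *ᵥ x) (Sum.inr (i, t)) = x (i, t.castSucc) + x (i, t.succ) := by
  simp only [timeMatrix, mulVec, dotProduct, Fintype.sum_prod_type]
  rw [Finset.sum_eq_single i]
  · simp [add_mul, Finset.sum_add_distrib]
  · intro j _ hj
    simp [hj]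
  · simp

theorem timeMatrix_transpose_mulVec (h : J ⊕ I × Fin τ → ZMod 2) (i : I) (t : Fin (τ + 1)) :
    ((timeMatrix SZ τ)ᵀ *ᵥ h) (i, t) =
      following SZ h i t + ∑ t' : Fin τ, if t = t'.succ then h (Sum.inr (i, t')) else 0 := by
  simp only [timeMatrix, mulVec, dotProduct, Fintype.sum_prod_type, Fintype.sum_sum_type,
    transpose_apply]
  rw [Finset.sum_eq_single (f := fun j => ∑ t' : Fin τ, _) i]
  · simp only [if_true, add_mul, Finset.sum_add_distrib, ite_mul, one_mul, zero_mul, ← add_assoc]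
    congr 1
    refine Fin.lastCases ?_ (fun t => ?_) t
    · simp [following_last, (Fin.castSucc_lt_last _).ne']
    · simp [following_castSucc, (Fin.castSucc_lt_last _).ne]
  · intro j _ hj
    simp [Ne.symm hj]
  · simp

theorem timeMatrix_transpose_mulVec_zero (h : J ⊕ I × Fin τ → ZMod 2) (i : I) :
    ((timeMatrix SZ τ)ᵀ *ᵥ h) (i, 0) = following SZ h i 0 := by
  rw [timeMatrix_transpose_mulVec]
  simp [(Fin.succ_ne_zero _).symm]

theorem timeMatrix_transpose_mulVec_succ (h : J ⊕ I × Fin τ → ZMod 2) (i : I) (t : Fin τ) :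
    ((timeMatrix SZ τ)ᵀ *ᵥ h) (i, t.succ) =
      following SZ h i t.succ + following SZ h i t.castSucc := by
  rw [timeMatrix_transpose_mulVec, following_castSucc]
  simp

end TimeMatrix

/-- Telescoping. In the applications `u` lists the flips along a time line, `f` is a check matrix,
and `μ` lists the flips of the measured checks. -/
theorem map_partialSum {G G' : Type} [AddCommGroup G] [AddCommGroup G'] [Module (ZMod 2) G]
    [Module (ZMod 2) G'] {τ : ℕ} (f : G →ₗ[ZMod 2] G') (u : Fin τ → G) (μ : Fin (τ + 1) → G')
    (h : ∀ t, f (u t) = μ t.castSucc + μ t.succ) (t : Fin (τ + 1)) :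
    f (Fin.partialSum u t) = μ t + μ 0 := by
  induction t using Fin.induction with
  | zero => rw [Fin.partialSum_zero, map_zero, ZModModule.add_self]
  | succ t ih =>
    rw [Fin.partialSum_succ, map_add, ih, h]
    have := ZModModule.add_self (μ t.castSucc)
    rw [show μ t.castSucc + μ 0 + (μ t.castSucc + μ t.succ) =
      μ t.castSucc + μ t.castSucc + (μ t.succ + μ 0) by abel, this, zero_add]

theorem partialSum_last {G : Type} [AddCommGroup G] {τ : ℕ} (u : Fin τ → G) :
    Fin.partialSum u (Fin.last τ) = ∑ t, u t := by
  rw [Fin.partialSum, Fin.val_last, List.take_of_length_le (by simp), List.sum_ofFn]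

/-! ### The product of the time complex and the code, and its outer differentials. -/

section Foliation

variable {I J X CX CZ : Type} [Fintype I] [DecidableEq I] [Fintype J] [DecidableEq J] [Fintype X]
  [DecidableEq X] [Fintype CX] [DecidableEq CX] [Fintype CZ] [DecidableEq CZ]
  (SZ : Matrix J I (ZMod 2)) (HX : Matrix CX X (ZMod 2)) (HZ : Matrix CZ X (ZMod 2)) (τ : ℕ)

/-- The product of the time complex and the complex of the code, as a bipartite graph. -/
def productMatrix : Matrix ((J ⊕ I × Fin τ) × X ⊕ (I × Fin (τ + 1)) × CZ)
    ((I × Fin (τ + 1)) × X ⊕ (J ⊕ I × Fin τ) × CX) (ZMod 2) :=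
  fromBlocks (timeMatrix SZ τ ⊗ₖ 1) (1 ⊗ₖ HXᵀ) (1 ⊗ₖ HZ) 0

/-- Separates the output qubits, which are the code qubits at time `0`. -/
def splitOutput : I × X ⊕ ((I × Fin τ) × X ⊕ (J ⊕ I × Fin τ) × CX) →
    (I × Fin (τ + 1)) × X ⊕ (J ⊕ I × Fin τ) × CX
  | Sum.inl p => Sum.inl ((p.1, 0), p.2)
  | Sum.inr (Sum.inl p) => Sum.inl ((p.1.1, p.1.2.succ), p.2)
  | Sum.inr (Sum.inr p) => Sum.inr p

theorem splitOutput_bijective : Function.Bijective (splitOutput (I := I) (J := J) (X := X)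
    (CX := CX) τ) := by
  constructor
  · rintro (⟨i, q⟩ | ⟨⟨i, t⟩, q⟩ | p) (⟨i', q'⟩ | ⟨⟨i', t'⟩, q'⟩ | p') h <;>
      simp_all [splitOutput, (Fin.succ_ne_zero _).symm]
  · rintro (⟨⟨i, t⟩, q⟩ | p)
    · refine Fin.cases ⟨Sum.inl (i, q), rfl⟩ (fun t => ⟨Sum.inr (Sum.inl ((i, t), q)), rfl⟩) t
    · exact ⟨Sum.inr (Sum.inr p), rfl⟩

/-- `splitOutput` as an equivalence. -/
noncomputable def splitEquiv : I × X ⊕ ((I × Fin τ) × X ⊕ (J ⊕ I × Fin τ) × CX) ≃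
    (I × Fin (τ + 1)) × X ⊕ (J ⊕ I × Fin τ) × CX :=
  Equiv.ofBijective _ (splitOutput_bijective τ)

/-- The bipartite graph of the foliated code. -/
def foliation : Matrix ((J ⊕ I × Fin τ) × X ⊕ (I × Fin (τ + 1)) × CZ)
    (I × X ⊕ ((I × Fin τ) × X ⊕ (J ⊕ I × Fin τ) × CX)) (ZMod 2) :=
  (productMatrix SZ HX HZ τ).submatrix id (splitOutput τ)

/-- The parity checks of the `X` measurement outcomes on the second side. -/
def sideTwoChecks : Matrix ((J ⊕ I × Fin τ) × CZ)
    ((J ⊕ I × Fin τ) × X ⊕ (I × Fin (τ + 1)) × CZ) (ZMod 2) :=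
  fromCols (1 ⊗ₖ HZ) (timeMatrix SZ τ ⊗ₖ 1)

/-- The parity checks of the `X` measurement outcomes on the first side, if the output qubits were
measured as well. -/
def sideOneChecks : Matrix ((I × Fin (τ + 1)) × CX)
    ((I × Fin (τ + 1)) × X ⊕ (J ⊕ I × Fin τ) × CX) (ZMod 2) :=
  fromCols (1 ⊗ₖ HX) ((timeMatrix SZ τ)ᵀ ⊗ₖ 1)

/-- The time after a time step. -/
def nextTime (p : (I × Fin τ) × CX) : (I × Fin (τ + 1)) × CX := ((p.1.1, p.1.2.succ), p.2)

/-- The parity checks of the measurement outcomes. -/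
def outcomeChecks : Matrix ((I × Fin τ) × CX ⊕ (J ⊕ I × Fin τ) × CZ)
    (((I × Fin τ) × X ⊕ (J ⊕ I × Fin τ) × CX) ⊕
      ((J ⊕ I × Fin τ) × X ⊕ (I × Fin (τ + 1)) × CZ)) (ZMod 2) :=
  fromBlocks ((sideOneChecks SZ HX τ).submatrix (nextTime τ) (splitOutput τ ∘ Sum.inr)) 0 0
    (sideTwoChecks SZ HZ τ)

variable {τ}

theorem foliation_mulVec (x : (I × Fin (τ + 1)) × X ⊕ (J ⊕ I × Fin τ) × CX → ZMod 2) :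
    foliation SZ HX HZ τ *ᵥ (x ∘ splitOutput τ) = productMatrix SZ HX HZ τ *ᵥ x := by
  have h := submatrix_mulVec_equiv (productMatrix SZ HX HZ τ) (x ∘ splitOutput τ) id (splitEquiv τ)
  have h2 : (x ∘ splitOutput τ) ∘ (splitEquiv τ).symm = x := by
    funext v
    exact congrArg x ((splitEquiv τ).apply_symm_apply v)
  rw [h2] at h
  exact h

theorem productMatrix_mulVec_inl (x : (I × Fin (τ + 1)) × X ⊕ (J ⊕ I × Fin τ) × CX → ZMod 2)
    (κ : J ⊕ I × Fin τ) (q : X) : (productMatrix SZ HX HZ τ *ᵥ x) (Sum.inl (κ, q)) =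
      (timeMatrix SZ τ *ᵥ fun β => x (Sum.inl (β, q))) κ +
        ((fun a => x (Sum.inr (κ, a))) ᵥ* HX) q := by
  rw [productMatrix, fromBlocks_mulVec, Sum.elim_inl, Pi.add_apply, kronecker_one_mulVec,
    one_kronecker_mulVec, mulVec_transpose]
  rfl

theorem productMatrix_mulVec_inr (x : (I × Fin (τ + 1)) × X ⊕ (J ⊕ I × Fin τ) × CX → ZMod 2)
    (β : I × Fin (τ + 1)) (b : CZ) : (productMatrix SZ HX HZ τ *ᵥ x) (Sum.inr (β, b)) =
      (HZ *ᵥ fun q => x (Sum.inl (β, q))) b := by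
  rw [productMatrix, fromBlocks_mulVec, Sum.elim_inr, Pi.add_apply, one_kronecker_mulVec,
    zero_mulVec, Pi.zero_apply, add_zero]
  rfl

theorem productMatrix_transpose : (productMatrix SZ HX HZ τ)ᵀ =
    fromBlocks ((timeMatrix SZ τ)ᵀ ⊗ₖ 1) (1 ⊗ₖ HZᵀ) (1 ⊗ₖ HX) 0 := by
  rw [productMatrix, fromBlocks_transpose]
  simp only [← kroneckerMap_transpose, transpose_one, transpose_transpose, transpose_zero]

theorem vecMul_productMatrix_inl (y : (J ⊕ I × Fin τ) × X ⊕ (I × Fin (τ + 1)) × CZ → ZMod 2)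
    (β : I × Fin (τ + 1)) (q : X) : (y ᵥ* productMatrix SZ HX HZ τ) (Sum.inl (β, q)) =
      ((timeMatrix SZ τ)ᵀ *ᵥ fun κ => y (Sum.inl (κ, q))) β +
        ((fun b => y (Sum.inr (β, b))) ᵥ* HZ) q := by
  rw [← mulVec_transpose, productMatrix_transpose, fromBlocks_mulVec, Sum.elim_inl, Pi.add_apply,
    kronecker_one_mulVec, one_kronecker_mulVec]
  simp only [mulVec_transpose]
  rfl

theorem vecMul_productMatrix_inr (y : (J ⊕ I × Fin τ) × X ⊕ (I × Fin (τ + 1)) × CZ → ZMod 2)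
    (κ : J ⊕ I × Fin τ) (a : CX) : (y ᵥ* productMatrix SZ HX HZ τ) (Sum.inr (κ, a)) =
      (HX *ᵥ fun q => y (Sum.inl (κ, q))) a := by
  rw [← mulVec_transpose, productMatrix_transpose, fromBlocks_mulVec, Sum.elim_inr, Pi.add_apply,
    one_kronecker_mulVec, zero_mulVec, Pi.zero_apply, add_zero]
  rfl

variable {HX HZ}

/-- These are consecutive differentials of a product complex: the composite of a step in time with
`HZ` occurs in both orders and cancels, and the remaining block vanishes by `HZ * HXᵀ = 0`. -/
theorem sideTwoChecks_mul (hcomm : HX * HZᵀ = 0) :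
    sideTwoChecks SZ HZ τ * productMatrix SZ HX HZ τ = 0 := by
  have h : HZ * HXᵀ = 0 := mul_transpose_eq_zero_symm hcomm
  rw [sideTwoChecks, productMatrix, fromCols_mul_fromBlocks]
  simp only [← mul_kronecker_mul, mul_one, h, kronecker_zero, Matrix.mul_zero,
    Matrix.one_mul, Matrix.mul_one, ZModModule.add_self]
  ext i (j | j) <;> rfl

theorem sideOneChecks_mul (hcomm : HX * HZᵀ = 0) :
    sideOneChecks SZ HX τ * (productMatrix SZ HX HZ τ)ᵀ = 0 := by
  rw [sideOneChecks, productMatrix_transpose, fromCols_mul_fromBlocks]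
  simp only [← mul_kronecker_mul, mul_one, hcomm, kronecker_zero, Matrix.mul_zero,
    Matrix.one_mul, Matrix.mul_one, ZModModule.add_self]
  ext i (j | j) <;> rfl

theorem sideOneChecks_mulVec (z : (I × Fin (τ + 1)) × X ⊕ (J ⊕ I × Fin τ) × CX → ZMod 2)
    (β : I × Fin (τ + 1)) (a : CX) : (sideOneChecks SZ HX τ *ᵥ z) (β, a) =
      (HX *ᵥ fun q => z (Sum.inl (β, q))) a +
        ((timeMatrix SZ τ)ᵀ *ᵥ fun κ => z (Sum.inr (κ, a))) β := by
  rw [sideOneChecks, fromCols_mulVec, Pi.add_apply, kronecker_one_mulVec, one_kronecker_mulVec]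
  rfl

theorem sideTwoChecks_mulVec (z : (J ⊕ I × Fin τ) × X ⊕ (I × Fin (τ + 1)) × CZ → ZMod 2)
    (κ : J ⊕ I × Fin τ) (b : CZ) : (sideTwoChecks SZ HZ τ *ᵥ z) (κ, b) =
      (HZ *ᵥ fun q => z (Sum.inl (κ, q))) b +
        (timeMatrix SZ τ *ᵥ fun β => z (Sum.inr (β, b))) κ := by
  rw [sideTwoChecks, fromCols_mulVec, Pi.add_apply, kronecker_one_mulVec, one_kronecker_mulVec]
  rfl

theorem sideOneChecks_submatrix_mulVec
    (z : (I × Fin τ) × X ⊕ (J ⊕ I × Fin τ) × CX → ZMod 2)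
    (z' : (I × Fin (τ + 1)) × X ⊕ (J ⊕ I × Fin τ) × CX → ZMod 2)
    (h : ∀ v, z' (splitOutput τ (Sum.inr v)) = z v) (p : (I × Fin τ) × CX) :
    ((sideOneChecks SZ HX τ).submatrix (nextTime τ) (splitOutput τ ∘ Sum.inr) *ᵥ z) p =
      (sideOneChecks SZ HX τ *ᵥ z') (nextTime τ p) := by
  have h1 : (sideOneChecks SZ HX τ *ᵥ z') (nextTime τ p) =
      ∑ v, sideOneChecks SZ HX τ (nextTime τ p) (splitOutput τ v) * z' (splitOutput τ v) :=
    ((splitEquiv τ).sum_comp fun v => sideOneChecks SZ HX τ (nextTime τ p) v * z' v).symm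
  rw [h1, Fintype.sum_sum_type, Finset.sum_eq_zero, zero_add]
  · simp only [h]
    rfl
  · rintro ⟨i, q⟩ -
    simp [sideOneChecks, splitOutput, nextTime, one_apply, Fin.succ_ne_zero]

/-- Up to the unmeasured outputs, possible outcomes are images under the middle differential and its
transpose, which the outer differentials kill. The first-side checks at time 0 would involve the
outputs, hence the restriction by `nextTime`. -/
theorem outcomeChecks_mulVec_eq_zero (hcomm : HX * HZᵀ = 0)
    {s : ((I × Fin τ) × X ⊕ (J ⊕ I × Fin τ) × CX) ⊕
      ((J ⊕ I × Fin τ) × X ⊕ (I × Fin (τ + 1)) × CZ) → ZMod 2}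
    {P : PauliOp (I × X)} (h : (s, P) ∈ residual (foliation SZ HX HZ τ)) :
    outcomeChecks SZ HX HZ τ *ᵥ s = 0 := by
  obtain ⟨⟨x, hx, -⟩, η, hη, -⟩ := h
  dsimp only at hx hη
  rw [outcomeChecks, fromBlocks_mulVec, zero_mulVec, zero_mulVec, add_zero, zero_add]
  have h1 : ((sideOneChecks SZ HX τ).submatrix (nextTime τ) (splitOutput τ ∘ Sum.inr) *ᵥ
      (s ∘ Sum.inl)) = 0 := by
    funext p
    rw [sideOneChecks_submatrix_mulVec SZ (s ∘ Sum.inl) (η ᵥ* productMatrix SZ HX HZ τ) hη,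
      ← mulVec_transpose, mulVec_mulVec, sideOneChecks_mul SZ hcomm, zero_mulVec]
    rfl
  have h2 : sideTwoChecks SZ HZ τ *ᵥ (s ∘ Sum.inr) = 0 := by
    have h3 : x = (x ∘ (splitEquiv τ).symm) ∘ splitOutput τ := by
      funext v
      exact congrArg x ((splitEquiv τ).symm_apply_apply v).symm
    rw [← hx, h3, foliation_mulVec, mulVec_mulVec, sideTwoChecks_mul SZ hcomm, zero_mulVec]
  rw [h1, h2]
  funext p
  rcases p with p | p <;> rfl

end Foliation

/-! ### Undetected errors of the foliated code -/

section Undetected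

variable {I J X CX CZ R : Type} [Fintype I] [DecidableEq I] [Fintype J] [DecidableEq J] [Fintype X]
  [DecidableEq X] [Fintype CX] [DecidableEq CX] [Fintype CZ] [DecidableEq CZ] [Fintype R]
  [DecidableEq R]
  (SZ : Matrix J I (ZMod 2)) {HX : Matrix CX X (ZMod 2)} {HZ : Matrix CZ X (ZMod 2)} {τ : ℕ}

/-- The ancilla qubits of the foliated code on the first side. -/
abbrev AncOne (I J X CX : Type) (τ : ℕ) : Type := (I × Fin τ) × X ⊕ (J ⊕ I × Fin τ) × CX

/-- The ancilla qubits of the foliated code on the second side. -/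
abbrev AncTwo (I J X CZ : Type) (τ : ℕ) : Type := (J ⊕ I × Fin τ) × X ⊕ (I × Fin (τ + 1)) × CZ

/-- The time of an ancilla qubit. -/
def ancTime : AncOne I J X CX τ ⊕ AncTwo I J X CZ τ → ℕ
  | Sum.inl (Sum.inl p) => p.1.2
  | Sum.inl (Sum.inr (Sum.inl _, _)) => τ
  | Sum.inl (Sum.inr (Sum.inr p, _)) => p.2
  | Sum.inr (Sum.inl (Sum.inl _, _)) => τ
  | Sum.inr (Sum.inl (Sum.inr p, _)) => p.2
  | Sum.inr (Sum.inr p) => p.1.2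

/-- The code qubit of an ancilla qubit. -/
def ancQubit : AncOne I J X CX τ ⊕ AncTwo I J X CZ τ → Option X
  | Sum.inl (Sum.inl p) => some p.2
  | Sum.inl (Sum.inr _) => none
  | Sum.inr (Sum.inl p) => some p.2
  | Sum.inr (Sum.inr _) => none

/-- The output qubit on the time line of an ancilla qubit. -/
def ancOutput : AncOne I J X CX τ ⊕ AncTwo I J X CZ τ → Option (I × X)
  | Sum.inl (Sum.inl p) => some (p.1.1, p.2)
  | Sum.inl (Sum.inr _) => none
  | Sum.inr (Sum.inl (Sum.inl _, _)) => none
  | Sum.inr (Sum.inl (Sum.inr p, q)) => some (p.1, q)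
  | Sum.inr (Sum.inr _) => none

/-- The sum of the outcome errors `g` along the time lines of the output qubits. -/
def timelineSum (g : AncOne I J X CX τ ⊕ AncTwo I J X CZ τ → ZMod 2) : PauliOp (I × X) := fun o =>
  (∑ t, g (Sum.inr (Sum.inl (Sum.inr (o.1, t), o.2))), ∑ t, g (Sum.inl (Sum.inl ((o.1, t), o.2))))

/-- Each code qubit in the support lifts to a flipped ancilla of its own. Hence combining flips over
times, blocks and generators loses no factor in the comparison with the distance. -/
theorem hammingNorm_le_of_ancQubit {g : AncOne I J X CX τ ⊕ AncTwo I J X CZ τ → ZMod 2}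
    {v : X → ZMod 2} (h : ∀ q, v q ≠ 0 → ∃ b, g b ≠ 0 ∧ ancQubit b = some q) :
    hammingNorm v ≤ hammingNorm g := by
  rw [hammingNorm, hammingNorm,
    ← Finset.card_map (Function.Embedding.some : X ↪ Option X)]
  refine (Finset.card_le_card ?_).trans
    (Finset.card_image_le (s := Finset.univ.filter fun b => g b ≠ 0) (f := ancQubit))
  intro o ho
  simp only [Finset.mem_map, Finset.mem_filter, Finset.mem_univ, true_and] at ho
  obtain ⟨q, hq, rfl⟩ := ho
  obtain ⟨b, hb, hb'⟩ := h q hq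
  simp only [Finset.mem_image, Finset.mem_filter, Finset.mem_univ, true_and]
  exact ⟨b, hb, hb'⟩

variable {g : AncOne I J X CX τ ⊕ AncTwo I J X CZ τ → ZMod 2}

section Equations

variable (hg : outcomeChecks SZ HX HZ τ *ᵥ g = 0)

include hg

theorem sideTwoChecks_mulVec_eq_zero : sideTwoChecks SZ HZ τ *ᵥ (g ∘ Sum.inr) = 0 := by
  rw [outcomeChecks, fromBlocks_mulVec, zero_mulVec, zero_mulVec, add_zero, zero_add] at hg
  funext p
  exact congrFun hg (Sum.inr p)

theorem HZ_mulVec_junction (c : J) : (HZ *ᵥ fun q => g (Sum.inr (Sum.inl (Sum.inl c, q)))) =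
    ∑ i, SZ c i • fun b => g (Sum.inr (Sum.inr ((i, Fin.last τ), b))) := by
  funext b
  have h := congrFun (sideTwoChecks_mulVec_eq_zero SZ hg) (Sum.inl c, b)
  rw [sideTwoChecks_mulVec, timeMatrix_mulVec_inl] at h
  simpa using CharTwo.add_eq_zero.1 h

theorem HZ_mulVec_step (i : I) (t : Fin τ) :
    (HZ *ᵥ fun q => g (Sum.inr (Sum.inl (Sum.inr (i, t), q)))) =
      (fun b => g (Sum.inr (Sum.inr ((i, t.castSucc), b)))) +
        fun b => g (Sum.inr (Sum.inr ((i, t.succ), b))) := by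
  funext b
  have h := congrFun (sideTwoChecks_mulVec_eq_zero SZ hg) (Sum.inr (i, t), b)
  rw [sideTwoChecks_mulVec, timeMatrix_mulVec_inr] at h
  exact CharTwo.add_eq_zero.1 h

theorem HX_mulVec_step (i : I) (t : Fin τ) :
    (HX *ᵥ fun q => g (Sum.inl (Sum.inl ((i, t), q)))) =
      following SZ (fun κ a => g (Sum.inl (Sum.inr (κ, a)))) i t.castSucc +
        following SZ (fun κ a => g (Sum.inl (Sum.inr (κ, a)))) i t.succ := by
  rw [outcomeChecks, fromBlocks_mulVec, zero_mulVec, zero_mulVec, add_zero, zero_add] at hg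
  funext a
  have h := congrFun hg (Sum.inl ((i, t), a))
  obtain ⟨z, hz⟩ : ∃ z : I × X ⊕ AncOne I J X CX τ → ZMod 2,
      ∀ v, z (Sum.inr v) = g (Sum.inl v) := ⟨Sum.elim (fun _ => 0) (g ∘ Sum.inl), fun _ => rfl⟩
  have hz' : ∀ v, (z ∘ (splitEquiv τ).symm) (splitOutput τ (Sum.inr v)) = g (Sum.inl v) :=
    fun v => (congrArg z ((splitEquiv τ).symm_apply_apply (Sum.inr v))).trans (hz v)
  rw [Sum.elim_inl,
    sideOneChecks_submatrix_mulVec SZ (g ∘ Sum.inl) (z ∘ (splitEquiv τ).symm) hz',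
    nextTime, sideOneChecks_mulVec, timeMatrix_transpose_mulVec_succ] at h
  have h1 : ∀ q, (z ∘ (splitEquiv τ).symm) (Sum.inl ((i, t.succ), q)) =
      g (Sum.inl (Sum.inl ((i, t), q))) := fun q => hz' (Sum.inl ((i, t), q))
  have h2 : ∀ κ, (z ∘ (splitEquiv τ).symm) (Sum.inr (κ, a)) = g (Sum.inl (Sum.inr (κ, a))) :=
    fun κ => hz' (Sum.inr (κ, a))
  simp only [h1, h2] at h
  rw [Pi.add_apply, following_apply, following_apply, add_comm (following _ _ _ _)]
  exact CharTwo.add_eq_zero.1 h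

/-- An undetected pattern of `X` errors, with the total error `off` on the output qubits. -/
theorem exists_foliation_mulVec_eq (off : I → X → ZMod 2)
    (hoff : ∀ i, HZ *ᵥ off i = fun b => g (Sum.inr (Sum.inr ((i, 0), b))))
    (xc : J → CX → ZMod 2)
    (hxc : ∀ c, xc c ᵥ* HX = (fun q => g (Sum.inr (Sum.inl (Sum.inl c, q)))) +
      ∑ i, SZ c i • ((∑ t, fun q => g (Sum.inr (Sum.inl (Sum.inr (i, t), q)))) + off i)) :
    ∃ x, foliation SZ HX HZ τ *ᵥ x = g ∘ Sum.inr ∧ ∀ o : I × X, x (Sum.inl o) = off o.1 o.2 := by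
  let u : I → Fin τ → X → ZMod 2 := fun i t q => g (Sum.inr (Sum.inl (Sum.inr (i, t), q)))
  -- On a time line the pattern starts at `off` and changes by the observed flips, so the step
  -- equations hold by construction. The equations of `HZ` then follow from `hoff` by telescoping,
  -- and `xc` solves those at the junctions.
  let x : (I × Fin (τ + 1)) × X ⊕ (J ⊕ I × Fin τ) × CX → ZMod 2 := Sum.elim
    (fun p => (Fin.partialSum (u p.1.1) p.1.2 + off p.1.1) p.2)
    fun p => Sum.elim (fun c => xc c p.2) (fun _ => 0) p.1
  refine ⟨x ∘ splitOutput τ, ?_, fun o => ?_⟩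
  · rw [foliation_mulVec]
    funext p
    rcases p with ⟨c | ⟨i, t⟩, q⟩ | ⟨⟨i, t⟩, b⟩
    · rw [productMatrix_mulVec_inl, timeMatrix_mulVec_inl]
      have h1 : ((fun a => x (Sum.inr (Sum.inl c, a))) ᵥ* HX) = xc c ᵥ* HX := rfl
      rw [h1, hxc]
      simp only [x, u, Sum.elim_inl, partialSum_last]
      simp only [Pi.add_apply, Finset.sum_apply, Pi.smul_apply, smul_eq_mul, Function.comp_apply]
      rw [add_comm, add_assoc, CharTwo.add_self_eq_zero, add_zero]
    · rw [productMatrix_mulVec_inl, timeMatrix_mulVec_inr]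
      have h1 : ((fun a => x (Sum.inr (Sum.inr (i, t), a))) ᵥ* HX) = 0 := zero_vecMul HX
      rw [h1]
      simp only [x, Sum.elim_inl, Fin.partialSum_succ, Pi.add_apply, Pi.zero_apply, add_zero]
      have h2 : ∀ a b c : ZMod 2, a + b + (a + c + b) = c := by decide
      rw [h2]
      rfl
    · rw [productMatrix_mulVec_inr]
      have h1 : (fun q => x (Sum.inl ((i, t), q))) = Fin.partialSum (u i) t + off i := rfl
      have h2 := map_partialSum HZ.mulVecLin (u i)
        (fun t b => g (Sum.inr (Sum.inr ((i, t), b)))) (fun t => HZ_mulVec_step SZ hg i t) t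
      rw [mulVecLin_apply] at h2
      rw [h1, mulVec_add, h2, hoff, add_assoc, ZModModule.add_self, add_zero]
      rfl
  · simp [x, splitOutput, Fin.partialSum_zero]

/-- An undetected pattern of `Z` errors, with the total error `off` on the output qubits. -/
theorem exists_vecMul_foliation_eq (off : I → X → ZMod 2)
    (hoff : ∀ i, HX *ᵥ off i = following SZ (fun κ a => g (Sum.inl (Sum.inr (κ, a)))) i 0)
    (yc : J → X → ZMod 2) (hyc : ∀ c, HX *ᵥ yc c = fun a => g (Sum.inl (Sum.inr (Sum.inl c, a))))
    (k : I → CZ → ZMod 2)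
    (hk : ∀ i, (∑ c, SZ c i • yc c) + k i ᵥ* HZ =
      (∑ t, fun q => g (Sum.inl (Sum.inl ((i, t), q)))) + off i) :
    ∃ η, (∀ b, (η ᵥ* foliation SZ HX HZ τ) (Sum.inr b) = g (Sum.inl b)) ∧
      ∀ o : I × X, (η ᵥ* foliation SZ HX HZ τ) (Sum.inl o) = off o.1 o.2 := by
  let z : I → Fin τ → X → ZMod 2 := fun i t q => g (Sum.inl (Sum.inl ((i, t), q)))
  -- `Y` is forced by `off` and the flips. Its value at the last time has to match the junctions;
  -- `k` corrects it there by `Z` stabilizers, and `η` uses no `Z` checks at earlier times.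
  let Y : I → Fin (τ + 1) → X → ZMod 2 := fun i t => Fin.partialSum (z i) t + off i
  let yκ : J ⊕ I × Fin τ → X → ZMod 2 := Sum.elim yc fun p => Y p.1 p.2.castSucc
  let η : (J ⊕ I × Fin τ) × X ⊕ (I × Fin (τ + 1)) × CZ → ZMod 2 := Sum.elim
    (fun p => yκ p.1 p.2) fun p => if p.1.2 = Fin.last τ then k p.1.1 p.2 else 0
  have hY : ∀ i t, HX *ᵥ Y i t = following SZ (fun κ a => g (Sum.inl (Sum.inr (κ, a)))) i t := by
    intro i t
    have h2 := map_partialSum HX.mulVecLin (z i) _ (fun t => HX_mulVec_step SZ hg i t) t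
    rw [mulVecLin_apply] at h2
    rw [mulVec_add, h2, hoff, add_assoc, ZModModule.add_self, add_zero]
  have hfol : ∀ i t q, following SZ (fun κ => η (Sum.inl (κ, q))) i t +
      ((fun b => η (Sum.inr ((i, t), b))) ᵥ* HZ) q = Y i t q := by
    intro i t q
    refine Fin.lastCases ?_ (fun t => ?_) t
    · have h1 : ((fun b => η (Sum.inr ((i, Fin.last τ), b))) ᵥ* HZ) = k i ᵥ* HZ := by
        simp [η]
      have h2 := congrFun (hk i) q
      rw [following_last, h1]
      simp only [Y, partialSum_last, z]
      rw [← h2]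
      simp [η, yκ]
    · have h1 : ((fun b => η (Sum.inr ((i, t.castSucc), b))) ᵥ* HZ) = 0 := by
        have : (fun b => η (Sum.inr ((i, t.castSucc), b))) = 0 := by
          funext b
          simp [η, (Fin.castSucc_lt_last _).ne]
        rw [this, zero_vecMul]
      rw [following_castSucc, h1, Pi.zero_apply, add_zero]
      rfl
  refine ⟨η, fun b => ?_, fun o => ?_⟩
  · change (η ᵥ* productMatrix SZ HX HZ τ) (splitOutput τ (Sum.inr b)) = _
    rcases b with ⟨⟨i, t⟩, q⟩ | ⟨κ, a⟩
    · rw [splitOutput, vecMul_productMatrix_inl, timeMatrix_transpose_mulVec_succ]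
      dsimp only
      rw [add_right_comm, hfol, following_castSucc]
      have h1 : η (Sum.inl (Sum.inr (i, t), q)) = Y i t.castSucc q := rfl
      rw [h1]
      simp only [Y, Fin.partialSum_succ, Pi.add_apply, z]
      have h2 : ∀ a b c : ZMod 2, a + c + b + (a + b) = c := by decide
      rw [h2]
    · rw [splitOutput, vecMul_productMatrix_inr]
      rcases κ with c | ⟨i, t⟩
      · exact congrFun (hyc c) a
      · have h1 := hY i t.castSucc
        rw [following_castSucc] at h1
        exact congrFun h1 a
  · change (η ᵥ* productMatrix SZ HX HZ τ) (splitOutput τ (Sum.inl o)) = _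
    rw [splitOutput, vecMul_productMatrix_inl, timeMatrix_transpose_mulVec_zero, hfol]
    simp [Y, Fin.partialSum_zero]

/-- An undetected pattern of errors away from the last time is equivalent to the sum along the time
lines of the output qubits. -/
theorem timelineSum_mem_residual (h : ∀ b, ancTime b = τ → g b = 0) :
    (g, timelineSum g) ∈ residual (foliation SZ HX HZ τ) := by
  have hu : ∀ c q, g (Sum.inr (Sum.inl (Sum.inl c, q))) = 0 := fun c q => h _ rfl
  have hμ : ∀ i b, g (Sum.inr (Sum.inr ((i, Fin.last τ), b))) = 0 := fun i b => h _ rfl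
  have hν : ∀ c a, g (Sum.inl (Sum.inr (Sum.inl c, a))) = 0 := fun c q => h _ rfl
  constructor
  -- With the whole time line sum as offset on the output, nothing is left at the last time and the
  -- junctions need no correction.
  · have := exists_foliation_mulVec_eq SZ hg
      (fun i => ∑ t, fun q => g (Sum.inr (Sum.inl (Sum.inr (i, t), q)))) (fun i => ?_) 0 fun c => ?_
    · obtain ⟨x, hx, hx'⟩ := this
      refine ⟨x, hx, fun o => ?_⟩
      rw [hx']
      simp [timelineSum]
    · have h2 := map_partialSum HZ.mulVecLin
        (fun t q => g (Sum.inr (Sum.inl (Sum.inr (i, t), q))))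
        (fun t b => g (Sum.inr (Sum.inr ((i, t), b)))) (fun t => HZ_mulVec_step SZ hg i t)
        (Fin.last τ)
      rw [partialSum_last, mulVecLin_apply] at h2
      rw [h2]
      funext b
      simp [hμ]
    · have h1 : (fun q => g (Sum.inr (Sum.inl (Sum.inl c, q)))) = 0 := funext fun q => hu c q
      rw [h1]
      simp only [ZModModule.add_self, smul_zero, Finset.sum_const_zero, Pi.zero_apply,
        zero_vecMul]
  · have := exists_vecMul_foliation_eq SZ hg
      (fun i => ∑ t, fun q => g (Sum.inl (Sum.inl ((i, t), q)))) (fun i => ?_) 0 (fun c => ?_) 0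
      fun i => ?_
    · obtain ⟨η, hη, hη'⟩ := this
      refine ⟨η, hη, fun o => ?_⟩
      rw [hη']
      simp [timelineSum]
    · have h2 := map_partialSum HX.mulVecLin
        (fun t q => g (Sum.inl (Sum.inl ((i, t), q)))) _ (fun t => HX_mulVec_step SZ hg i t)
        (Fin.last τ)
      rw [partialSum_last, mulVecLin_apply] at h2
      rw [h2, following_last]
      have h3 : ∀ c, (fun a => g (Sum.inl (Sum.inr (Sum.inl c, a)))) = 0 := fun c => funext (hν c)
      simp [h3]
    · rw [Pi.zero_apply, mulVec_zero]
      exact (funext (hν c)).symm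
    · simp only [ZModModule.add_self, Pi.zero_apply, smul_zero, Finset.sum_const_zero, zero_vecMul]

/-- A small undetected pattern of errors away from the output qubits is harmless. -/
theorem zero_mem_residual_of_hammingNorm_lt (hcomm : HX * HZᵀ = 0) {SX : Matrix R I (ZMod 2)}
    {SX' : Matrix I R (ZMod 2)} (hSX : SX * SX' = 1) (hSXZ : SX * SZᵀ = 0)
    (hker : ∀ v, SX *ᵥ v = 0 → ∃ y, y ᵥ* SZ = v) (hSZ : Function.Injective fun y => y ᵥ* SZ)
    {d : ℕ} (hdX : ∀ v, HZ *ᵥ v = 0 → hammingNorm v < d → ∃ x, x ᵥ* HX = v)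
    (hdZ : ∀ v, HX *ᵥ v = 0 → hammingNorm v < d → ∃ x, x ᵥ* HZ = v)
    (hd : hammingNorm g < d) (h : ∀ b, ancTime b = 0 → g b = 0) :
    (g, 0) ∈ residual (foliation SZ HX HZ τ) := by
  have hμ : ∀ i b, g (Sum.inr (Sum.inr ((i, 0), b))) = 0 := fun i b => h _ rfl
  have hν : ∀ i, following SZ (fun κ a => g (Sum.inl (Sum.inr (κ, a)))) i 0 = 0 := by
    intro i
    -- For `τ = 0` time 0 is followed directly by the junctions, which then have time 0 as well.
    rcases τ with _ | τ
    · have h1 : (0 : Fin 1) = Fin.last 0 := rfl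
      rw [h1, following_last]
      have h3 : ∀ c, (fun a => g (Sum.inl (Sum.inr (Sum.inl c, a)))) = 0 :=
        fun c => funext fun a => h _ rfl
      simp [h3]
    · have h1 : (0 : Fin (τ + 2)) = Fin.castSucc 0 := rfl
      rw [h1, following_castSucc]
      exact funext fun a => h _ rfl
  constructor
  · have hT : ∀ i, (HZ *ᵥ ∑ t, fun q => g (Sum.inr (Sum.inl (Sum.inr (i, t), q)))) =
        fun b => g (Sum.inr (Sum.inr ((i, Fin.last τ), b))) := by
      intro i
      have h2 := map_partialSum HZ.mulVecLin
        (fun t q => g (Sum.inr (Sum.inl (Sum.inr (i, t), q))))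
        (fun t b => g (Sum.inr (Sum.inr ((i, t), b)))) (fun t => HZ_mulVec_step SZ hg i t)
        (Fin.last τ)
      rw [partialSum_last, mulVecLin_apply] at h2
      rw [h2]
      funext b
      simp [hμ]
    have hxc : ∀ c, ∃ x, x ᵥ* HX = (fun q => g (Sum.inr (Sum.inl (Sum.inl c, q)))) +
        ∑ i, SZ c i • ((∑ t, fun q => g (Sum.inr (Sum.inl (Sum.inr (i, t), q)))) +
          (0 : I → X → ZMod 2) i) := by
      intro c
      -- The mismatch at a junction is a cycle of weight less than the distance, hence an `X`
      -- stabilizer.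
      refine hdX _ ?_ (lt_of_le_of_lt (hammingNorm_le_of_ancQubit fun q hq => ?_) hd)
      · simp only [Pi.zero_apply, add_zero]
        rw [mulVec_add, HZ_mulVec_junction SZ hg, mulVec_sum]
        simp only [mulVec_smul, hT, ZModModule.add_self]
      · by_contra! hne
        refine hq ?_
        have h1 : g (Sum.inr (Sum.inl (Sum.inl c, q))) = 0 := by
          by_contra h0; exact hne _ h0 rfl
        have h2 : ∀ i t, g (Sum.inr (Sum.inl (Sum.inr (i, t), q))) = 0 := by
          intro i t
          by_contra h0; exact hne _ h0 rfl
        simp [h1, h2]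
    choose xc hxc using hxc
    exact exists_foliation_mulVec_eq SZ hg 0 (fun i => by
      rw [Pi.zero_apply, mulVec_zero]; exact (funext (hμ i)).symm) xc hxc
  · let ζ : I → X → ZMod 2 := fun i => ∑ t, fun q => g (Sum.inl (Sum.inl ((i, t), q)))
    let ν : J → CX → ZMod 2 := fun c a => g (Sum.inl (Sum.inr (Sum.inl c, a)))
    have hT : ∀ i, HX *ᵥ ζ i = ∑ c, SZ c i • ν c := by
      intro i
      have h2 := map_partialSum HX.mulVecLin
        (fun t q => g (Sum.inl (Sum.inl ((i, t), q)))) _ (fun t => HX_mulVec_step SZ hg i t)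
        (Fin.last τ)
      rw [partialSum_last, mulVecLin_apply, hν, add_zero, following_last] at h2
      exact h2
    -- A combination of time line sums along an `X` generator is a cycle because the generators
    -- commute, and it is light whatever the weight of the generator. This is why only the `Z`
    -- generators have to be sparse.
    have hw : ∀ r, ∃ x, x ᵥ* HZ = ∑ i, SX r i • ζ i := by
      intro r
      refine hdZ _ ?_ (lt_of_le_of_lt (hammingNorm_le_of_ancQubit fun q hq => ?_) hd)
      · rw [mulVec_sum]
        simp only [mulVec_smul, hT, Finset.smul_sum, smul_smul]
        rw [Finset.sum_comm]
        refine Finset.sum_eq_zero fun c _ => ?_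
        rw [← Finset.sum_smul]
        have h1 : ∑ i, SX r i * SZ c i = 0 := congrFun (congrFun hSXZ r) c
        rw [h1, zero_smul]
      · by_contra! hne
        refine hq ?_
        have h2 : ∀ i t, g (Sum.inl (Sum.inl ((i, t), q))) = 0 := by
          intro i t
          by_contra h0; exact hne _ h0 rfl
        simp [ζ, h2]
    choose w hw using hw
    -- The right inverse of `SX` distributes the stabilizers `w` over the blocks so that `ζ + k HZ`
    -- is orthogonal to every `X` generator. By completeness it is then a combination `y` of `Z`
    -- generators, qubit by qubit.
    let k : I → CZ → ZMod 2 := fun i => ∑ r, SX' i r • w r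
    have hk : ∀ i, k i ᵥ* HZ = ∑ r, SX' i r • ∑ i', SX r i' • ζ i' := by
      intro i
      simp only [k, sum_vecMul, smul_vecMul, hw]
    have hcol : ∀ q, ∃ y, y ᵥ* SZ = fun i => ζ i q + (k i ᵥ* HZ) q := by
      intro q
      refine hker _ ?_
      have h1 : (fun i => ζ i q + (k i ᵥ* HZ) q) =
          (fun i => ζ i q) + SX' *ᵥ (SX *ᵥ fun i => ζ i q) := by
        funext i
        simp only [hk, Pi.add_apply, Finset.sum_apply, Pi.smul_apply, smul_eq_mul, mulVec,
          dotProduct]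
      rw [h1, mulVec_add, mulVec_mulVec, hSX, one_mulVec, ZModModule.add_self]
    choose y hy using hcol
    have hyc : ∀ i, ∑ c, SZ c i • (fun q => y q c) = ζ i + k i ᵥ* HZ := by
      intro i
      funext q
      rw [Pi.add_apply, ← congrFun (hy q) i]
      simp [vecMul, dotProduct, mul_comm]
    refine exists_vecMul_foliation_eq SZ hg 0 (fun i => ?_) (fun c q => y q c) (fun c => ?_) k
      fun i => ?_
    · rw [hν, Pi.zero_apply, mulVec_zero]
    · funext a
      -- Only the combinations along the columns of `SZ` are known to agree; independence of the `Z`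
      -- generators removes `SZ`.
      have h1 : (fun c => (HX *ᵥ fun q => y q c) a) ᵥ* SZ = (fun c => ν c a) ᵥ* SZ := by
        funext i
        have h2 : HX *ᵥ (∑ c, SZ c i • (fun q => y q c)) = ∑ c, SZ c i • ν c := by
          rw [hyc, mulVec_add, hT, ← mulVec_transpose, mulVec_mulVec, hcomm, zero_mulVec, add_zero]
        rw [mulVec_sum] at h2
        have h3 := congrFun h2 a
        simp only [mulVec_smul, Finset.sum_apply, Pi.smul_apply, smul_eq_mul] at h3
        simpa [vecMul, dotProduct, mul_comm] using h3
      exact congrFun (hSZ h1) c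
    · rw [hyc, add_assoc, ZModModule.add_self]
      rfl

end Equations

theorem exists_of_timelineSum_ne_zero {o : I × X} (h : timelineSum g o ≠ 0) :
    ∃ b, g b ≠ 0 ∧ ancOutput b = some o := by
  by_contra! hne
  refine h ?_
  have h1 : ∀ t, g (Sum.inr (Sum.inl (Sum.inr (o.1, t), o.2))) = 0 := by
    intro t
    by_contra h0; exact hne _ h0 rfl
  have h2 : ∀ t, g (Sum.inl (Sum.inl ((o.1, t), o.2))) = 0 := by
    intro t
    by_contra h0; exact hne _ h0 rfl
  simp [timelineSum, h1, h2]

end Undetected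

/-! ### The state prepared by the foliated code -/

/-- Successive strings on a time line differ by `X` stabilizers, so the junction conditions at the
last time can be moved to time 0. The converse is `exists_foliation_mulVec_eq` without flips. -/
theorem exists_foliation_mulVec_eq_zero_iff {I J X CX CZ : Type} [Fintype I] [DecidableEq I]
    [Fintype J] [DecidableEq J] [Fintype X] [DecidableEq X] [Fintype CX] [DecidableEq CX]
    [Fintype CZ] [DecidableEq CZ] (SZ : Matrix J I (ZMod 2)) (HX : Matrix CX X (ZMod 2))
    (HZ : Matrix CZ X (ZMod 2)) (τ : ℕ) (y : I × X → ZMod 2) :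
    (∃ b, foliation SZ HX HZ τ *ᵥ Sum.elim y b = 0) ↔ (∀ i, (HZ *ᵥ fun q => y (i, q)) = 0) ∧
      ∀ c, (∑ i, SZ c i • fun q => y (i, q)) ∈ Submodule.span (ZMod 2) (Set.range HX.row) := by
  constructor
  · rintro ⟨b, hb⟩
    obtain ⟨x, hx⟩ : ∃ x, Sum.elim y b = x ∘ splitOutput τ := ⟨Sum.elim y b ∘ (splitEquiv τ).symm, by
      funext v
      exact congrArg (Sum.elim y b) ((splitEquiv τ).symm_apply_apply v).symm⟩
    rw [hx, foliation_mulVec] at hb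
    have hy : ∀ i q, y (i, q) = x (Sum.inl ((i, 0), q)) := fun i q => congrFun hx (Sum.inl (i, q))
    have h1 : ∀ i t, (HZ *ᵥ fun q => x (Sum.inl ((i, t), q))) = 0 := by
      intro i t
      funext b
      rw [← productMatrix_mulVec_inr SZ HX HZ, hb]
      rfl
    refine ⟨fun i => ?_, fun c => ?_⟩
    · simpa only [hy] using h1 i 0
    · have hstep : ∀ i (t : Fin (τ + 1)), (fun q => x (Sum.inl ((i, t), q))) +
          (fun q => x (Sum.inl ((i, 0), q))) ∈ Submodule.span (ZMod 2) (Set.range HX.row) := by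
        intro i t
        induction t using Fin.induction with
        | zero => rw [ZModModule.add_self]; exact Submodule.zero_mem _
        | succ t ih =>
          have h2 : (fun q => x (Sum.inl ((i, t.castSucc), q))) +
              (fun q => x (Sum.inl ((i, t.succ), q))) =
              (fun a => x (Sum.inr (Sum.inr (i, t), a))) ᵥ* HX := by
            funext q
            have h := congrFun hb (Sum.inl (Sum.inr (i, t), q))
            rw [productMatrix_mulVec_inl, timeMatrix_mulVec_inr] at h
            exact CharTwo.add_eq_zero.1 h
          have h3 := Submodule.add_mem _ ih (mem_span_row.2 ⟨_, h2.symm⟩)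
          have h4 := ZModModule.add_self (fun q => x (Sum.inl ((i, t.castSucc), q)))
          rw [show ∀ a b c : X → ZMod 2, a + b + (a + c) = a + a + (c + b) by intros; abel,
            h4, zero_add] at h3
          exact h3
      have hlast : (∑ i, SZ c i • fun q => x (Sum.inl ((i, Fin.last τ), q))) ∈
          Submodule.span (ZMod 2) (Set.range HX.row) := by
        refine mem_span_row.2 ⟨fun a => x (Sum.inr (Sum.inl c, a)), ?_⟩
        funext q
        have h := congrFun hb (Sum.inl (Sum.inl c, q))
        rw [productMatrix_mulVec_inl, timeMatrix_mulVec_inl] at h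
        simpa using (CharTwo.add_eq_zero.1 h).symm
      have hsum := Submodule.sum_mem (Submodule.span (ZMod 2) (Set.range HX.row))
        (t := Finset.univ) fun i _ => Submodule.smul_mem _ (SZ c i) (hstep i (Fin.last τ))
      simp only [smul_add, Finset.sum_add_distrib] at hsum
      simp only [hy]
      exact (Submodule.add_mem_iff_right _ hlast).1 hsum
  · rintro ⟨h1, h2⟩
    choose xc hxc using fun c => mem_span_row.1 (h2 c)
    obtain ⟨x, hx, hx'⟩ := exists_foliation_mulVec_eq (g := 0) (HX := HX) (HZ := HZ) (τ := τ) SZ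
      (mulVec_zero _) (fun i q => y (i, q)) h1 xc (fun c => by
        rw [hxc]
        have h0 : ∀ i : I, (∑ t : Fin τ, fun q : X => (0 : AncOne I J X CX τ ⊕ AncTwo I J X CZ τ →
          ZMod 2) (Sum.inr (Sum.inl (Sum.inr (i, t), q)))) = 0 := by
          intro i
          exact Finset.sum_eq_zero fun _ _ => rfl
        simp only [h0, zero_add]
        exact (zero_add _).symm)
    refine ⟨x ∘ Sum.inr, ?_⟩
    have : Sum.elim y (x ∘ Sum.inr) = x := by
      funext v
      rcases v with v | v
      · exact (hx' v).symm
      · rfl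
    rw [this, hx]
    rfl

/-! ### Clusters -/

section Clusters

variable {V : Type} [DecidableEq V] (nb : V → Finset V)

/-- The walks with `n` steps from a vertex, as lists of vertices. -/
def walks : ℕ → V → Finset (List V)
  | 0, v => {[v]}
  | n + 1, v => (nb v).biUnion fun u => (walks n u).image (v :: ·)

/-- A connected set of vertices. -/
def IsCluster (K : Finset V) : Prop :=
  ∀ u ∈ K, ∀ v ∈ K, Relation.ReflTransGen (fun a b => b ∈ nb a ∧ b ∈ K) u v

variable {nb}

theorem card_walks_le {Δ : ℕ} (hΔ : ∀ v, (nb v).card ≤ Δ) (n : ℕ) (v : V) :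
    (walks nb n v).card ≤ Δ ^ n := by
  induction n generalizing v with
  | zero => simp [walks]
  | succ n ih =>
    rw [walks, pow_succ, mul_comm]
    refine (Finset.card_biUnion_le_card_mul _ _ _ fun u _ =>
      Finset.card_image_le.trans (ih u)).trans ?_
    exact Nat.mul_le_mul_right _ (hΔ v)

/-- A detour `x, y, x` at a visit of `x` adds `y` at the cost of two steps. -/
theorem exists_walk_insert (hsymm : ∀ u v, u ∈ nb v → v ∈ nb u) {n : ℕ} {v : V} {l : List V}
    (hl : l ∈ walks nb n v) {x y : V} (hx : x ∈ l) (hy : y ∈ nb x) :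
    ∃ l' ∈ walks nb (n + 2) v, l'.toFinset = insert y l.toFinset := by
  induction n generalizing v l with
  | zero =>
    simp only [walks, Finset.mem_singleton] at hl
    subst hl
    rw [List.mem_singleton] at hx
    subst hx
    refine ⟨[x, y, x], ?_, ?_⟩
    · simp only [walks, Finset.mem_biUnion, Finset.mem_image, Finset.mem_singleton]
      exact ⟨y, hy, [y, x], ⟨x, hsymm _ _ hy, [x], rfl, rfl⟩, rfl⟩
    · ext z
      simp
  | succ n ih =>
    rw [walks, Finset.mem_biUnion] at hl
    obtain ⟨u, hu, hl⟩ := hl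
    obtain ⟨l, hl', rfl⟩ := Finset.mem_image.1 hl
    rcases List.mem_cons.1 hx with rfl | hx
    · refine ⟨x :: y :: x :: l, ?_, ?_⟩
      · simp only [walks, Finset.mem_biUnion, Finset.mem_image]
        exact ⟨y, hy, y :: x :: l, ⟨x, hsymm _ _ hy, x :: l, ⟨u, hu, l, hl', rfl⟩, rfl⟩, rfl⟩
      · ext z
        simp
    · obtain ⟨l₂, h₂, h₃⟩ := ih hl' hx
      refine ⟨v :: l₂, ?_, ?_⟩
      · rw [walks, Finset.mem_biUnion]
        exact ⟨u, hu, Finset.mem_image_of_mem _ h₂⟩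
      · rw [List.toFinset_cons, h₃, List.toFinset_cons, Finset.insert_comm]

theorem exists_step_out {r : V → V → Prop} {J : Finset V} {u v : V}
    (h : Relation.ReflTransGen r u v) (hu : u ∈ J) (hv : v ∉ J) : ∃ x ∈ J, ∃ y ∉ J, r x y := by
  induction h with
  | refl => exact absurd hu hv
  | @tail b c _ hbc ih =>
    by_cases hb : b ∈ J
    · exact ⟨b, hb, c, hv, hbc⟩
    · exact ih hb

/-- As long as the walk misses a vertex of the cluster, connectedness gives an edge of the cluster
leaving the visited set, and a detour along it adds one vertex. -/
theorem IsCluster.exists_walk (hsymm : ∀ u v, u ∈ nb v → v ∈ nb u) {K : Finset V}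
    (hK : IsCluster nb K) {v : V} (hv : v ∈ K) (j : ℕ) (hj : j < K.card) :
    ∃ l ∈ walks nb (2 * j) v, v ∈ l.toFinset ∧ l.toFinset ⊆ K ∧ l.toFinset.card = j + 1 := by
  induction j with
  | zero => exact ⟨[v], by simp [walks], by simp, by simpa using hv, by simp⟩
  | succ j ih =>
    obtain ⟨l, hl, hvl, hlK, hcard⟩ := ih (by omega)
    obtain ⟨u, hu, hul⟩ : ∃ u ∈ K, u ∉ l.toFinset := by
      by_contra! h
      have := Finset.card_le_card h
      omega
    obtain ⟨x, hx, y, hy, hxy, hyK⟩ := exists_step_out (hK v hv u hu) hvl hul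
    obtain ⟨l', hl', heq⟩ := exists_walk_insert hsymm hl (List.mem_toFinset.1 hx) hxy
    refine ⟨l', hl', ?_, ?_, ?_⟩
    · rw [heq]; exact Finset.mem_insert_of_mem hvl
    · rw [heq]; exact Finset.insert_subset hyK hlK
    · rw [heq, Finset.card_insert_of_notMem hy, hcard]

theorem IsCluster.mem_image_walks (hsymm : ∀ u v, u ∈ nb v → v ∈ nb u) {K : Finset V}
    (hK : IsCluster nb K) {v : V} (hv : v ∈ K) :
    K ∈ (walks nb (2 * (K.card - 1)) v).image List.toFinset := by
  have hpos := Finset.card_pos.2 ⟨v, hv⟩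
  obtain ⟨l, hl, -, hlK, hcard⟩ := hK.exists_walk hsymm hv (K.card - 1) (by omega)
  refine Finset.mem_image.2 ⟨l, hl, Finset.eq_of_subset_of_card_le hlK ?_⟩
  omega

/-- If every step changes `time` by at most one, then a cluster touching time `0` and containing `v`
has more than `time v` elements. -/
theorem IsCluster.time_lt_card {K : Finset V} (hK : IsCluster nb K) {time : V → ℕ}
    (htime : ∀ u, ∀ v ∈ nb u, time v ≤ time u + 1) {u v : V} (hu : u ∈ K) (hu0 : time u = 0)
    (hv : v ∈ K) : time v < K.card := by
  have key : ∀ t ≤ time v, ∃ w ∈ K, time w = t := by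
    have h := hK u hu v hv
    clear hv
    induction h with
    | refl =>
      intro t ht
      exact ⟨u, hu, by omega⟩
    | @tail b c _ hbc ih =>
      intro t ht
      have h1 := htime b c hbc.1
      rcases Nat.lt_or_ge (time b) t with h2 | h2
      · exact ⟨c, hbc.2, by omega⟩
      · exact ih t h2
  have hsub : Finset.range (time v + 1) ⊆ K.image time := by
    intro t ht
    obtain ⟨w, hw, rfl⟩ := key t (by simpa [Nat.lt_succ_iff] using ht)
    exact Finset.mem_image_of_mem _ hw
  have h1 := Finset.card_le_card hsub
  rw [Finset.card_range] at h1
  exact lt_of_lt_of_le (Nat.lt_succ_self _) (h1.trans Finset.card_image_le)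

open Classical in
/-- The clusters that contain `v`. -/
noncomputable def clustersAt [Fintype V] (nb : V → Finset V) (v : V) : Finset (Finset V) :=
  Finset.univ.filter fun K => IsCluster nb K ∧ v ∈ K

/-- Clusters of size `k + 1` are the vertex sets of walks with `2 * k` steps, so they contribute at
most `y * (Δ ^ 2 * y) ^ k`, and the sum is dominated by a geometric series. -/
theorem sum_clustersAt_le [Fintype V] (hsymm : ∀ u v, u ∈ nb v → v ∈ nb u) {Δ : ℕ}
    (hΔ : ∀ v, (nb v).card ≤ Δ) {y : ℝ} (hy : 0 ≤ y) (hy2 : y ≤ 1 / 2)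
    (hyΔ : (Δ : ℝ) ^ 2 * y ≤ 1 / 2) (v : V) : ∑ K ∈ clustersAt nb v, y ^ K.card ≤ 1 := by
  classical
  have hmaps : ∀ K ∈ clustersAt nb v, K.card - 1 ∈ Finset.range (Fintype.card V) := by
    intro K hK
    have h1 := Finset.card_pos.2 ⟨v, (Finset.mem_filter.1 hK).2.2⟩
    have h2 := Finset.card_le_univ K
    rw [Finset.mem_range]
    omega
  rw [← Finset.sum_fiberwise_of_maps_to hmaps]
  have hk : ∀ k, ∑ K ∈ (clustersAt nb v).filter (fun K => K.card - 1 = k), y ^ K.card ≤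
      1 / 2 * (1 / 2) ^ k := by
    intro k
    have h1 : ∀ K ∈ (clustersAt nb v).filter (fun K => K.card - 1 = k), y ^ K.card = y ^ (k + 1) := by
      intro K hK
      rw [Finset.mem_filter, clustersAt, Finset.mem_filter] at hK
      have h1 := Finset.card_pos.2 ⟨v, hK.1.2.2⟩
      congr 1
      omega
    have h2 : ((clustersAt nb v).filter (fun K => K.card - 1 = k)).card ≤ Δ ^ (2 * k) := by
      refine (Finset.card_le_card (t := (walks nb (2 * k) v).image List.toFinset) ?_).trans
        (Finset.card_image_le.trans (card_walks_le hΔ _ _))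
      intro K hK
      rw [Finset.mem_filter, clustersAt, Finset.mem_filter] at hK
      have := hK.1.2.1.mem_image_walks hsymm hK.1.2.2
      rwa [hK.2] at this
    rw [Finset.sum_congr rfl h1, Finset.sum_const, nsmul_eq_mul]
    calc (((clustersAt nb v).filter (fun K => K.card - 1 = k)).card : ℝ) * y ^ (k + 1)
        ≤ (Δ : ℝ) ^ (2 * k) * y ^ (k + 1) := by
          refine mul_le_mul_of_nonneg_right ?_ (pow_nonneg hy _)
          exact_mod_cast h2
      _ = y * ((Δ : ℝ) ^ 2 * y) ^ k := by rw [pow_succ, pow_mul, mul_pow]; ring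
      _ ≤ 1 / 2 * (1 / 2) ^ k := by gcongr
  refine (Finset.sum_le_sum fun k _ => hk k).trans ?_
  rw [← Finset.mul_sum]
  have h3 := sum_geometric_two_le (Fintype.card V)
  linarith

end Clusters

/-! ### Minimum-weight decoding -/

section Decoding

variable {B Λ : Type} [Fintype B] [DecidableEq B] (L : Matrix Λ B (ZMod 2))

theorem exists_decoder : ∃ dec : (Λ → ZMod 2) → B → ZMod 2, ∀ f : B → ZMod 2,
    L *ᵥ dec (L *ᵥ f) = L *ᵥ f ∧
      ∀ f', L *ᵥ f' = L *ᵥ f → hammingNorm (dec (L *ᵥ f)) ≤ hammingNorm f' := by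
  have h : ∀ σ : Λ → ZMod 2, ∃ e : B → ZMod 2, ∀ f, L *ᵥ f = σ →
      L *ᵥ e = σ ∧ hammingNorm e ≤ hammingNorm f := by
    intro σ
    by_cases hσ : ∃ f, L *ᵥ f = σ
    · obtain ⟨e, he, hmin⟩ := Set.exists_min_image {f | L *ᵥ f = σ} hammingNorm
        (Set.toFinite _) hσ
      exact ⟨e, fun f hf => ⟨he, hmin f hf⟩⟩
    · exact ⟨0, fun f hf => absurd ⟨f, hf⟩ hσ⟩
  choose dec hdec using h
  exact ⟨dec, fun f => ⟨(hdec _ f rfl).1, fun f' hf' => (hdec _ f' hf').2⟩⟩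

open Classical in
/-- The bits that share a parity check with a given bit. -/
noncomputable def checkNeighbors (b : B) : Finset B :=
  Finset.univ.filter fun b' => ∃ c, L c b ≠ 0 ∧ L c b' ≠ 0

theorem mem_checkNeighbors {b b' : B} :
    b' ∈ checkNeighbors L b ↔ ∃ c, L c b ≠ 0 ∧ L c b' ≠ 0 := by
  simp [checkNeighbors]

theorem checkNeighbors_symm (u v : B) (h : u ∈ checkNeighbors L v) : v ∈ checkNeighbors L u := by
  rw [mem_checkNeighbors] at h ⊢
  obtain ⟨c, h1, h2⟩ := h
  exact ⟨c, h2, h1⟩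

variable (g : B → ZMod 2)

/-- Two elements of the support of `g` are connected in the support. -/
def SuppConnected (u v : B) : Prop :=
  Relation.ReflTransGen (fun a b => b ∈ checkNeighbors L a ∧ g a ≠ 0 ∧ g b ≠ 0) u v

variable {L g}

theorem SuppConnected.symm {u v : B} (h : SuppConnected L g u v) : SuppConnected L g v u := by
  induction h with
  | refl => exact Relation.ReflTransGen.refl
  | tail _ hab ih => exact ih.head ⟨checkNeighbors_symm L _ _ hab.1, hab.2.2, hab.2.1⟩

theorem SuppConnected.ne_zero {u v : B} (h : SuppConnected L g u v) (hu : g u ≠ 0) : g v ≠ 0 := by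
  induction h with
  | refl => exact hu
  | tail _ h _ => exact h.2.2

variable (L g)

open Classical in
/-- The connected component of `b` in the support of `g`. -/
noncomputable def component (b : B) : Finset B := Finset.univ.filter fun v => SuppConnected L g b v

variable {L g}

theorem mem_component {b v : B} : v ∈ component L g b ↔ SuppConnected L g b v := by
  simp [component]

theorem self_mem_component (b : B) : b ∈ component L g b :=
  mem_component.2 Relation.ReflTransGen.refl

theorem component_eq {b v : B} (h : v ∈ component L g b) : component L g v = component L g b := by
  rw [mem_component] at h
  ext u
  rw [mem_component, mem_component]
  exact ⟨fun h' => h.trans h', fun h' => h.symm.trans h'⟩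

theorem component_eq_or_disjoint (b b' : B) :
    component L g b = component L g b' ∨ Disjoint (component L g b) (component L g b') := by
  by_cases h : Disjoint (component L g b) (component L g b')
  · exact Or.inr h
  · rw [Finset.not_disjoint_iff] at h
    obtain ⟨v, hv, hv'⟩ := h
    exact Or.inl ((component_eq hv).symm.trans (component_eq hv'))

theorem isCluster_component (b : B) : IsCluster (checkNeighbors L) (component L g b) := by
  intro u hu v hv
  have h : SuppConnected L g u v := (mem_component.1 hu).symm.trans (mem_component.1 hv)
  clear hv
  induction h with
  | refl => exact Relation.ReflTransGen.refl
  | @tail c d huc hcd ih =>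
    refine ih.tail ⟨hcd.1, ?_⟩
    rw [mem_component] at hu ⊢
    exact (hu.trans huc).tail hcd

variable (g) in
/-- The restriction of `g` to `K`. -/
def restrictTo (K : Finset B) : B → ZMod 2 := fun b => if b ∈ K then g b else 0

/-- Flipped bits in a common check are adjacent, so a check that meets the component sees all its
flipped bits there and agrees with `g`; the other checks see nothing. -/
theorem mulVec_restrictTo_component (hg : L *ᵥ g = 0) {b : B} (hb : g b ≠ 0) :
    L *ᵥ restrictTo g (component L g b) = 0 := by
  funext c
  by_cases h : ∃ v ∈ component L g b, L c v ≠ 0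
  · obtain ⟨v, hv, hcv⟩ := h
    have h1 : (L *ᵥ restrictTo g (component L g b)) c = (L *ᵥ g) c := by
      refine Finset.sum_congr rfl fun u _ => ?_
      dsimp only [restrictTo]
      split_ifs with hu
      · rfl
      · rw [mul_zero]
        by_contra hne
        refine hu ?_
        have h2 : L c u ≠ 0 := fun h0 => hne (by rw [h0, zero_mul])
        have h3 : g u ≠ 0 := fun h0 => hne (by rw [h0, mul_zero])
        rw [mem_component] at hv ⊢
        exact hv.tail ⟨(mem_checkNeighbors L).2 ⟨c, hcv, h2⟩, hv.ne_zero hb, h3⟩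
    rw [h1, hg]
  · push Not at h
    refine Finset.sum_eq_zero fun u _ => ?_
    dsimp only [restrictTo]
    split_ifs with hu
    · rw [h u hu, zero_mul]
    · rw [mul_zero]

theorem hammingNorm_restrictTo_component {b : B} (hb : g b ≠ 0) :
    hammingNorm (restrictTo g (component L g b)) = (component L g b).card := by
  rw [hammingNorm]
  congr 1
  ext v
  simp only [Finset.mem_filter, Finset.mem_univ, true_and]
  refine ⟨fun h => by_contra fun h' => h (if_neg h'), fun h => ?_⟩
  rw [restrictTo, if_pos h]
  exact (mem_component.1 h).ne_zero hb

theorem hammingNorm_eq_add (f : B → ZMod 2) (K : Finset B) :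
    hammingNorm f = (K.filter fun b => f b ≠ 0).card + (Kᶜ.filter fun b => f b ≠ 0).card := by
  rw [hammingNorm, ← Finset.card_union_of_disjoint, ← Finset.filter_union, Finset.union_compl]
  exact Finset.disjoint_filter_filter disjoint_compl_right

/-- At least half of a component of the difference of an error and its minimum-weight guess is in
the support of the error. -/
theorem card_component_le {f e : B → ZMod 2}
    (hmin : ∀ f', L *ᵥ f' = L *ᵥ e → hammingNorm e ≤ hammingNorm f') (hg : L *ᵥ (f + e) = 0) {b : B}
    (hb : (f + e) b ≠ 0) :
    (component L (f + e) b).card ≤ 2 * ((component L (f + e) b).filter fun v => f v ≠ 0).card := by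
  set K := component L (f + e) b with hK
  -- Changing the guess to the true error on `K` alone preserves the syndrome, so by minimality `e`
  -- is no heavier than `f` on `K`.
  have h1 := hmin (e + restrictTo (f + e) K) (by
    rw [mulVec_add, mulVec_restrictTo_component hg hb, add_zero])
  rw [hammingNorm_eq_add e K, hammingNorm_eq_add _ K] at h1
  have h2 : (K.filter fun v => (e + restrictTo (f + e) K) v ≠ 0) = K.filter fun v => f v ≠ 0 := by
    refine Finset.filter_congr fun v hv => ?_
    have : (e + restrictTo (f + e) K) v = f v := by
      simp only [Pi.add_apply, restrictTo, if_pos hv]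
      rw [add_left_comm, CharTwo.add_self_eq_zero, add_zero]
    rw [this]
  have h3 : (Kᶜ.filter fun v => (e + restrictTo (f + e) K) v ≠ 0) =
      Kᶜ.filter fun v => e v ≠ 0 := by
    refine Finset.filter_congr fun v hv => ?_
    have : (e + restrictTo (f + e) K) v = e v := by
      simp [restrictTo, Finset.mem_compl.1 hv]
    rw [this]
  rw [h2, h3] at h1
  have h4 : K.card ≤ (K.filter fun v => f v ≠ 0).card + (K.filter fun v => e v ≠ 0).card := by
    refine (Finset.card_le_card ?_).trans (Finset.card_union_le _ _)
    intro v hv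
    rw [Finset.mem_union, Finset.mem_filter, Finset.mem_filter]
    by_contra! hne
    have h5 := (mem_component.1 hv).ne_zero hb
    have h6 : f v = 0 := hne.1 hv
    have h7 : e v = 0 := hne.2 hv
    exact h5 (by rw [Pi.add_apply, h6, h7, add_zero])
  omega

/-- If all the components of an undetected error are small, then it has a residual error near the
components. -/
theorem exists_residual_of_components {O : Type}
    (𝓡 : Submodule (ZMod 2) ((B → ZMod 2) × PauliOp O)) {time : B → ℕ} {out : B → Option O} {τ M : ℕ}
    (hM : M ≤ τ + 1)
    (htime : ∀ u, ∀ v ∈ checkNeighbors L u, time v ≤ time u + 1)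
    (hfar : ∀ g, L *ᵥ g = 0 → hammingNorm g < M → (∀ b, time b = 0 → g b = 0) → (g, 0) ∈ 𝓡)
    {line : (B → ZMod 2) → PauliOp O}
    (hnear : ∀ g, L *ᵥ g = 0 → (∀ b, time b = τ → g b = 0) → (g, line g) ∈ 𝓡)
    (hline : ∀ g o, line g o ≠ 0 → ∃ b, g b ≠ 0 ∧ out b = some o)
    (hg : L *ᵥ g = 0) (hsmall : ∀ b, g b ≠ 0 → (component L g b).card < M) :
    ∃ P : PauliOp O, (g, P) ∈ 𝓡 ∧ ∀ o, P o ≠ 0 →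
      ∃ b, g b ≠ 0 ∧ ∃ v ∈ component L g b, out v = some o ∧ time v < (component L g b).card := by
  classical
  let 𝓚 : Finset (Finset B) := (Finset.univ.filter fun b => g b ≠ 0).image (component L g)
  have h𝓚 : ∀ K ∈ 𝓚, ∃ b, g b ≠ 0 ∧ component L g b = K := by
    intro K hK
    obtain ⟨b, hb, rfl⟩ := Finset.mem_image.1 hK
    exact ⟨b, (Finset.mem_filter.1 hb).2, rfl⟩
  have hK : ∀ K, ∃ P : PauliOp O, K ∈ 𝓚 → (restrictTo g K, P) ∈ 𝓡 ∧
      ∀ o, P o ≠ 0 → ∃ v ∈ K, out v = some o ∧ time v < K.card := by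
    intro K
    by_cases hK : K ∈ 𝓚
    swap
    · exact ⟨0, fun h => absurd h hK⟩
    obtain ⟨b, hb, rfl⟩ := h𝓚 K hK
    -- A small component that touches time 0 stays below time `τ`, because time grows by at most one
    -- along an edge and the component has at most `τ` elements.
    by_cases h0 : ∃ u ∈ component L g b, time u = 0
    · obtain ⟨u, hu, hu0⟩ := h0
      refine ⟨line (restrictTo g (component L g b)), fun _ => ⟨?_, fun o ho => ?_⟩⟩
      · refine hnear _ (mulVec_restrictTo_component hg hb) fun v hv => if_neg fun hvK => ?_
        have h1 := (isCluster_component b).time_lt_card htime hu hu0 hvK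
        have h2 := hsmall b hb
        omega
      · obtain ⟨v, hv, hvo⟩ := hline _ o ho
        have hvK : v ∈ component L g b := by
          by_contra h
          exact hv (if_neg h)
        exact ⟨v, hvK, hvo, (isCluster_component b).time_lt_card htime hu hu0 hvK⟩
    · push Not at h0
      refine ⟨0, fun _ => ⟨hfar _ (mulVec_restrictTo_component hg hb) ?_ fun v hv =>
        if_neg fun hvK => h0 v hvK hv, fun o ho => absurd rfl ho⟩⟩
      rw [hammingNorm_restrictTo_component hb]
      exact hsmall b hb
  choose P hP using hK
  refine ⟨∑ K ∈ 𝓚, P K, ?_, fun o ho => ?_⟩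
  · have hsum : ∑ K ∈ 𝓚, restrictTo g K = g := by
      funext b
      rw [Finset.sum_apply]
      by_cases hb : g b = 0
      · rw [hb]
        refine Finset.sum_eq_zero fun K _ => ?_
        rw [restrictTo, hb, ite_self]
      · rw [Finset.sum_eq_single (component L g b)]
        · exact if_pos (self_mem_component b)
        · intro K hK hne
          obtain ⟨b', -, rfl⟩ := h𝓚 K hK
          exact if_neg fun h => hne (component_eq h).symm
        · intro h
          exact absurd (Finset.mem_image_of_mem (component L g)
            (Finset.mem_filter.2 ⟨Finset.mem_univ b, hb⟩)) h
    have h1 := 𝓡.sum_mem fun K hK => (hP K hK).1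
    have h2 : ∑ K ∈ 𝓚, (restrictTo g K, P K) = (g, ∑ K ∈ 𝓚, P K) := by
      refine Prod.ext ?_ ?_
      · rw [Prod.fst_sum]
        exact hsum
      · rw [Prod.snd_sum]
    rwa [h2] at h1
  · rw [Finset.sum_apply] at ho
    obtain ⟨K, hK, hne⟩ := Finset.exists_ne_zero_of_sum_ne_zero ho
    obtain ⟨b, hb, rfl⟩ := h𝓚 K hK
    exact ⟨b, hb, (hP _ hK).2 o hne⟩

end Decoding

/-! ### Local stochastic noise -/

section Prob

variable {Ω : Type} (μ : PMF Ω)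

theorem toOuterMeasure_ne_top (A : Set Ω) : μ.toOuterMeasure A ≠ ⊤ := by
  refine ne_top_of_le_ne_top ENNReal.one_ne_top ?_
  rw [← (PMF.toOuterMeasure_apply_eq_one_iff μ (s := Set.univ)).2 (Set.subset_univ _)]
  exact MeasureTheory.measure_mono (Set.subset_univ A)

theorem prob_mono {A A' : Set Ω} (h : A ⊆ A') : prob μ A ≤ prob μ A' :=
  ENNReal.toReal_mono (toOuterMeasure_ne_top μ A') (MeasureTheory.measure_mono h)

theorem prob_univ : prob μ Set.univ = 1 := by
  rw [prob, (PMF.toOuterMeasure_apply_eq_one_iff μ (s := Set.univ)).2 (Set.subset_univ _),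
    ENNReal.toReal_one]

theorem prob_empty : prob μ ∅ = 0 := by
  rw [prob, MeasureTheory.measure_empty, ENNReal.toReal_zero]

theorem prob_le_one (A : Set Ω) : prob μ A ≤ 1 := by
  rw [← prob_univ μ]
  exact prob_mono μ (Set.subset_univ A)

theorem prob_union_le (A A' : Set Ω) : prob μ (A ∪ A') ≤ prob μ A + prob μ A' := by
  rw [prob, prob, prob, ← ENNReal.toReal_add (toOuterMeasure_ne_top μ A)
    (toOuterMeasure_ne_top μ A')]
  exact ENNReal.toReal_mono (ENNReal.add_ne_top.2 ⟨toOuterMeasure_ne_top μ A,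
    toOuterMeasure_ne_top μ A'⟩) (MeasureTheory.measure_union_le A A')

theorem one_sub_prob_compl_le (A : Set Ω) : 1 - prob μ Aᶜ ≤ prob μ A := by
  have h := prob_union_le μ A Aᶜ
  rw [Set.union_compl_self, prob_univ] at h
  linarith

theorem prob_le_sum {ι : Type} (s : Finset ι) (A : Set Ω) (A' : ι → Set Ω)
    (h : ∀ ω ∈ A, ∃ i ∈ s, ω ∈ A' i) : prob μ A ≤ ∑ i ∈ s, prob μ (A' i) := by
  classical
  induction s using Finset.induction_on generalizing A with
  | empty =>
    have : A = ∅ := by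
      rw [Set.eq_empty_iff_forall_notMem]
      intro ω hω
      obtain ⟨i, hi, -⟩ := h ω hω
      simp at hi
    rw [this, prob_empty, Finset.sum_empty]
  | insert i s hi ih =>
    rw [Finset.sum_insert hi]
    have h1 := ih (A \ A' i) fun ω hω => by
      obtain ⟨j, hj, hj'⟩ := h ω hω.1
      rcases Finset.mem_insert.1 hj with rfl | hj
      · exact absurd hj' hω.2
      · exact ⟨j, hj, hj'⟩
    have h2 := prob_union_le μ (A' i) (A \ A' i)
    have h3 : prob μ A ≤ prob μ (A' i ∪ A \ A' i) := prob_mono μ fun ω hω => by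
      by_cases h : ω ∈ A' i
      · exact Or.inl h
      · exact Or.inr ⟨hω, h⟩
    linarith

variable {V : Type}

/-- The random set `F` is local stochastic of rate `p`. -/
def LocalStochasticSet (F : Ω → Set V) (p : ℝ) : Prop :=
  ∀ S : Finset V, prob μ {ω | ∀ q ∈ S, q ∈ F ω} ≤ p ^ S.card

variable {μ}

/-- The union of local stochastic errors at different times, with arbitrary correlations. -/
theorem localStochasticSet_exists {k : ℕ} (E : Ω → Fin k → PauliOp V) (hk : 0 < k) {r : ℝ}
    (hr : 0 ≤ r) (hr1 : r ≤ 1) (h : ∀ t, LocalStochastic μ (fun ω => E ω t) (r ^ k)) :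
    LocalStochasticSet μ (fun ω => {v | ∃ t, E ω t v ≠ 0}) (2 * k * r) := by
  classical
  have : Nonempty (Fin k) := ⟨⟨0, hk⟩⟩
  intro S
  rcases S.eq_empty_or_nonempty with rfl | hS
  · simpa using prob_le_one μ _
  -- By pigeonhole a single time accounts for at least a fraction `1 / k` of `S`, so no independence
  -- between times is needed. There are at most `k * 2 ^ |S| ≤ (2 * k) ^ |S|` choices of a time and
  -- a subset, as `S` is nonempty.
  have h1 := prob_le_sum μ (Finset.univ ×ˢ S.powerset.filter fun H => S.card ≤ k * H.card)
    {ω | ∀ q ∈ S, q ∈ {v | ∃ t, E ω t v ≠ 0}} (fun p : Fin k × Finset V =>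
      {ω | ∀ q ∈ p.2, E ω p.1 q ≠ 0}) ?_
  · refine h1.trans ?_
    have h2 : ∀ p ∈ (Finset.univ : Finset (Fin k)) ×ˢ
        S.powerset.filter (fun H => S.card ≤ k * H.card),
        prob μ {ω | ∀ q ∈ p.2, E ω p.1 q ≠ 0} ≤ r ^ S.card := by
      intro p hp
      rw [Finset.mem_product, Finset.mem_filter] at hp
      refine (h p.1 p.2).trans ?_
      rw [← pow_mul]
      exact pow_le_pow_of_le_one hr hr1 hp.2.2
    refine (Finset.sum_le_card_nsmul _ _ _ h2).trans ?_
    rw [nsmul_eq_mul, Finset.card_product, Finset.card_univ, Fintype.card_fin, mul_pow, mul_pow]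
    refine mul_le_mul_of_nonneg_right ?_ (pow_nonneg hr _)
    rw [mul_comm ((2 : ℝ) ^ _)]
    have h3 : k ≤ k ^ S.card := Nat.le_self_pow (Finset.card_pos.2 hS).ne' k
    have h4 : (S.powerset.filter fun H => S.card ≤ k * H.card).card ≤ 2 ^ S.card :=
      (Finset.card_filter_le _ _).trans_eq (Finset.card_powerset S)
    exact_mod_cast Nat.mul_le_mul h3 h4
  · intro ω hω
    have hcov : S.card ≤ ∑ t, (S.filter fun q => E ω t q ≠ 0).card := by
      refine (Finset.card_le_card (t := Finset.univ.biUnion fun t =>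
        S.filter fun q => E ω t q ≠ 0) ?_).trans Finset.card_biUnion_le
      intro q hq
      obtain ⟨t, ht⟩ := hω q hq
      exact Finset.mem_biUnion.2 ⟨t, Finset.mem_univ _, Finset.mem_filter.2 ⟨hq, ht⟩⟩
    obtain ⟨t, -, ht⟩ := Finset.exists_le_of_sum_le (s := (Finset.univ : Finset (Fin k)))
      (f := fun _ => S.card) (g := fun t => k * (S.filter fun q => E ω t q ≠ 0).card)
      Finset.univ_nonempty (by
        rw [← Finset.mul_sum, Finset.sum_const, Finset.card_univ, Fintype.card_fin, smul_eq_mul]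
        exact Nat.mul_le_mul_left _ hcov)
    refine ⟨(t, S.filter fun q => E ω t q ≠ 0), ?_, fun q hq => (Finset.mem_filter.1 hq).2⟩
    rw [Finset.mem_product, Finset.mem_filter, Finset.mem_powerset]
    exact ⟨Finset.mem_univ _, Finset.filter_subset _ _, ht⟩

/-- Errors that have spread to a bounded neighbourhood. -/
theorem LocalStochasticSet.spread [Fintype V] {F F' : Ω → Set V} {c : ℕ} {r : ℝ} (hr : 0 ≤ r)
    (hr1 : r ≤ 1) (h : LocalStochasticSet μ F (r ^ c)) (cl : V → Finset V)
    (hcl : ∀ v, (cl v).card ≤ c) (hcl' : ∀ u, Set.ncard {v | u ∈ cl v} ≤ c)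
    (hF : ∀ ω, ∀ v ∈ F' ω, ∃ u ∈ cl v, u ∈ F ω) : LocalStochasticSet μ F' (2 ^ c * r) := by
  classical
  intro S
  -- `H` is the set of sources of the errors on `S`; each source accounts for at most `c` of them.
  have h1 := prob_le_sum μ ((S.biUnion cl).powerset.filter fun H => S.card ≤ c * H.card)
    {ω | ∀ q ∈ S, q ∈ F' ω} (fun H => {ω | ∀ q ∈ H, q ∈ F ω}) ?_
  · refine h1.trans ?_
    have h2 : ∀ H ∈ (S.biUnion cl).powerset.filter (fun H => S.card ≤ c * H.card),
        prob μ {ω | ∀ q ∈ H, q ∈ F ω} ≤ r ^ S.card := by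
      intro H hH
      rw [Finset.mem_filter] at hH
      refine (h H).trans ?_
      rw [← pow_mul]
      exact pow_le_pow_of_le_one hr hr1 hH.2
    refine (Finset.sum_le_card_nsmul _ _ _ h2).trans ?_
    rw [nsmul_eq_mul, mul_pow]
    refine mul_le_mul_of_nonneg_right ?_ (pow_nonneg hr _)
    have h3 : (S.biUnion cl).card ≤ c * S.card := by
      rw [mul_comm]
      exact Finset.card_biUnion_le_card_mul _ _ _ fun v _ => hcl v
    have h4 : ((S.biUnion cl).powerset.filter fun H => S.card ≤ c * H.card).card ≤
        2 ^ (c * S.card) := by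
      refine (Finset.card_filter_le _ _).trans ?_
      rw [Finset.card_powerset]
      exact Nat.pow_le_pow_right (by norm_num) h3
    rw [← pow_mul]
    exact_mod_cast h4
  · intro ω hω
    refine ⟨(S.biUnion cl).filter (· ∈ F ω), ?_, fun q hq => (Finset.mem_filter.1 hq).2⟩
    rw [Finset.mem_filter, Finset.mem_powerset]
    refine ⟨Finset.filter_subset _ _, ?_⟩
    have h5 : S ⊆ ((S.biUnion cl).filter (· ∈ F ω)).biUnion fun u =>
        Finset.univ.filter fun v => u ∈ cl v := by
      intro v hv
      obtain ⟨u, hu, huF⟩ := hF ω v (hω v hv)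
      refine Finset.mem_biUnion.2 ⟨u, Finset.mem_filter.2 ⟨Finset.mem_biUnion.2 ⟨v, hv, hu⟩, huF⟩, ?_⟩
      simpa using hu
    refine (Finset.card_le_card h5).trans ?_
    rw [mul_comm]
    refine Finset.card_biUnion_le_card_mul _ _ _ fun u _ => ?_
    have := hcl' u
    rwa [Set.ncard_eq_toFinset_card', Set.toFinset_ofPred] at this

theorem sum_biUnion_le_sum {ι κ : Type} [DecidableEq κ] (s : Finset ι) (t : ι → Finset κ) (x : κ → ℝ)
    (hx : ∀ j, 0 ≤ x j) : ∑ j ∈ s.biUnion t, x j ≤ ∑ i ∈ s, ∑ j ∈ t i, x j := by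
  classical
  induction s using Finset.induction_on with
  | empty => simp
  | insert i s hi ih =>
    rw [Finset.biUnion_insert, Finset.sum_insert hi]
    have h := Finset.sum_union_inter (s₁ := t i) (s₂ := s.biUnion t) (f := x)
    have h' := Finset.sum_nonneg fun j (_ : j ∈ t i ∩ s.biUnion t) => hx j
    linarith

open Classical in
/-- At least half of `K` is in `F`. -/
def HalfFilled (F : Set V) (K : Finset V) : Prop := K.card ≤ 2 * (K.filter (· ∈ F)).card

/-- Union bound over the subsets that make up at least half of `K`: each has probability at most `δ
^ |K|`. -/
theorem LocalStochasticSet.prob_halfFilled_le {F : Ω → Set V} {δ : ℝ} (hδ : 0 ≤ δ) (hδ1 : δ ≤ 1)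
    (h : LocalStochasticSet μ F (δ ^ 2)) (K : Finset V) :
    prob μ {ω | HalfFilled (F ω) K} ≤ (2 * δ) ^ K.card := by
  classical
  have h1 := prob_le_sum μ (K.powerset.filter fun H => K.card ≤ 2 * H.card)
    {ω | HalfFilled (F ω) K} (fun H => {ω | ∀ q ∈ H, q ∈ F ω}) ?_
  · refine h1.trans ?_
    have h2 : ∀ H ∈ K.powerset.filter (fun H => K.card ≤ 2 * H.card),
        prob μ {ω | ∀ q ∈ H, q ∈ F ω} ≤ δ ^ K.card := by
      intro H hH
      rw [Finset.mem_filter] at hH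
      refine (h H).trans ?_
      rw [← pow_mul]
      exact pow_le_pow_of_le_one hδ hδ1 hH.2
    refine (Finset.sum_le_card_nsmul _ _ _ h2).trans ?_
    rw [nsmul_eq_mul, mul_pow]
    refine mul_le_mul_of_nonneg_right ?_ (pow_nonneg hδ _)
    have h4 : (K.powerset.filter fun H => K.card ≤ 2 * H.card).card ≤ 2 ^ K.card :=
      (Finset.card_filter_le _ _).trans_eq (Finset.card_powerset K)
    exact_mod_cast h4
  · intro ω hω
    refine ⟨K.filter (· ∈ F ω), ?_, fun q hq => (Finset.mem_filter.1 hq).2⟩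
    rw [Finset.mem_filter, Finset.mem_powerset]
    exact ⟨Finset.filter_subset _ _, by
      have h5 : HalfFilled (F ω) K := hω
      rw [HalfFilled] at h5
      convert h5⟩

theorem HalfFilled.biUnion {ι : Type} [DecidableEq V] {F : Set V} {s : Finset ι} {K : ι → Finset V}
    (h : ∀ i ∈ s, HalfFilled F (K i)) (hdisj : (s : Set ι).PairwiseDisjoint K) :
    HalfFilled F (s.biUnion K) := by
  classical
  rw [HalfFilled, Finset.filter_biUnion, Finset.card_biUnion hdisj, Finset.card_biUnion,
    Finset.mul_sum]
  · exact Finset.sum_le_sum h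
  · exact fun i hi j hj hij => Finset.disjoint_filter_filter (hdisj hi hj hij)

/-! ### Peierls estimates for half-filled clusters. -/

section Peierls

variable [Fintype V] [DecidableEq V] {nb : V → Finset V} (hsymm : ∀ u v, u ∈ nb v → v ∈ nb u)
  {Δ : ℕ} (hΔ : ∀ v, (nb v).card ≤ Δ) {F : Ω → Set V} {δ y : ℝ} (hδ : 0 ≤ δ) (hδ1 : δ ≤ 1)
  (hF : LocalStochasticSet μ F (δ ^ 2)) (hy : 0 ≤ y) (hy2 : y ≤ 1 / 2)
  (hyΔ : (Δ : ℝ) ^ 2 * y ≤ 1 / 2)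

include hsymm hΔ hδ hδ1 hF hy hy2 hyΔ

/-- Large half-filled clusters are unlikely. -/
theorem prob_exists_large_cluster_le (hδy : 2 * δ ≤ y * y) (M : ℕ) :
    prob μ {ω | ∃ K, IsCluster nb K ∧ K.Nonempty ∧ M ≤ K.card ∧ HalfFilled (F ω) K} ≤
      Fintype.card V * y ^ M := by
  classical
  have h1 := prob_le_sum μ (Finset.univ.sigma fun v : V =>
      (clustersAt nb v).filter fun K => M ≤ K.card)
    {ω | ∃ K, IsCluster nb K ∧ K.Nonempty ∧ M ≤ K.card ∧ HalfFilled (F ω) K}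
    (fun p => {ω | HalfFilled (F ω) p.2}) ?_
  · refine h1.trans ?_
    rw [Finset.sum_sigma]
    have h2 : ∀ v ∈ (Finset.univ : Finset V),
        ∑ K ∈ (clustersAt nb v).filter (fun K => M ≤ K.card), prob μ {ω | HalfFilled (F ω) K} ≤
          y ^ M := by
      intro v _
      have h3 : ∀ K ∈ (clustersAt nb v).filter (fun K => M ≤ K.card),
          prob μ {ω | HalfFilled (F ω) K} ≤ y ^ M * y ^ K.card := by
        intro K hK
        -- Of the two factors `y ^ |K|`, one gives `y ^ M` and the other pays for the number of
        -- clusters.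
        refine (hF.prob_halfFilled_le hδ hδ1 K).trans ?_
        refine (pow_le_pow_left₀ (by positivity) hδy _).trans ?_
        rw [mul_pow]
        refine mul_le_mul_of_nonneg_right ?_ (pow_nonneg hy _)
        exact pow_le_pow_of_le_one hy (by linarith) (Finset.mem_filter.1 hK).2
      refine (Finset.sum_le_sum h3).trans ?_
      rw [← Finset.mul_sum]
      refine mul_le_of_le_one_right (pow_nonneg hy _) ?_
      refine (Finset.sum_le_sum_of_subset_of_nonneg (Finset.filter_subset _ _)
        fun _ _ _ => pow_nonneg hy _).trans ?_
      exact sum_clustersAt_le hsymm hΔ hy hy2 hyΔ v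
    refine (Finset.sum_le_card_nsmul _ _ _ h2).trans_eq ?_
    rw [nsmul_eq_mul, Finset.card_univ]
  · rintro ω ⟨K, hK, ⟨v, hv⟩, hM, hω⟩
    refine ⟨⟨v, K⟩, ?_, hω⟩
    simp only [Finset.mem_sigma, Finset.mem_univ, Finset.mem_filter, clustersAt, true_and]
    exact ⟨⟨hK, hv⟩, hM⟩

open Classical in
/-- The clusters that contain a vertex above `o` whose level is less than their size. -/
noncomputable def clustersOver {O : Type} (nb : V → Finset V) (root : V → Option O) (level : V → ℕ)
    (o : O) : Finset (Finset V) :=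
  Finset.univ.filter fun K => IsCluster nb K ∧ ∃ v ∈ K, root v = some o ∧ level v < K.card

-- A cluster may meet the line above `o` at any level below its size. The extra factor `(1 / 4) ^
-- |K|` pays for this: with at most three vertices at each level `t`, the sum is at most the series
-- of `3 / 4 ^ (t + 1)`, which is 1.
omit [DecidableEq V] hδ hδ1 hF in
theorem sum_clustersOver_le {O : Type} (root : V → Option O) (level : V → ℕ) (o : O)
    (hroot : ∀ t, Set.ncard {v | root v = some o ∧ level v = t} ≤ 3) :
    ∑ K ∈ clustersOver nb root level o, (y / 4) ^ K.card ≤ 1 := by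
  classical
  have h1 : clustersOver nb root level o ⊆ (Finset.univ.filter fun v => root v = some o).biUnion
      fun v => (clustersAt nb v).filter fun K => level v < K.card := by
    intro K hK
    simp only [clustersOver, Finset.mem_filter, Finset.mem_univ, true_and] at hK
    obtain ⟨hK, v, hv, hvo, hlt⟩ := hK
    refine Finset.mem_biUnion.2 ⟨v, by simpa using hvo, ?_⟩
    simp only [Finset.mem_filter, clustersAt, Finset.mem_univ, true_and]
    exact ⟨⟨hK, hv⟩, hlt⟩
  have h2 : ∀ v, ∑ K ∈ (clustersAt nb v).filter (fun K => level v < K.card), (y / 4) ^ K.card ≤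
      (1 / 4) ^ (level v + 1) := by
    intro v
    have h3 : ∀ K ∈ (clustersAt nb v).filter (fun K => level v < K.card),
        (y / 4) ^ K.card ≤ (1 / 4) ^ (level v + 1) * y ^ K.card := by
      intro K hK
      rw [div_eq_mul_one_div, mul_comm, mul_pow]
      refine mul_le_mul_of_nonneg_right ?_ (pow_nonneg hy _)
      exact pow_le_pow_of_le_one (by norm_num) (by norm_num) (Finset.mem_filter.1 hK).2
    refine (Finset.sum_le_sum h3).trans ?_
    rw [← Finset.mul_sum]
    refine mul_le_of_le_one_right (by positivity) ?_
    refine (Finset.sum_le_sum_of_subset_of_nonneg (Finset.filter_subset _ _)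
      fun _ _ _ => pow_nonneg hy _).trans ?_
    exact sum_clustersAt_le hsymm hΔ hy hy2 hyΔ v
  refine (Finset.sum_le_sum_of_subset_of_nonneg h1 fun _ _ _ => by positivity).trans ?_
  refine (sum_biUnion_le_sum _ _ _ fun _ => by positivity).trans ?_
  refine (Finset.sum_le_sum fun v _ => h2 v).trans ?_
  rw [← Finset.sum_fiberwise_of_maps_to (g := level)
    (t := Finset.range (Finset.univ.sup level + 1))
    (fun v _ => Finset.mem_range.2 (Nat.lt_succ_of_le (Finset.le_sup (Finset.mem_univ v))))]
  have h4 : ∀ t ∈ Finset.range (Finset.univ.sup level + 1),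
      ∑ v ∈ (Finset.univ.filter fun v => root v = some o) with level v = t,
        ((1 : ℝ) / 4) ^ (level v + 1) ≤ 3 / 4 * (1 / 4) ^ t := by
    intro t _
    have h5 : ∀ v ∈ (Finset.univ.filter fun v => root v = some o).filter (fun v => level v = t),
        ((1 : ℝ) / 4) ^ (level v + 1) ≤ (1 / 4) ^ (t + 1) := by
      intro v hv
      rw [(Finset.mem_filter.1 hv).2]
    refine (Finset.sum_le_card_nsmul _ _ _ h5).trans ?_
    have h6 := hroot t
    rw [Set.ncard_eq_toFinset_card', Set.toFinset_ofPred] at h6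
    rw [Finset.filter_filter, nsmul_eq_mul, pow_succ']
    have h7 : ((Finset.univ.filter fun v => root v = some o ∧ level v = t).card : ℝ) ≤ 3 := by
      exact_mod_cast h6
    have h8 : (0 : ℝ) ≤ 1 / 4 * (1 / 4) ^ t := by positivity
    calc _ ≤ 3 * (1 / 4 * (1 / 4 : ℝ) ^ t) := mul_le_mul_of_nonneg_right h7 h8
      _ = _ := by ring
  refine (Finset.sum_le_sum h4).trans ?_
  rw [← Finset.mul_sum, geom_sum_eq (by norm_num)]
  have h9 : (0 : ℝ) ≤ (1 / 4) ^ (Finset.univ.sup level + 1) := by positivity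
  rw [show (3 : ℝ) / 4 * (((1 / 4) ^ (Finset.univ.sup level + 1) - 1) / (1 / 4 - 1)) =
    1 - (1 / 4) ^ (Finset.univ.sup level + 1) by ring]
  linarith

end Peierls

/-- Disjoint half-filled candidates that cover a given set are unlikely. -/
theorem LocalStochasticSet.prob_exists_candidates_le [Fintype V] [DecidableEq V] {O : Type}
    [Fintype O] [DecidableEq O] {F : Ω → Set V} {δ z : ℝ} (hδ : 0 ≤ δ) (hδ1 : δ ≤ 1)
    (hF : LocalStochasticSet μ F (δ ^ 2)) (hz : 0 ≤ z) (hz1 : z ≤ 1) (hδz : 2 * δ ≤ z * z)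
    (cand : O → Finset (Finset V)) (root : V → Option O)
    (hcand : ∀ o, ∀ K ∈ cand o, ∃ v ∈ K, root v = some o)
    (hsum : ∀ o, ∑ K ∈ cand o, z ^ K.card ≤ 1) (S : Finset O) :
    prob μ {ω | ∃ A : O → Finset V, (∀ s ∈ S, A s ∈ cand s ∧ HalfFilled (F ω) (A s)) ∧
      ∀ s ∈ S, ∀ t ∈ S, A s = A t ∨ Disjoint (A s) (A t)} ≤ (2 * z) ^ S.card := by
  classical
  -- One cluster may serve several elements of `S`. It is assigned to a single representative and
  -- the others get `∅`, so that the chosen sets are disjoint.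
  let choices : O → Finset (Finset V) := fun s => if s ∈ S then insert ∅ (cand s) else {∅}
  have h1 := prob_le_sum μ ((Fintype.piFinset choices).filter fun K =>
      (Finset.univ.biUnion K).card = ∑ s, (K s).card ∧ S.card ≤ ∑ s, (K s).card)
    {ω | ∃ A : O → Finset V, (∀ s ∈ S, A s ∈ cand s ∧ HalfFilled (F ω) (A s)) ∧
      ∀ s ∈ S, ∀ t ∈ S, A s = A t ∨ Disjoint (A s) (A t)}
    (fun K => {ω | HalfFilled (F ω) (Finset.univ.biUnion K)}) ?_
  · refine h1.trans ?_
    have h2 : ∀ K ∈ (Fintype.piFinset choices).filter fun K =>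
        (Finset.univ.biUnion K).card = ∑ s, (K s).card ∧ S.card ≤ ∑ s, (K s).card,
        prob μ {ω | HalfFilled (F ω) (Finset.univ.biUnion K)} ≤
          z ^ S.card * ∏ s, z ^ (K s).card := by
      intro K hK
      obtain ⟨-, hcard, hS⟩ := Finset.mem_filter.1 hK
      refine (hF.prob_halfFilled_le hδ hδ1 _).trans ?_
      -- One factor `z` per vertex gives `z ^ |S|`; the other makes the sum over the candidates
      -- converge.
      refine (pow_le_pow_left₀ (by positivity) hδz _).trans ?_
      rw [mul_pow, hcard, Finset.prod_pow_eq_pow_sum]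
      exact mul_le_mul_of_nonneg_right (pow_le_pow_of_le_one hz hz1 hS) (pow_nonneg hz _)
    refine (Finset.sum_le_sum h2).trans ?_
    rw [← Finset.mul_sum, mul_pow, mul_comm]
    refine mul_le_mul_of_nonneg_right ?_ (pow_nonneg hz _)
    refine (Finset.sum_le_sum_of_subset_of_nonneg (Finset.filter_subset _ _)
      fun _ _ _ => Finset.prod_nonneg fun _ _ => pow_nonneg hz _).trans ?_
    rw [← Finset.prod_univ_sum choices fun _ K => z ^ K.card]
    calc ∏ s, ∑ K ∈ choices s, z ^ K.card ≤ ∏ s, if s ∈ S then (2 : ℝ) else 1 := by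
          refine Finset.prod_le_prod (fun s _ => Finset.sum_nonneg fun _ _ => pow_nonneg hz _)
            fun s _ => ?_
          simp only [choices]
          split_ifs with hs
          · by_cases he : ∅ ∈ cand s
            · rw [Finset.insert_eq_of_mem he]
              linarith [hsum s]
            · rw [Finset.sum_insert he, Finset.card_empty, pow_zero]
              linarith [hsum s]
          · simp
      _ = 2 ^ S.card := by
          rw [Finset.prod_ite_mem, Finset.univ_inter, Finset.prod_const]
  · rintro ω ⟨A, hA, hdisj⟩
    obtain ⟨S', hS', hinj, himg⟩ : ∃ S' ⊆ S, Set.InjOn A S' ∧ S'.image A = S.image A := by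
      obtain ⟨S', hS', hinj, himg⟩ :=
        Finset.exists_subset_injOn_image_eq_of_surjOn (f := A) (S : Set O) (S.image A) (by
          rw [Finset.coe_image]
          exact Set.surjOn_image _ _)
      exact ⟨S', Finset.coe_subset.1 hS', hinj, himg⟩
    have hpw : ∀ s t, s ≠ t → Disjoint (if s ∈ S' then A s else ∅) (if t ∈ S' then A t else ∅) := by
      intro s t hst
      split_ifs with hs ht
      · exact (hdisj s (hS' hs) t (hS' ht)).resolve_left fun h => hst (hinj hs ht h)
      all_goals simp
    have hcard := Finset.card_biUnion (s := Finset.univ)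
      (t := fun s => if s ∈ S' then A s else ∅) fun s _ t _ hst => hpw s t hst
    refine ⟨fun s => if s ∈ S' then A s else ∅, Finset.mem_filter.2 ⟨?_, hcard, ?_⟩, ?_⟩
    · rw [Fintype.mem_piFinset]
      intro s
      simp only [choices]
      by_cases hs : s ∈ S'
      · rw [if_pos hs, if_pos (hS' hs)]
        exact Finset.mem_insert_of_mem (hA s (hS' hs)).1
      · rw [if_neg hs]
        split_ifs <;> simp
    -- Every element of `S` is the root of some vertex of the selected clusters, so these have at
    -- least `|S|` vertices in total.
    · rw [← hcard, ← Finset.card_map Function.Embedding.some]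
      refine (Finset.card_le_card (t := (Finset.univ.biUnion fun s =>
        if s ∈ S' then A s else ∅).image root) fun o ho => ?_).trans Finset.card_image_le
      obtain ⟨s, hs, rfl⟩ := Finset.mem_map.1 ho
      obtain ⟨v, hv, hvs⟩ := hcand s _ (hA s hs).1
      obtain ⟨t, ht, hts⟩ := Finset.mem_image.1 (himg ▸ Finset.mem_image_of_mem A hs)
      refine Finset.mem_image.2 ⟨v, Finset.mem_biUnion.2 ⟨t, Finset.mem_univ _, ?_⟩, hvs⟩
      rwa [if_pos ht, hts]
    · refine HalfFilled.biUnion (fun s _ => ?_) fun s _ t _ hst => hpw s t hst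
      split_ifs with hs
      · exact (hA s (hS' hs)).2
      · simp [HalfFilled]

end Prob

/-! ### Residual errors after decoding -/

section Residual

variable {O B Λ : Type} [Fintype O] [DecidableEq O] [Fintype B] [DecidableEq B]
  (L : Matrix Λ B (ZMod 2))

/-- The graph of the qubits in which the measured qubits are joined if they share a parity check. -/
noncomputable def qubitNeighbors : O ⊕ B → Finset (O ⊕ B)
  | Sum.inl _ => ∅
  | Sum.inr b => (checkNeighbors L b).map Function.Embedding.inr

theorem qubitNeighbors_symm (u v : O ⊕ B) (h : u ∈ qubitNeighbors L v) :
    v ∈ qubitNeighbors L u := by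
  rcases v with o | b
  · simp [qubitNeighbors] at h
  · obtain ⟨b', hb', rfl⟩ := Finset.mem_map.1 h
    exact Finset.mem_map_of_mem _ (checkNeighbors_symm L _ _ hb')

theorem card_qubitNeighbors_le {Δ : ℕ} (hΔ : ∀ b, (checkNeighbors L b).card ≤ Δ) (v : O ⊕ B) :
    (qubitNeighbors L v).card ≤ Δ := by
  rcases v with o | b
  · simp [qubitNeighbors]
  · rw [qubitNeighbors, Finset.card_map]
    exact hΔ b

theorem IsCluster.map_inr {K : Finset B} (hK : IsCluster (checkNeighbors L) K) :
    IsCluster (qubitNeighbors (O := O) L) (K.map Function.Embedding.inr) := by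
  intro u' hu' v' hv'
  obtain ⟨u, hu, rfl⟩ := Finset.mem_map.1 hu'
  obtain ⟨v, hv, rfl⟩ := Finset.mem_map.1 hv'
  exact (hK u hu v hv).lift _ fun a b hab =>
    ⟨Finset.mem_map_of_mem _ hab.1, Finset.mem_map_of_mem _ hab.2⟩

theorem halfFilled_setOf {V : Type} {p : V → Prop} [DecidablePred p] {K : Finset V}
    (h : K.card ≤ 2 * (K.filter p).card) : HalfFilled {v | p v} K := by
  rw [HalfFilled]
  convert h
  exact Iff.rfl

theorem isCluster_singleton {V : Type} (nb : V → Finset V) (v : V) : IsCluster nb {v} := by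
  intro u hu u' hu'
  rw [Finset.mem_singleton.1 hu, Finset.mem_singleton.1 hu']

/-- The output qubit to which a qubit belongs. -/
def rootOf (out : B → Option O) : O ⊕ B → Option O := Sum.elim some out

/-- The time of a qubit. -/
def levelOf (time : B → ℕ) : O ⊕ B → ℕ := Sum.elim 0 time

/-- The flips of the measurement outcomes caused by a Pauli error. -/
def outcomeFlips (P : PauliOp (O ⊕ B)) : B → ZMod 2 := fun b => (P (Sum.inr b)).2

/-- The residual operator matters only modulo stabilizers of the target. If all components are
small, the representative close to the components is chosen, and otherwise `ρ` itself, about which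
nothing has to be known. For a good error, a residual at `o` comes from a component or from an error
on the output itself, which counts as a cluster with one element. Two such clusters coincide or are
disjoint, as the union bound requires. -/
theorem exists_residual_of_decoder
    (𝓡 : Submodule (ZMod 2) ((B → ZMod 2) × PauliOp O)) {time : B → ℕ} {out : B → Option O} {τ M : ℕ}
    (hM : M ≤ τ + 1)
    (htime : ∀ u, ∀ v ∈ checkNeighbors L u, time v ≤ time u + 1)
    (hfar : ∀ g, L *ᵥ g = 0 → hammingNorm g < M → (∀ b, time b = 0 → g b = 0) → (g, 0) ∈ 𝓡)
    {line : (B → ZMod 2) → PauliOp O}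
    (hnear : ∀ g, L *ᵥ g = 0 → (∀ b, time b = τ → g b = 0) → (g, line g) ∈ 𝓡)
    (hline : ∀ g o, line g o ≠ 0 → ∃ b, g b ≠ 0 ∧ out b = some o)
    {ρ : (B → ZMod 2) → PauliOp O} (hρ : ∀ s P, (s, P) ∈ 𝓡 → (s, ρ s) ∈ 𝓡)
    {dec : (Λ → ZMod 2) → B → ZMod 2} (hdec : ∀ f : B → ZMod 2, L *ᵥ dec (L *ᵥ f) = L *ᵥ f ∧
      ∀ f', L *ᵥ f' = L *ᵥ f → hammingNorm (dec (L *ᵥ f)) ≤ hammingNorm f') :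
    ∃ (res : (B → ZMod 2) → PauliOp O) (good : Set (PauliOp (O ⊕ B))),
      (∀ f, (0, res f - ρ (f + dec (L *ᵥ f))) ∈ 𝓡) ∧
      (∀ P ∉ good, ∃ K, IsCluster (qubitNeighbors (O := O) L) K ∧ K.Nonempty ∧ M ≤ K.card ∧
        HalfFilled {v | P v ≠ 0} K) ∧
      ∀ P ∈ good, ∃ A : O → Finset (O ⊕ B),
        (∀ o, P (Sum.inl o) + res (outcomeFlips P) o ≠ 0 →
          A o ∈ clustersOver (qubitNeighbors L) (rootOf out) (levelOf time) o ∧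
            HalfFilled {v | P v ≠ 0} (A o)) ∧
        ∀ o o', P (Sum.inl o) + res (outcomeFlips P) o ≠ 0 →
          P (Sum.inl o') + res (outcomeFlips P) o' ≠ 0 → A o = A o' ∨ Disjoint (A o) (A o') := by
  classical
  have hg : ∀ f : B → ZMod 2, L *ᵥ (f + dec (L *ᵥ f)) = 0 := by
    intro f
    rw [mulVec_add, (hdec f).1, ZModModule.add_self]
  have hhalf : ∀ (P : PauliOp (O ⊕ B)) b,
      (outcomeFlips P + dec (L *ᵥ outcomeFlips P)) b ≠ 0 → HalfFilled {v | P v ≠ 0}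
      ((component L (outcomeFlips P + dec (L *ᵥ outcomeFlips P)) b).map
        (Function.Embedding.inr : B ↪ O ⊕ B)) := by
    intro P b hb
    have h := card_component_le (f := outcomeFlips P) (e := dec (L *ᵥ outcomeFlips P))
      (fun f' hf' => (hdec _).2 f' (hf'.trans (hdec _).1)) (hg _) hb
    refine halfFilled_setOf ?_
    rw [Finset.card_map, Finset.filter_map, Finset.card_map]
    refine h.trans (Nat.mul_le_mul_left _ (Finset.card_le_card ?_))
    intro v hv
    rw [Finset.mem_filter] at hv ⊢
    refine ⟨hv.1, fun h0 => hv.2 ?_⟩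
    exact congrArg Prod.snd h0
  let small : (B → ZMod 2) → Prop := fun f => ∀ b, (f + dec (L *ᵥ f)) b ≠ 0 →
    (component L (f + dec (L *ᵥ f)) b).card < M
  have hsmall : ∀ f, ∃ R : PauliOp O, (0, R - ρ (f + dec (L *ᵥ f))) ∈ 𝓡 ∧ (small f → ∀ o, R o ≠ 0 →
      ∃ b, (f + dec (L *ᵥ f)) b ≠ 0 ∧ ∃ v ∈ component L (f + dec (L *ᵥ f)) b, out v = some o ∧
        time v < (component L (f + dec (L *ᵥ f)) b).card) := by
    intro f
    by_cases hf : small f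
    · obtain ⟨R, hR, hR'⟩ := exists_residual_of_components 𝓡 hM htime hfar hnear hline (hg f) hf
      refine ⟨R, ?_, fun _ => hR'⟩
      have h := Submodule.sub_mem _ hR (hρ _ _ hR)
      rwa [Prod.mk_sub_mk, sub_self] at h
    · refine ⟨ρ (f + dec (L *ᵥ f)), ?_, fun h => absurd h hf⟩
      rw [sub_self]
      exact Submodule.zero_mem _
  choose res hres hres' using hsmall
  refine ⟨res, {P | small (outcomeFlips P)}, hres, ?_, ?_⟩
  · intro P hP
    have hP' : ¬ small (outcomeFlips P) := hP
    simp only [small, not_forall, not_lt] at hP'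
    obtain ⟨b, hb, hMb⟩ := hP'
    refine ⟨_, (isCluster_component b).map_inr L, ?_, ?_, hhalf P b hb⟩
    · exact ⟨_, Finset.mem_map_of_mem _ (self_mem_component b)⟩
    · rwa [Finset.card_map]
  · intro P hP
    have hC : ∀ o, ∃ C : Finset B, res (outcomeFlips P) o ≠ 0 →
        ∃ b, (outcomeFlips P + dec (L *ᵥ outcomeFlips P)) b ≠ 0 ∧
          component L (outcomeFlips P + dec (L *ᵥ outcomeFlips P)) b = C ∧
          ∃ v ∈ C, out v = some o ∧ time v < C.card := by
      intro o
      by_cases ho : res (outcomeFlips P) o ≠ 0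
      · obtain ⟨b, hb, hv⟩ := hres' _ hP o ho
        exact ⟨_, fun _ => ⟨b, hb, rfl, hv⟩⟩
      · exact ⟨∅, fun h => absurd h ho⟩
    choose C hC using hC
    have hor : ∀ o, P (Sum.inl o) + res (outcomeFlips P) o ≠ 0 → P (Sum.inl o) = 0 →
        res (outcomeFlips P) o ≠ 0 := by
      intro o h h0 h1
      rw [h0, h1, add_zero] at h
      exact h rfl
    refine ⟨fun o => if P (Sum.inl o) = 0 then (C o).map Function.Embedding.inr else {Sum.inl o},
      fun o ho => ?_, fun o o' ho ho' => ?_⟩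
    · beta_reduce
      by_cases h0 : P (Sum.inl o) = 0
      · rw [if_pos h0]
        obtain ⟨b, hb, hbC, v, hv, hvo, hlt⟩ := hC o (hor o ho h0)
        refine ⟨?_, hbC ▸ hhalf P b hb⟩
        simp only [clustersOver, Finset.mem_filter, Finset.mem_univ, true_and]
        refine ⟨hbC ▸ (isCluster_component b).map_inr L, Sum.inr v, Finset.mem_map_of_mem _ hv,
          hvo, ?_⟩
        rwa [Finset.card_map]
      · rw [if_neg h0]
        constructor
        · simp only [clustersOver, Finset.mem_filter, Finset.mem_univ, true_and]
          exact ⟨isCluster_singleton _ _, Sum.inl o, Finset.mem_singleton_self _, rfl,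
            Nat.zero_lt_one⟩
        · refine halfFilled_setOf ?_
          rw [Finset.filter_singleton, if_pos h0, Finset.card_singleton]
          norm_num
    · beta_reduce
      by_cases h0 : P (Sum.inl o) = 0 <;> by_cases h0' : P (Sum.inl o') = 0
      · rw [if_pos h0, if_pos h0']
        obtain ⟨b, hb, hbC, -⟩ := hC o (hor o ho h0)
        obtain ⟨b', hb', hbC', -⟩ := hC o' (hor o' ho' h0')
        rw [← hbC, ← hbC']
        rcases component_eq_or_disjoint b b' with h | h
        · exact Or.inl (by rw [h])
        · exact Or.inr ((Finset.disjoint_map _).2 h)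
      · rw [if_pos h0, if_neg h0']
        right
        simp
      · rw [if_neg h0, if_pos h0']
        right
        simp
      · rw [if_neg h0, if_neg h0']
        by_cases h : o = o'
        · left
          rw [h]
        · right
          simpa using h

variable {Ω : Type} {μ : PMF Ω} {P : Ω → PauliOp (O ⊕ B)} {R : Ω → PauliOp O} {good : Set Ω}
  {out : B → Option O} {time : B → ℕ} {M : ℕ} {Δ : ℕ} (hΔ : ∀ b, (checkNeighbors L b).card ≤ Δ)
  {δ y : ℝ} (hδ : 0 ≤ δ) (hδ1 : δ ≤ 1)
  (hP : LocalStochasticSet μ (fun ω => {v | P ω v ≠ 0}) (δ ^ 2)) (hy : 0 ≤ y) (hy2 : y ≤ 1 / 2)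
  (hyΔ : (Δ : ℝ) ^ 2 * y ≤ 1 / 2) (hδy : 2 * δ ≤ y / 4 * (y / 4))

include hΔ hδ hδ1 hP hy hy2 hyΔ hδy

theorem prob_compl_good_le (hbad : ∀ ω ∉ good, ∃ K, IsCluster (qubitNeighbors (O := O) L) K ∧
    K.Nonempty ∧ M ≤ K.card ∧ HalfFilled {v | P ω v ≠ 0} K) :
    prob μ goodᶜ ≤ Fintype.card (O ⊕ B) * y ^ M := by
  refine (prob_mono μ hbad).trans ?_
  refine prob_exists_large_cluster_le (qubitNeighbors_symm L) (card_qubitNeighbors_le L hΔ) hδ hδ1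
    hP hy hy2 hyΔ (hδy.trans ?_) M
  nlinarith [mul_nonneg hy hy]

theorem prob_good_residual_le (hout : ∀ o t, Set.ncard {b | out b = some o ∧ time b = t} ≤ 2)
    (hgood : ∀ ω ∈ good, ∃ A : O → Finset (O ⊕ B),
      (∀ o, R ω o ≠ 0 → A o ∈ clustersOver (qubitNeighbors L) (rootOf out) (levelOf time) o ∧
        HalfFilled {v | P ω v ≠ 0} (A o)) ∧
      ∀ o o', R ω o ≠ 0 → R ω o' ≠ 0 → A o = A o' ∨ Disjoint (A o) (A o')) (S : Finset O) :
    prob μ {ω | ω ∈ good ∧ ∀ o ∈ S, R ω o ≠ 0} ≤ (y / 2) ^ S.card := by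
  refine (prob_mono μ ?_).trans ((hP.prob_exists_candidates_le hδ hδ1 (z := y / 4) (by linarith)
    (by linarith) hδy (clustersOver (qubitNeighbors L) (rootOf out) (levelOf time)) (rootOf out)
    ?_ ?_ S).trans_eq ?_)
  · rintro ω ⟨hω, hS⟩
    obtain ⟨A, hA, hdisj⟩ := hgood ω hω
    exact ⟨A, fun s hs => hA s (hS s hs), fun s hs t ht => hdisj s t (hS s hs) (hS t ht)⟩
  · intro o K hK
    simp only [clustersOver, Finset.mem_filter, Finset.mem_univ, true_and] at hK
    obtain ⟨-, v, hv, hvo, -⟩ := hK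
    exact ⟨v, hv, hvo⟩
  · intro o
    refine sum_clustersOver_le (qubitNeighbors_symm L) (card_qubitNeighbors_le L hΔ) hy hy2 hyΔ _ _ o
      fun t => ?_
    -- The three vertices are at most two ancillas and the output qubit.
    have hsub : {v : O ⊕ B | rootOf out v = some o ∧ levelOf time v = t} ⊆
        {Sum.inl o} ∪ Sum.inr '' {b | out b = some o ∧ time b = t} := by
      rintro (o' | b) ⟨h1, h2⟩
      · left
        exact congrArg Sum.inl (Option.some.inj h1)
      · right
        exact ⟨b, ⟨h1, h2⟩, rfl⟩
    refine (Set.ncard_le_ncard hsub (Set.toFinite _)).trans ((Set.ncard_union_le _ _).trans ?_)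
    rw [Set.ncard_singleton, Set.ncard_image_of_injective _ Sum.inr_injective]
    linarith [hout o t]
  · ring

omit hΔ hδ hδ1 hP hy2 hyΔ hδy in
/-- Conditioning on a likely event costs a constant factor. -/
theorem localStochasticOn_of_prob_le {C : ℝ} (hC : 0 ≤ C) (hcompl : C < 1 → prob μ goodᶜ ≤ C / 2)
    (hS : ∀ S : Finset O, prob μ {ω | ω ∈ good ∧ ∀ o ∈ S, R ω o ≠ 0} ≤ (y / 2) ^ S.card)
    {success : Set Ω} (hs : 1 ≤ C ∧ success = ∅ ∨ C < 1 ∧ success = good) :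
    1 - C ≤ prob μ success ∧ LocalStochasticOn μ success R y := by
  rcases hs with ⟨h1, rfl⟩ | ⟨h1, rfl⟩
  -- The lower bound on the probability is not positive here, so the empty event will do.
  · refine ⟨by rw [prob_empty]; linarith, fun S => ?_⟩
    have : {ω | ω ∈ (∅ : Set Ω) ∧ ∀ q ∈ S, R ω q ≠ 0} = ∅ := by
      ext ω
      simp
    rw [this, prob_empty, mul_zero]
  · have h := one_sub_prob_compl_le μ success
    have hcompl := hcompl h1
    refine ⟨by linarith, fun S => ?_⟩
    rcases S.eq_empty_or_nonempty with rfl | hne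
    · rw [Finset.card_empty, pow_zero, one_mul]
      exact prob_mono μ fun ω hω => hω.1
    · refine (hS S).trans ?_
      -- For nonempty `S` one of the factors `1 / 2` in `(y / 2) ^ |S|` pays for the conditioning.
      have h2 : (1 / 2 : ℝ) ≤ prob μ success := by linarith
      rw [div_eq_mul_one_div, mul_pow]
      refine mul_le_mul_of_nonneg_left (le_trans ?_ h2) (pow_nonneg hy _)
      exact pow_le_of_le_one (by norm_num) (by norm_num) (Finset.card_pos.2 hne).ne'

end Residual

/-! ### Sparse matrices -/

section Sparse

variable {α β γ δ : Type} [Finite α] [Finite β] [Finite γ] [Finite δ]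

/-- Every row and every column of `A` has at most `s` nonzero entries. -/
def IsSparse (A : Matrix α β (ZMod 2)) (s : ℕ) : Prop :=
  (∀ i, {j | A i j ≠ 0}.ncard ≤ s) ∧ ∀ j, {i | A i j ≠ 0}.ncard ≤ s

variable {A : Matrix α β (ZMod 2)} {s : ℕ}

theorem IsSparse.mono (h : IsSparse A s) {s' : ℕ} (hs : s ≤ s') : IsSparse A s' :=
  ⟨fun i => (h.1 i).trans hs, fun j => (h.2 j).trans hs⟩

theorem IsSparse.transpose (h : IsSparse A s) : IsSparse Aᵀ s := ⟨h.2, h.1⟩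

theorem isSparse_zero : IsSparse (0 : Matrix α β (ZMod 2)) s := by
  constructor <;> simp

theorem IsSparse.submatrix (h : IsSparse A s) {f : γ → α} {g : δ → β} (hf : Function.Injective f)
    (hg : Function.Injective g) : IsSparse (A.submatrix f g) s :=
  ⟨fun i => (Set.ncard_le_ncard_of_injOn g (t := {j | A (f i) j ≠ 0}) (fun _ hj => hj) hg.injOn
    (Set.toFinite _)).trans (h.1 _), fun j => (Set.ncard_le_ncard_of_injOn f
    (t := {i | A i (g j) ≠ 0}) (fun _ hi => hi) hf.injOn (Set.toFinite _)).trans (h.2 _)⟩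

theorem IsSparse.kronecker_one [DecidableEq γ] (h : IsSparse A s) :
    IsSparse (A ⊗ₖ (1 : Matrix γ γ (ZMod 2))) s := by
  constructor
  · rintro ⟨i, k⟩
    refine (Set.ncard_le_ncard_of_injOn Prod.fst (t := {j | A i j ≠ 0}) ?_ ?_
      (Set.toFinite _)).trans (h.1 i)
    · rintro ⟨j, k'⟩ hj
      exact left_ne_zero_of_mul hj
    · rintro ⟨j, k'⟩ hj ⟨j', k''⟩ hj' hjj
      have h1 : k = k' := by
        by_contra hk
        exact right_ne_zero_of_mul hj (one_apply_ne hk)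
      have h2 : k = k'' := by
        by_contra hk
        exact right_ne_zero_of_mul hj' (one_apply_ne hk)
      exact Prod.ext hjj (h1.symm.trans h2)
  · rintro ⟨j, k⟩
    refine (Set.ncard_le_ncard_of_injOn Prod.fst (t := {i | A i j ≠ 0}) ?_ ?_
      (Set.toFinite _)).trans (h.2 j)
    · rintro ⟨i, k'⟩ hi
      exact left_ne_zero_of_mul hi
    · rintro ⟨i, k'⟩ hi ⟨i', k''⟩ hi' hii
      have h1 : k' = k := by
        by_contra hk
        exact right_ne_zero_of_mul hi (one_apply_ne hk)
      have h2 : k'' = k := by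
        by_contra hk
        exact right_ne_zero_of_mul hi' (one_apply_ne hk)
      exact Prod.ext hii (h1.trans h2.symm)

theorem IsSparse.one_kronecker [DecidableEq γ] (h : IsSparse A s) :
    IsSparse ((1 : Matrix γ γ (ZMod 2)) ⊗ₖ A) s := by
  have h1 : (1 : Matrix γ γ (ZMod 2)) ⊗ₖ A =
      (A ⊗ₖ (1 : Matrix γ γ (ZMod 2))).submatrix Prod.swap Prod.swap := by
    ext ⟨k, i⟩ ⟨k', j⟩
    exact mul_comm _ _
  rw [h1]
  exact h.kronecker_one.submatrix Prod.swap_injective Prod.swap_injective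

theorem ncard_sum_le {p : α ⊕ β → Prop} : {v | p v}.ncard ≤
    {a | p (Sum.inl a)}.ncard + {b | p (Sum.inr b)}.ncard := by
  have h : {v | p v} ⊆ Sum.inl '' {a | p (Sum.inl a)} ∪ Sum.inr '' {b | p (Sum.inr b)} := by
    rintro (a | b) h
    · exact Or.inl ⟨a, h, rfl⟩
    · exact Or.inr ⟨b, h, rfl⟩
  refine (Set.ncard_le_ncard h (Set.toFinite _)).trans ((Set.ncard_union_le _ _).trans ?_)
  rw [Set.ncard_image_of_injective _ Sum.inl_injective,
    Set.ncard_image_of_injective _ Sum.inr_injective]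

theorem IsSparse.fromBlocks (hA : IsSparse A s) {A₁₂ : Matrix α δ (ZMod 2)} (h₁₂ : IsSparse A₁₂ s)
    {A₂₁ : Matrix γ β (ZMod 2)} (h₂₁ : IsSparse A₂₁ s) {A₂₂ : Matrix γ δ (ZMod 2)}
    (h₂₂ : IsSparse A₂₂ s) : IsSparse (fromBlocks A A₁₂ A₂₁ A₂₂) (2 * s) := by
  rw [two_mul]
  constructor <;> rintro (i | i) <;> refine ncard_sum_le.trans (add_le_add ?_ ?_)
  · exact hA.1 i
  · exact h₁₂.1 i
  · exact h₂₁.1 i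
  · exact h₂₂.1 i
  · exact hA.2 i
  · exact h₂₁.2 i
  · exact h₁₂.2 i
  · exact h₂₂.2 i

theorem IsSparse.fromCols (hA : IsSparse A s) {A' : Matrix α δ (ZMod 2)} (hA' : IsSparse A' s) :
    IsSparse (fromCols A A') (2 * s) := by
  rw [two_mul]
  constructor
  · exact fun i => ncard_sum_le.trans (add_le_add (hA.1 i) (hA'.1 i))
  · rintro (j | j)
    · exact (hA.2 j).trans (Nat.le_add_right _ _)
    · exact (hA'.2 j).trans (Nat.le_add_right _ _)

theorem IsSparse.card_checkNeighbors_le {B Λ : Type} [Fintype B] [DecidableEq B] [Finite Λ]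
    {L : Matrix Λ B (ZMod 2)} {s : ℕ} (h : IsSparse L s) (b : B) :
    (checkNeighbors L b).card ≤ s * s := by
  classical
  have : Fintype Λ := Fintype.ofFinite Λ
  have h1 : checkNeighbors L b ⊆ (Finset.univ.filter fun c => L c b ≠ 0).biUnion fun c =>
      Finset.univ.filter fun b' => L c b' ≠ 0 := by
    intro b' hb'
    obtain ⟨c, hc, hc'⟩ := (mem_checkNeighbors L).1 hb'
    exact Finset.mem_biUnion.2 ⟨c, by simpa using hc, by simpa using hc'⟩
  refine (Finset.card_le_card h1).trans ?_
  refine (Finset.card_biUnion_le_card_mul _ _ s fun c _ => ?_).trans (Nat.mul_le_mul_right _ ?_)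
  · have := h.1 c
    rwa [Set.ncard_eq_toFinset_card', Set.toFinset_ofPred] at this
  · have := h.2 b
    rwa [Set.ncard_eq_toFinset_card', Set.toFinset_ofPred] at this

/-- A bipartite graph of bounded degree has an edge colouring with boundedly many colours. -/
theorem IsSparse.exists_coloring (h : IsSparse A s) (hs : 0 < s) :
    ∃ col : β × α → Fin (s * s), ∀ p p', A p.2 p.1 ≠ 0 → A p'.2 p'.1 ≠ 0 → p ≠ p' →
      col p = col p' → p.1 ≠ p'.1 ∧ p.2 ≠ p'.2 := by
  have : NeZero s := ⟨hs.ne'⟩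
  have key : ∀ {ι : Type} [Finite ι] (S : Set ι), S.ncard ≤ s →
      ∃ f : ι → Fin s, Set.InjOn f S := by
    intro ι _ S hS
    obtain ⟨f, -, hf⟩ := (Set.toFinite S).exists_injOn_of_encard_le (t := (Set.univ : Set (Fin s))) (by
      rw [← (Set.toFinite S).cast_ncard_eq, ← (Set.toFinite _).cast_ncard_eq, Set.ncard_univ,
        Nat.card_eq_fintype_card, Fintype.card_fin]
      exact_mod_cast hS)
    exact ⟨f, hf⟩
  choose f hf using fun i => key _ (h.1 i)
  choose f' hf' using fun j => key _ (h.2 j)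
  -- The colour records labels of the edge at both ends; distinct edges with a common end differ in
  -- the label there.
  refine ⟨fun p => finProdFinEquiv (f p.2 p.1, f' p.1 p.2), ?_⟩
  rintro ⟨j, i⟩ ⟨j', i'⟩ hp hp' hne hcol
  obtain ⟨h1, h2⟩ := Prod.mk.inj (finProdFinEquiv.injective hcol)
  constructor
  · rintro rfl
    exact hne (Prod.ext rfl (hf' j hp hp' h2))
  · rintro rfl
    exact hne (Prod.ext (hf i hp hp' h1) rfl)

end Sparse

/-! ### Bounded degree and locality in time of the foliated code. -/

section FoliationSparse

variable {I J X CX CZ : Type} [Fintype I] [DecidableEq I] [Fintype J] [DecidableEq J] [Fintype X]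
  [DecidableEq X] [Fintype CX] [DecidableEq CX] [Fintype CZ] [DecidableEq CZ]
  {SZ : Matrix J I (ZMod 2)} {HX : Matrix CX X (ZMod 2)} {HZ : Matrix CZ X (ZMod 2)} {τ s : ℕ}

theorem isSparse_timeMatrix (h : IsSparse SZ s) : IsSparse (timeMatrix SZ τ) (s + 2) := by
  have hpair : ∀ {ι : Type} (a b : ι), ({a, b} : Set ι).ncard ≤ 2 := fun a b =>
    (Set.ncard_insert_le a {b}).trans_eq (by rw [Set.ncard_singleton])
  constructor
  · rintro (c | ⟨i, t⟩)
    · refine (Set.ncard_le_ncard_of_injOn Prod.fst (t := {j | SZ c j ≠ 0}) ?_ ?_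
        (Set.toFinite _)).trans ((h.1 c).trans (Nat.le_add_right _ _))
      · rintro ⟨i, t⟩ hi
        simp only [timeMatrix, Set.mem_ofPred_eq, ne_eq, ite_eq_right_iff, Classical.not_imp] at hi
        exact hi.2
      · rintro ⟨i, t⟩ hi ⟨i', t'⟩ hi' hii
        simp only [timeMatrix, Set.mem_ofPred_eq, ne_eq, ite_eq_right_iff, Classical.not_imp] at hi hi'
        exact Prod.ext hii (hi.1.trans hi'.1.symm)
    · refine (Set.ncard_le_ncard (t := {(i, t.castSucc), (i, t.succ)}) ?_ (Set.toFinite _)).trans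
        ((hpair _ _).trans (Nat.le_add_left _ _))
      rintro ⟨i', t'⟩ hi
      by_contra hne
      simp only [Set.mem_insert_iff, Set.mem_singleton_iff, Prod.mk.injEq, not_or, not_and] at hne
      refine hi ?_
      by_cases hii : i' = i
      · simp [timeMatrix, hne.1 hii, hne.2 hii]
      · simp [timeMatrix, hii]
  · rintro ⟨i, t⟩
    refine ncard_sum_le.trans (add_le_add ?_ ?_)
    · refine (Set.ncard_le_ncard (t := {c | SZ c i ≠ 0}) ?_ (Set.toFinite _)).trans (h.2 i)
      intro c hc
      simp only [timeMatrix, Set.mem_ofPred_eq, ne_eq, ite_eq_right_iff, Classical.not_imp] at hc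
      exact hc.2
    · have h1 : {p : I × Fin τ | timeMatrix SZ τ (Sum.inr p) (i, t) ≠ 0} ⊆
          {p | i = p.1 ∧ t = p.2.castSucc} ∪ {p | i = p.1 ∧ t = p.2.succ} := by
        rintro ⟨i', t'⟩ hp
        by_contra hne
        simp only [Set.mem_union, Set.mem_ofPred_eq, not_or, not_and] at hne
        refine hp ?_
        by_cases hii : i = i'
        · simp [timeMatrix, hne.1 hii, hne.2 hii]
        · simp [timeMatrix, hii]
      refine (Set.ncard_le_ncard h1 (Set.toFinite _)).trans ((Set.ncard_union_le _ _).trans ?_)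
      refine add_le_add (b := 1) (d := 1) ?_ ?_ <;>
      · refine Set.ncard_le_one_iff_subsingleton.2 ?_
        rintro ⟨i', t'⟩ ⟨h1, h2⟩ ⟨i'', t''⟩ ⟨h3, h4⟩
        simp only at h1 h2 h3 h4
        subst h1 h3
        simpa using h2.symm.trans h4

theorem isSparse_foliation (h : IsSparse (timeMatrix SZ τ) s) (hX : IsSparse HX s)
    (hZ : IsSparse HZ s) : IsSparse (foliation SZ HX HZ τ) (2 * s) :=
  (h.kronecker_one.fromBlocks hX.transpose.one_kronecker hZ.one_kronecker isSparse_zero).submatrix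
    Function.injective_id (splitOutput_bijective τ).1

theorem nextTime_injective : Function.Injective (nextTime (I := I) (CX := CX) (τ := τ)) := by
  rintro ⟨⟨i, t⟩, c⟩ ⟨⟨i', t'⟩, c'⟩ h
  simpa [nextTime, and_assoc] using h

theorem isSparse_outcomeChecks (h : IsSparse (timeMatrix SZ τ) s) (hX : IsSparse HX s)
    (hZ : IsSparse HZ s) : IsSparse (outcomeChecks SZ HX HZ τ) (2 * (2 * s)) :=
  ((hX.one_kronecker.fromCols h.transpose.kronecker_one).submatrix nextTime_injective
    ((splitOutput_bijective τ).1.comp Sum.inr_injective)).fromBlocks isSparse_zero isSparse_zero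
    (hZ.one_kronecker.fromCols h.kronecker_one)

theorem eq_of_one_apply_mul_ne_zero {ι : Type} [DecidableEq ι] {a b : ι} {x : ZMod 2}
    (h : (1 : Matrix ι ι (ZMod 2)) a b * x ≠ 0) : a = b := by
  by_contra hab
  exact left_ne_zero_of_mul h (one_apply_ne hab)

theorem timeMatrix_inl_ne_zero {c : J} {i : I} {t : Fin (τ + 1)}
    (h : timeMatrix SZ τ (Sum.inl c) (i, t) ≠ 0) : (t : ℕ) = τ := by
  simp only [timeMatrix, ne_eq, ite_eq_right_iff, Classical.not_imp] at h
  rw [h.1, Fin.val_last]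

theorem timeMatrix_inr_ne_zero {i i' : I} {t' : Fin τ} {t : Fin (τ + 1)}
    (h : timeMatrix SZ τ (Sum.inr (i', t')) (i, t) ≠ 0) :
    (t : ℕ) = t' ∨ (t : ℕ) = t' + 1 := by
  by_contra hne
  rw [not_or] at hne
  refine h ?_
  have h1 : t ≠ t'.castSucc := fun h => hne.1 (by rw [h, Fin.val_castSucc])
  have h2 : t ≠ t'.succ := fun h => hne.2 (by rw [h, Fin.val_succ])
  simp [timeMatrix, h1, h2]

/-- A parity check acts on ancilla qubits at two successive times. -/
theorem exists_ancTime_of_outcomeChecks (c : (I × Fin τ) × CX ⊕ (J ⊕ I × Fin τ) × CZ) :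
    ∃ t : ℕ, ∀ u, outcomeChecks SZ HX HZ τ c u ≠ 0 → t ≤ ancTime u ∧ ancTime u ≤ t + 1 := by
  rcases c with ⟨⟨i, t⟩, c⟩ | ⟨c' | ⟨i, t⟩, c⟩
  · refine ⟨t, ?_⟩
    rintro ((⟨⟨i', t'⟩, q⟩ | ⟨c' | ⟨i', t'⟩, a⟩) | u) hu
    · have h : (1 : Matrix (I × Fin (τ + 1)) _ (ZMod 2)) (i, t.succ) (i', t'.succ) * HX c q ≠ 0 := hu
      have h1 := Fin.succ_injective _ (Prod.mk.inj (eq_of_one_apply_mul_ne_zero h)).2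
      subst h1
      exact ⟨le_rfl, Nat.le_succ _⟩
    · have h : timeMatrix SZ τ (Sum.inl c') (i, t.succ) * (1 : Matrix CX CX (ZMod 2)) c a ≠ 0 := hu
      have h1 := timeMatrix_inl_ne_zero (left_ne_zero_of_mul h)
      rw [Fin.val_succ] at h1
      simp only [ancTime]
      omega
    · have h : timeMatrix SZ τ (Sum.inr (i', t')) (i, t.succ) *
        (1 : Matrix CX CX (ZMod 2)) c a ≠ 0 := hu
      have h1 := timeMatrix_inr_ne_zero (left_ne_zero_of_mul h)
      rw [Fin.val_succ] at h1
      simp only [ancTime]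
      omega
    · exact absurd rfl hu
  · refine ⟨τ, ?_⟩
    rintro (u | ⟨κ, q⟩ | ⟨⟨i', t'⟩, a⟩) hu
    · exact absurd rfl hu
    · have h : (1 : Matrix (J ⊕ I × Fin τ) _ (ZMod 2)) (Sum.inl c') κ * HZ c q ≠ 0 := hu
      obtain rfl := eq_of_one_apply_mul_ne_zero h
      simp [ancTime]
    · have h : timeMatrix SZ τ (Sum.inl c') (i', t') * (1 : Matrix CZ CZ (ZMod 2)) c a ≠ 0 := hu
      have h1 := timeMatrix_inl_ne_zero (left_ne_zero_of_mul h)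
      simp only [ancTime]
      omega
  · refine ⟨t, ?_⟩
    rintro (u | ⟨κ, q⟩ | ⟨⟨i', t'⟩, a⟩) hu
    · exact absurd rfl hu
    · have h : (1 : Matrix (J ⊕ I × Fin τ) _ (ZMod 2)) (Sum.inr (i, t)) κ * HZ c q ≠ 0 := hu
      obtain rfl := eq_of_one_apply_mul_ne_zero h
      simp [ancTime]
    · have h : timeMatrix SZ τ (Sum.inr (i, t)) (i', t') *
        (1 : Matrix CZ CZ (ZMod 2)) c a ≠ 0 := hu
      have h1 := timeMatrix_inr_ne_zero (left_ne_zero_of_mul h)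
      simp only [ancTime]
      omega

theorem ancTime_le_of_mem_checkNeighbors (u v : AncOne I J X CX τ ⊕ AncTwo I J X CZ τ)
    (h : v ∈ checkNeighbors (outcomeChecks SZ HX HZ τ) u) : ancTime v ≤ ancTime u + 1 := by
  obtain ⟨c, hu, hv⟩ := (mem_checkNeighbors (outcomeChecks SZ HX HZ τ)).1 h
  obtain ⟨t, ht⟩ := exists_ancTime_of_outcomeChecks (SZ := SZ) (HX := HX) (HZ := HZ) c
  have h1 := ht u hu
  have h2 := ht v hv
  omega

theorem ncard_ancOutput_le (o : I × X) (t : ℕ) :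
    {b : AncOne I J X CX τ ⊕ AncTwo I J X CZ τ | ancOutput b = some o ∧ ancTime b = t}.ncard ≤ 2 := by
  refine ncard_sum_le.trans (add_le_add (b := 1) (d := 1) ?_ ?_) <;>
    refine Set.ncard_le_one_iff_subsingleton.2 ?_
  · rintro (⟨⟨i, s⟩, q⟩ | _) ⟨h1, h2⟩ (⟨⟨i', s'⟩, q'⟩ | _) ⟨h3, h4⟩ <;> try cases h1 <;> try cases h3
    have : s = s' := Fin.ext (h2.trans h4.symm)
    rw [this]
  · rintro (⟨_ | ⟨i, s⟩, q⟩ | _) ⟨h1, h2⟩ (⟨_ | ⟨i', s'⟩, q'⟩ | _) ⟨h3, h4⟩ <;> try cases h1 <;>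
      try cases h3
    have : s = s' := Fin.ext (h2.trans h4.symm)
    rw [this]

end FoliationSparse

/-! ### Sparse parity checks of the code -/

section Checks

theorem mulVec_eq_zero_iff_of_span_eq {α β n : Type} [Fintype n] {A : Matrix α n (ZMod 2)}
    {A' : Matrix β n (ZMod 2)} (h : Submodule.span (ZMod 2) (Set.range A.row) =
      Submodule.span (ZMod 2) (Set.range A'.row)) (v : n → ZMod 2) : A *ᵥ v = 0 ↔ A' *ᵥ v = 0 := by
  have key : ∀ {α β : Type} {A : Matrix α n (ZMod 2)} {A' : Matrix β n (ZMod 2)},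
      Submodule.span (ZMod 2) (Set.range A.row) ≤ Submodule.span (ZMod 2) (Set.range A'.row) →
      A' *ᵥ v = 0 → A *ᵥ v = 0 := by
    intro α β A A' hle hv
    have h1 : Submodule.span (ZMod 2) (Set.range A'.row) ≤
        LinearMap.ker (replicateRow Unit v).mulVecLin := by
      refine span_row_le_ker ?_
      ext i j
      have := congrFun hv j
      rw [mulVec, dotProduct_comm] at this
      exact this
    funext c
    have h2 := congrFun (h1 (hle (Submodule.subset_span ⟨c, rfl⟩))) ()
    rw [mulVec, dotProduct_comm]
    exact h2
  exact ⟨key h.ge, key h.le⟩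

theorem exists_sparse_checks {n r ℓ : ℕ} (A : Fin r → Fin n → ZMod 2)
    (hrow : ∀ c, (Finset.univ.filter fun i => A c i ≠ 0).card ≤ ℓ)
    (hcol : ∀ i, (Finset.univ.filter fun c => A c i ≠ 0).card ≤ ℓ) :
    ∃ (b : ℕ) (H : Matrix (Fin b) (Fin n) (ZMod 2)), b ≤ ℓ * n ∧ IsSparse H ℓ ∧
      Submodule.span (ZMod 2) (Set.range H.row) = Submodule.span (ZMod 2) (Set.range A) := by
  classical
  -- Zero rows are discarded: a nonzero row meets some column, so at most `ℓ * n` rows remain,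
  -- whatever `r` is.
  let e := (Fintype.equivFin {c : Fin r // A c ≠ 0}).symm
  have hinj : Function.Injective fun c => (e c : Fin r) := Subtype.val_injective.comp e.injective
  have hsparse : IsSparse (Matrix.of A) ℓ := by
    constructor
    · intro c
      rw [Set.ncard_eq_toFinset_card', Set.toFinset_ofPred]
      exact hrow c
    · intro i
      rw [Set.ncard_eq_toFinset_card', Set.toFinset_ofPred]
      exact hcol i
  refine ⟨_, (Matrix.of A).submatrix (fun c => (e c : Fin r)) id, ?_,
    hsparse.submatrix hinj Function.injective_id, ?_⟩
  · have h1 : (Finset.univ.filter fun c => A c ≠ 0) ⊆ Finset.univ.biUnion fun i =>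
        Finset.univ.filter fun c => A c i ≠ 0 := by
      intro c hc
      obtain ⟨i, hi⟩ := Function.ne_iff.1 (Finset.mem_filter.1 hc).2
      exact Finset.mem_biUnion.2 ⟨i, Finset.mem_univ _, Finset.mem_filter.2 ⟨Finset.mem_univ _, hi⟩⟩
    rw [Fintype.card_subtype, mul_comm]
    refine (Finset.card_le_card h1).trans ?_
    refine (Finset.card_biUnion_le_card_mul _ _ ℓ fun i _ => hcol i).trans_eq ?_
    rw [Finset.card_univ, Fintype.card_fin]
  · refine le_antisymm (Submodule.span_mono ?_) (Submodule.span_le.2 ?_)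
    · rintro _ ⟨c, rfl⟩
      exact ⟨_, rfl⟩
    · rintro _ ⟨c, rfl⟩
      by_cases hc : A c = 0
      · rw [hc]
        exact Submodule.zero_mem _
      · refine Submodule.subset_span ⟨e.symm ⟨c, hc⟩, ?_⟩
        funext i
        change A (e (e.symm ⟨c, hc⟩)) i = A c i
        rw [Equiv.apply_symm_apply]

/-- An LDPC code has sparse parity checks of `X` type and of `Z` type. -/
theorem CSSCode.IsLDPC.exists_checks {n ℓ : ℕ} {Q : CSSCode n} (h : Q.IsLDPC ℓ) :
    ∃ (bX bZ : ℕ) (HX : Matrix (Fin bX) (Fin n) (ZMod 2)) (HZ : Matrix (Fin bZ) (Fin n) (ZMod 2)),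
      bX ≤ ℓ * n ∧ bZ ≤ ℓ * n ∧ IsSparse HX ℓ ∧ IsSparse HZ ℓ ∧
      Submodule.span (ZMod 2) (Set.range HX.row) = Q.stabX ∧
      Submodule.span (ZMod 2) (Set.range HZ.row) = Q.stabZ := by
  obtain ⟨r, A, hA, hrow, hcol⟩ := h
  obtain ⟨bX, HX, hbX, hsX, hHX⟩ := exists_sparse_checks (fun c => (A c).1)
    (fun c => (Finset.card_le_card (Finset.monotone_filter_right _ fun _ _ h => Or.inl h)).trans
      (hrow c))
    fun i => (Finset.card_le_card (Finset.monotone_filter_right _ fun _ _ h => Or.inl h)).trans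
      (hcol i)
  obtain ⟨bZ, HZ, hbZ, hsZ, hHZ⟩ := exists_sparse_checks (fun c => (A c).2)
    (fun c => (Finset.card_le_card (Finset.monotone_filter_right _ fun _ _ h => Or.inr h)).trans
      (hrow c))
    fun i => (Finset.card_le_card (Finset.monotone_filter_right _ fun _ _ h => Or.inr h)).trans
      (hcol i)
  refine ⟨bX, bZ, HX, HZ, hbX, hbZ, hsX, hsZ, ?_, ?_⟩
  -- The stabilizer group is a product, so the `X` parts of possibly mixed generators generate its
  -- first factor.
  · rw [hHX, ← Submodule.prod_map_fst Q.stabX Q.stabZ, ← hA, Submodule.map_span, ← Set.range_comp]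
    rfl
  · rw [hHZ, ← Submodule.prod_map_snd Q.stabX Q.stabZ, ← hA, Submodule.map_span, ← Set.range_comp]
    rfl

variable {n bX bZ : ℕ} {Q : CSSCode n} {HX : Matrix (Fin bX) (Fin n) (ZMod 2)}
  {HZ : Matrix (Fin bZ) (Fin n) (ZMod 2)}
  (hX : Submodule.span (ZMod 2) (Set.range HX.row) = Q.stabX)
  (hZ : Submodule.span (ZMod 2) (Set.range HZ.row) = Q.stabZ)

include hX hZ

theorem CSSCode.checks_comm : HX * HZᵀ = 0 := by
  refine mul_transpose_eq_zero_symm ?_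
  ext b a
  have h1 : HZ *ᵥ HX.row a = 0 := by
    rw [mulVec_eq_zero_iff_of_span_eq (A' := Q.HZ) hZ]
    exact stabX_le_ker (hX ▸ Submodule.subset_span ⟨a, rfl⟩)
  exact congrFun h1 b

theorem CSSCode.exists_vecMul_eq_of_lt_distance_X {v : Fin n → ZMod 2} (hv : HZ *ᵥ v = 0)
    (hd : hammingNorm v < Q.distance) : ∃ x, x ᵥ* HX = v := by
  rw [mulVec_eq_zero_iff_of_span_eq (A' := Q.HZ) hZ] at hv
  rw [← mem_span_row, hX]
  by_contra hne
  exact Nat.notMem_of_lt_sInf hd ⟨v, rfl, Or.inl ⟨hv, hne⟩⟩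

theorem CSSCode.exists_vecMul_eq_of_lt_distance_Z {v : Fin n → ZMod 2} (hv : HX *ᵥ v = 0)
    (hd : hammingNorm v < Q.distance) : ∃ x, x ᵥ* HZ = v := by
  rw [mulVec_eq_zero_iff_of_span_eq (A' := Q.HX) hX] at hv
  rw [← mem_span_row, hZ]
  by_contra hne
  exact Nat.notMem_of_lt_sInf hd ⟨v, rfl, Or.inr ⟨hv, hne⟩⟩

theorem CSSCode.LogicalBasis.proportional_clusterTarget (B : Q.LogicalBasis) {m : ℕ} {S : CSSGenerators m}
    {ψ : State (Fin m)} (hψ : S.IsStabilizerState ψ) (τ : ℕ) :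
    Proportional (clusterTarget (foliation S.SZ HX HZ τ)) (B.encode ψ) := by
  classical
  obtain ⟨κ, hκ, h⟩ := B.encode_eq hψ
  refine Proportional.of_smul_eq hκ (h.trans ?_)
  congr 1
  funext y
  have key : y ∈ Q.encodedX S ↔ ∃ b, foliation S.SZ HX HZ τ *ᵥ Sum.elim y b = 0 := ?_
  · rw [clusterTarget]
    by_cases hy : y ∈ Q.encodedX S
    · rw [if_pos hy, if_pos (key.1 hy)]
    · rw [if_neg hy, if_neg (mt key.2 hy)]
  rw [exists_foliation_mulVec_eq_zero_iff, hX]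
  simp only [mulVec_eq_zero_iff_of_span_eq (A' := Q.HZ) hZ]
  exact Iff.rfl

end Checks

theorem CSSGenerators.ZSparse.isSparse {m w : ℕ} {S : CSSGenerators m} (h : S.ZSparse w) :
    IsSparse S.SZ w := by
  constructor
  · intro c
    rw [Set.ncard_eq_toFinset_card', Set.toFinset_ofPred]
    convert h.1 c
  · intro i
    rw [Set.ncard_eq_toFinset_card', Set.toFinset_ofPred]
    convert h.2 i

theorem CSSGenerators.exists_mul_SX_eq_one {m : ℕ} (S : CSSGenerators m) :
    ∃ X : Matrix (Fin m) (Fin S.mX) (ZMod 2), S.SX * X = 1 := by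
  have h : Function.Surjective S.SX.mulVecLin := by
    rw [← LinearMap.range_eq_top]
    refine Submodule.eq_top_of_finrank_eq ?_
    have := S.indepX.rank_matrix
    rw [Module.finrank_fin_fun]
    rwa [Matrix.rank, Fintype.card_fin] at this
  exact (mulVec_surjective_iff_exists_right_inverse (A := S.SX)).1 h

/-! ### Spread of the noise through the preparation of the cluster state -/

section Spread

variable {O B₁ B₂ : Type} [Fintype O] [DecidableEq O] [Fintype B₁] [DecidableEq B₁] [Fintype B₂]
  [DecidableEq B₂] {N : Matrix B₂ (O ⊕ B₁) (ZMod 2)} {a : ℕ} (e : Fin a ≃ B₁ ⊕ B₂)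

theorem ClusterAdj.symm {u v : O ⊕ Fin a} (h : ClusterAdj N e v u) : ClusterAdj N e u v := by
  obtain ⟨p, hp, h | h⟩ := h
  · exact ⟨p, hp, Or.inr ⟨h.2, h.1⟩⟩
  · exact ⟨p, hp, Or.inl ⟨h.2, h.1⟩⟩

theorem ncard_clusterAdj_le {s : ℕ} (hN : IsSparse N s) (v : O ⊕ Fin a) :
    {u | ClusterAdj N e v u}.ncard ≤ s := by
  have h1 : ∀ x : O ⊕ B₁, {u | ClusterAdj N e (sideOne e x) u}.ncard ≤ s := by
    intro x
    have hsub : {u | ClusterAdj N e (sideOne e x) u} ⊆ sideTwo e '' {b | N b x ≠ 0} := by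
      rintro u ⟨p, hp, ⟨h, rfl⟩ | ⟨h, rfl⟩⟩
      · rw [sideOne_injective e h]
        exact ⟨p.2, (Finset.mem_filter.1 hp).2, rfl⟩
      · exact absurd h (sideOne_ne_sideTwo e _ _)
    refine (Set.ncard_le_ncard hsub (Set.toFinite _)).trans ?_
    rw [Set.ncard_image_of_injective _ (sideTwo_injective e)]
    exact hN.2 x
  have h2 : ∀ b : B₂, {u | ClusterAdj N e (sideTwo e b) u}.ncard ≤ s := by
    intro b
    have hsub : {u | ClusterAdj N e (sideTwo e b) u} ⊆ sideOne e '' {x | N b x ≠ 0} := by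
      rintro u ⟨p, hp, ⟨h, rfl⟩ | ⟨h, rfl⟩⟩
      · exact absurd h.symm (sideOne_ne_sideTwo e _ _)
      · rw [sideTwo_injective e h]
        exact ⟨p.1, (Finset.mem_filter.1 hp).2, rfl⟩
    refine (Set.ncard_le_ncard hsub (Set.toFinite _)).trans ?_
    rw [Set.ncard_image_of_injective _ (sideOne_injective e)]
    exact hN.1 b
  rcases v with o | i
  · exact h1 (Sum.inl o)
  · rcases hi : e i with b | b
    · have h := h1 (Sum.inr b)
      rwa [show sideOne e (Sum.inr b) = (Sum.inr i : O ⊕ Fin a) by simp [sideOne, ← hi]] at h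
    · have h := h2 b
      rwa [show sideTwo e b = (Sum.inr i : O ⊕ Fin a) by simp [sideTwo, ← hi]] at h

/-- The rate of noise in a circuit with `k` noisy times in which every error spreads from at most
`c` qubits, for which the resulting errors have rate `(y / 4) ^ 4 / 4`. -/
noncomputable def noiseRate (c k : ℕ) (y : ℝ) : ℝ := (((y ^ 4 / (1024 * 2 ^ c)) ^ c) / (2 * k)) ^ k

/-- `noiseRate` is undone in two steps: the union over `k` times, then the spread over closed
neighbourhoods of at most `s + 1` qubits. The result is `δ ^ 2` with `δ = y ^ 2 / 32`, chosen so
that `2 * δ = (y / 4) ^ 2`. -/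
theorem localStochasticSet_of_spreadFrom {Ω : Type} {μ : PMF Ω} {k s : ℕ} (hk : 0 < k)
    (hN : IsSparse N s) {E : Ω → Fin k → PauliOp (O ⊕ Fin a)} {F : Ω → PauliOp (O ⊕ Fin a)}
    (hF : ∀ ω, SpreadFrom (ClusterAdj N e) {v | ∃ t, E ω t v ≠ 0} (F ω)) {y : ℝ} (hy : 0 ≤ y)
    (hy1 : y ≤ 1) (h : ∀ t, LocalStochastic μ (fun ω => E ω t) (noiseRate (s + 1) k y)) :
    LocalStochasticSet μ (fun ω => {v : O ⊕ (B₁ ⊕ B₂) | F ω (Sum.map id e.symm v) ≠ 0})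
      ((y ^ 2 / 32) ^ 2) := by
  classical
  set c := s + 1 with hc
  have hr1 : y ^ 4 / (1024 * 2 ^ c) ≤ 1 := by
    refine div_le_one_of_le₀ ((pow_le_one₀ hy hy1).trans ?_) (by positivity)
    have : (1 : ℝ) ≤ 2 ^ c := one_le_pow₀ (by norm_num)
    linarith
  have hr2 : (y ^ 4 / (1024 * 2 ^ c)) ^ c / (2 * k) ≤ 1 := by
    refine div_le_one_of_le₀ ((pow_le_one₀ (by positivity) hr1).trans ?_) (by positivity)
    have : (1 : ℝ) ≤ k := by exact_mod_cast hk
    linarith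
  have h1 := localStochasticSet_exists E hk (by positivity) hr2 h
  have hk0 : (k : ℝ) ≠ 0 := by exact_mod_cast hk.ne'
  rw [mul_div_cancel₀ _ (by positivity)] at h1
  let cl : O ⊕ Fin a → Finset (O ⊕ Fin a) := fun v =>
    insert v (Finset.univ.filter fun u => ClusterAdj N e v u)
  have hcard : ∀ v, (Finset.univ.filter fun u => ClusterAdj N e v u).card ≤ s := by
    intro v
    have := ncard_clusterAdj_le e hN v
    rwa [Set.ncard_eq_toFinset_card', Set.toFinset_ofPred] at this
  have h2 := h1.spread (F' := fun ω => {v | F ω v ≠ 0}) (by positivity) hr1 cl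
    (fun v => (Finset.card_insert_le _ _).trans (Nat.add_le_add_right (hcard v) 1)) ?_ ?_
  · intro S
    have h3 := h2 (S.map ⟨Sum.map id e.symm, Sum.map_injective.2 ⟨Function.injective_id,
      e.symm.injective⟩⟩)
    rw [Finset.card_map] at h3
    rw [show 2 ^ c * (y ^ 4 / (1024 * 2 ^ c)) = (y ^ 2 / 32) ^ 2 by field_simp; ring] at h3
    refine le_trans (prob_mono μ fun ω hω => ?_) h3
    intro v hv
    obtain ⟨u, hu, rfl⟩ := Finset.mem_map.1 hv
    exact hω u hu
  · intro u
    have hsub : {v | u ∈ cl v} ⊆ insert u {v | ClusterAdj N e u v} := by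
      intro v hv
      rcases Finset.mem_insert.1 hv with rfl | hv
      · exact Or.inl rfl
      · exact Or.inr (ClusterAdj.symm e (Finset.mem_filter.1 hv).2)
    exact (Set.ncard_le_ncard hsub (Set.toFinite _)).trans ((Set.ncard_insert_le _ _).trans
      (Nat.add_le_add_right (ncard_clusterAdj_le e hN u) 1))
  · intro ω v hv
    have hv' : (F ω v).1 ≠ 0 ∨ (F ω v).2 ≠ 0 := by
      by_contra hne
      rw [not_or, not_not, not_not] at hne
      exact hv (Prod.ext hne.1 hne.2)
    rcases hv' with hv' | hv'
    · exact ⟨v, Finset.mem_insert_self _ _, (hF ω).1 v hv'⟩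
    · rcases (hF ω).2 v hv' with h | ⟨u, hu, huv⟩
      · exact ⟨v, Finset.mem_insert_self _ _, h⟩
      · exact ⟨u, Finset.mem_insert_of_mem (Finset.mem_filter.2 ⟨Finset.mem_univ _, huv⟩), hu⟩

end Spread

/-! ### The single-shot procedure -/

/-- The undetected errors far from the output qubits are harmless. -/
theorem zero_mem_residual_of_lt_distance {n m bX bZ τ : ℕ} {Q : CSSCode n}
    {HX : Matrix (Fin bX) (Fin n) (ZMod 2)} {HZ : Matrix (Fin bZ) (Fin n) (ZMod 2)}
    (hX : Submodule.span (ZMod 2) (Set.range HX.row) = Q.stabX)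
    (hZ : Submodule.span (ZMod 2) (Set.range HZ.row) = Q.stabZ) (S : CSSGenerators m)
    {g : AncOne (Fin m) (Fin S.mZ) (Fin n) (Fin bX) τ ⊕
      AncTwo (Fin m) (Fin S.mZ) (Fin n) (Fin bZ) τ → ZMod 2}
    (hg : outcomeChecks S.SZ HX HZ τ *ᵥ g = 0) (hd : hammingNorm g < Q.distance)
    (h : ∀ b, ancTime b = 0 → g b = 0) : (g, 0) ∈ residual (foliation S.SZ HX HZ τ) := by
  obtain ⟨X, hSX⟩ := S.exists_mul_SX_eq_one
  refine zero_mem_residual_of_hammingNorm_lt S.SZ hg (CSSCode.checks_comm hX hZ) hSX S.comm ?_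
    (vecMul_injective_iff.2 S.indepZ)
    (fun v hv hvd => CSSCode.exists_vecMul_eq_of_lt_distance_X hX hZ hv hvd)
    (fun v hv hvd => CSSCode.exists_vecMul_eq_of_lt_distance_Z hX hZ hv hvd) hd h
  intro v hv
  rw [← mem_span_row, ← S.ker_SX]
  exact hv

theorem card_ancillas_le {m n ℓ mZ bX bZ : ℕ} (hmZ : mZ ≤ m) (hbX : bX ≤ ℓ * n) (hbZ : bZ ≤ ℓ * n)
    (τ : ℕ) : Fintype.card (AncOne (Fin m) (Fin mZ) (Fin n) (Fin bX) τ ⊕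
      AncTwo (Fin m) (Fin mZ) (Fin n) (Fin bZ) τ) ≤ (2 + 2 * ℓ) * (m * n * (τ + 1)) := by
  simp only [Fintype.card_sum, Fintype.card_prod, Fintype.card_fin]
  have h1 : mZ + m * τ ≤ m * (τ + 1) := by rw [mul_add, mul_one]; omega
  have h2 : (mZ + m * τ) * bX ≤ m * (τ + 1) * (ℓ * n) := Nat.mul_le_mul h1 hbX
  have h3 : (mZ + m * τ) * n ≤ m * (τ + 1) * n := Nat.mul_le_mul_right _ h1
  have h4 : m * (τ + 1) * bZ ≤ m * (τ + 1) * (ℓ * n) := Nat.mul_le_mul_left _ hbZ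
  have h5 : m * τ * n ≤ m * (τ + 1) * n := by gcongr; omega
  calc _ ≤ m * (τ + 1) * n + m * (τ + 1) * (ℓ * n) + (m * (τ + 1) * n + m * (τ + 1) * (ℓ * n)) := by
        omega
    _ = _ := by ring

/-- The bound on the rate of the residual errors. -/
noncomputable def maxRate (ℓ Δ : ℕ) : ℝ := 1 / (4 * (3 + 2 * ℓ + (Δ : ℝ) ^ 2))

theorem maxRate_pos (ℓ Δ : ℕ) : 0 < maxRate ℓ Δ := by
  unfold maxRate
  positivity

theorem maxRate_mul_le (ℓ Δ : ℕ) : maxRate ℓ Δ * (3 + 2 * ℓ + (Δ : ℝ) ^ 2) = 1 / 4 := by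
  have : (3 + 2 * ℓ + (Δ : ℝ) ^ 2) ≠ 0 := by positivity
  rw [maxRate]
  field_simp

/-- For positive `M` one factor `y` absorbs the constant `3 + 2 * ℓ`. For `M = 0` the last
hypothesis forces `x = 0`, so there are no qubits at all. -/
theorem card_mul_pow_le {ℓ Δ V M : ℕ} {x : ℕ} (hV : V ≤ (3 + 2 * ℓ) * x) {y : ℝ} (hy : 0 ≤ y)
    (hyr : y ≤ maxRate ℓ Δ) (hlt : (x : ℝ) * (2 : ℝ) ^ (-(1 * (M : ℕ) : ℝ)) < 1) :
    (V : ℝ) * y ^ M ≤ x * (2 : ℝ) ^ (-(1 * (M : ℕ) : ℝ)) / 2 := by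
  have hx : (0 : ℝ) ≤ x := Nat.cast_nonneg x
  have hV' : (V : ℝ) ≤ (3 + 2 * ℓ) * x := by exact_mod_cast hV
  have hyK : y * (3 + 2 * ℓ) ≤ 1 / 4 := by
    rw [← maxRate_mul_le ℓ Δ]
    exact mul_le_mul hyr (by linarith [sq_nonneg (Δ : ℝ)]) (by positivity) (maxRate_pos ℓ Δ).le
  have hy4 : y ≤ 1 / 2 := by nlinarith [mul_nonneg hy (Nat.cast_nonneg (α := ℝ) ℓ)]
  have h2 : (2 : ℝ) ^ (-(1 * (M : ℕ) : ℝ)) = (1 / 2) ^ M := by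
    rw [one_mul, Real.rpow_neg (by norm_num), Real.rpow_natCast, one_div, inv_pow]
  rw [h2] at hlt ⊢
  rcases M with _ | M
  · rw [pow_zero, mul_one] at hlt
    have h3 : x = 0 := by
      have : x < 1 := by exact_mod_cast hlt
      omega
    subst h3
    have h4 : V = 0 := by simpa using hV
    simp [h4]
  · have h5 : y ^ M ≤ (1 / 2) ^ M := pow_le_pow_left₀ hy hy4 M
    calc (V : ℝ) * y ^ (M + 1) ≤ (3 + 2 * ℓ) * x * (y ^ M * y) := by
          rw [pow_succ]
          exact mul_le_mul_of_nonneg_right hV' (by positivity)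
      _ = y * (3 + 2 * ℓ) * (x * y ^ M) := by ring
      _ ≤ 1 / 4 * (x * (1 / 2) ^ M) := by gcongr
      _ = _ := by ring

/-- The rate `y` of the residual error is the parameter, and the admissible noise rate is computed
from it; `exists_rate` inverts this dependence. -/
theorem exists_procedure {ℓ w T n m : ℕ} (hT : 1 ≤ T) {Q : CSSCode n} (hQ : Q.IsLDPC ℓ)
    (B : Q.LogicalBasis) {S : CSSGenerators m} (hS : S.ZSparse w) {ψ : State (Fin m)}
    (hψ : S.IsStabilizerState ψ) {s : ℕ} (hℓ : ℓ ≤ s) (hw : w + 2 ≤ s) :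
    ∃ (a : ℕ) (W : Procedure (Fin m × Fin n) a) (rep : W.Errors → PauliOp (Fin m × Fin n))
      (success : Set W.Errors),
      a ≤ (2 + 2 * ℓ) * (m * n * T) ∧ W.depth = 2 * s * (2 * s) + 1 ∧
      W.Prepares rep (B.encode ψ) ∧
      ∀ y : ℝ, 0 ≤ y → y ≤ maxRate ℓ (2 * (2 * s) * (2 * (2 * s))) → ∀ μ : PMF W.Errors,
        (∀ t, LocalStochastic μ (fun E => E t)
          (noiseRate (2 * s + 1) (2 * s * (2 * s) + 1 + 1) y)) →
        1 - (m * n * T : ℝ) * (2 : ℝ) ^ (-(1 * (min Q.distance T : ℕ) : ℝ)) ≤ prob μ success ∧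
        LocalStochasticOn μ success rep y := by
  classical
  obtain ⟨τ, rfl⟩ : ∃ τ, T = τ + 1 := ⟨T - 1, by omega⟩
  obtain ⟨bX, bZ, HX, HZ, hbX, hbZ, hsX, hsZ, hX, hZ⟩ := hQ.exists_checks
  have hcomm := CSSCode.checks_comm hX hZ
  have hstime : IsSparse (timeMatrix S.SZ τ) s := (isSparse_timeMatrix hS.isSparse).mono hw
  have hN := isSparse_foliation hstime (hsX.mono hℓ) (hsZ.mono hℓ)
  have hL := isSparse_outcomeChecks hstime (hsX.mono hℓ) (hsZ.mono hℓ)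
  let e := (Fintype.equivFin (AncOne (Fin m) (Fin S.mZ) (Fin n) (Fin bX) τ ⊕
    AncTwo (Fin m) (Fin S.mZ) (Fin n) (Fin bZ) τ)).symm
  obtain ⟨col, hcol⟩ := hN.exists_coloring (by omega)
  obtain ⟨ρ, hρ⟩ := exists_linearMap_selection (residual (foliation S.SZ HX HZ τ))
  obtain ⟨dec, hdec⟩ := exists_decoder (outcomeChecks S.SZ HX HZ τ)
  obtain ⟨res, good, hres, hbad, hgood⟩ := exists_residual_of_decoder (outcomeChecks S.SZ HX HZ τ)
    (residual (foliation S.SZ HX HZ τ)) (time := ancTime) (out := ancOutput)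
    (M := min Q.distance (τ + 1)) (min_le_right _ _) ancTime_le_of_mem_checkNeighbors
    (fun g hg hd h => zero_mem_residual_of_lt_distance hX hZ S hg
      (hd.trans_le (min_le_left _ _)) h)
    (line := timelineSum) (fun g hg h => timelineSum_mem_residual S.SZ hg h)
    (fun g o h => exists_of_timelineSum_ne_zero h) hρ hdec
  obtain ⟨F, hF, hprep⟩ := clusterProcedure_prepares (foliation S.SZ HX HZ τ) e col
    (fun p hp p' hp' => hcol p p' (Finset.mem_filter.1 hp).2 (Finset.mem_filter.1 hp').2)
    (B.proportional_clusterTarget hX hZ hψ τ) (outcomeChecks S.SZ HX HZ τ).mulVecLin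
    (fun s P h => outcomeChecks_mulVec_eq_zero S.SZ hcomm h) ρ hρ dec res hres
  -- The event is fixed before the noise is, so the choice between the empty event and successful
  -- decoding is made by the size of the claimed failure bound.
  refine ⟨_, _, _, if 1 ≤ (m * n * (τ + 1 : ℕ) : ℝ) *
      (2 : ℝ) ^ (-(1 * (min Q.distance (τ + 1) : ℕ) : ℝ)) then ∅ else
      {E | (fun v => F E (Sum.map id e.symm v)) ∈ good}, ?_, rfl, hprep, ?_⟩
  · exact card_ancillas_le (by have := S.complete; omega) hbX hbZ τ
  · intro y hy hyr μ hμ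
    have hmax := maxRate_mul_le ℓ (2 * (2 * s) * (2 * (2 * s)))
    have hpos := maxRate_pos ℓ (2 * (2 * s) * (2 * (2 * s)))
    have hℓ0 : (0 : ℝ) ≤ ℓ := Nat.cast_nonneg ℓ
    have hΔ0 := sq_nonneg (((2 * (2 * s) * (2 * (2 * s)) : ℕ) : ℝ))
    have hy2 : y ≤ 1 / 2 := by nlinarith [mul_nonneg hpos.le hℓ0, mul_nonneg hpos.le hΔ0]
    have hyΔ : ((2 * (2 * s) * (2 * (2 * s)) : ℕ) : ℝ) ^ 2 * y ≤ 1 / 2 := by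
      nlinarith [mul_nonneg hpos.le hℓ0, mul_le_mul_of_nonneg_left hyr hΔ0]
    have hloc := localStochasticSet_of_spreadFrom e (Nat.succ_pos _) hN (μ := μ) (E := fun E => E)
      hF hy (by linarith) hμ
    have hδ1 : y ^ 2 / 32 ≤ 1 := by nlinarith
    have hδy : 2 * (y ^ 2 / 32) ≤ y / 4 * (y / 4) := by nlinarith
    refine localStochasticOn_of_prob_le (good := {E | (fun v => F E (Sum.map id e.symm v)) ∈ good})
      hy (by positivity) ?_ ?_ ?_
    · intro hlt
      refine (prob_compl_good_le _ hL.card_checkNeighbors_le (by positivity) hδ1 hloc hy hy2 hyΔ hδy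
        fun ω hω => hbad _ hω).trans ?_
      have h := card_mul_pow_le (ℓ := ℓ) (V := Fintype.card ((Fin m × Fin n) ⊕
        (AncOne (Fin m) (Fin S.mZ) (Fin n) (Fin bX) τ ⊕
          AncTwo (Fin m) (Fin S.mZ) (Fin n) (Fin bZ) τ)))
        (M := min Q.distance (τ + 1)) (x := m * n * (τ + 1)) ?_ hy hyr ?_
      · push_cast at h ⊢
        exact h
      · have h1 := card_ancillas_le (m := m) (n := n) (show S.mZ ≤ m by
          have := S.complete; omega) hbX hbZ τ
        rw [Fintype.card_sum, Fintype.card_prod, Fintype.card_fin, Fintype.card_fin]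
        refine (Nat.add_le_add_left h1 _).trans ?_
        have h2 : m * n ≤ m * n * (τ + 1) := Nat.le_mul_of_pos_right _ (Nat.succ_pos τ)
        linarith
      · push_cast at hlt ⊢
        exact hlt
    · refine prob_good_residual_le (outcomeChecks S.SZ HX HZ τ) hL.card_checkNeighbors_le
        (by positivity) hδ1 hloc hy hy2 hyΔ hδy (fun o t => ncard_ancOutput_le o t)
        fun ω hω => hgood _ hω
    · by_cases hC : 1 ≤ (m * n * (τ + 1 : ℕ) : ℝ) *
        (2 : ℝ) ^ (-(1 * (min Q.distance (τ + 1) : ℕ) : ℝ))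
      · exact Or.inl ⟨hC, if_pos hC⟩
      · exact Or.inr ⟨not_le.1 hC, if_neg hC⟩

/-- The noise rate as a function of the residual rate. -/
theorem exists_rate (c k : ℕ) (hc : 0 < c) (hk : 0 < k) {y₀ : ℝ} (hy₀ : 0 < y₀) (hy₀1 : y₀ < 1) :
    ∃ pstar c₁ c₂ : ℝ, 0 < pstar ∧ pstar < 1 ∧ 0 < c₁ ∧ 0 < c₂ ∧ c₁ * pstar ^ c₂ < 1 ∧
      ∀ p, 0 ≤ p → p < pstar → 0 ≤ c₁ * p ^ c₂ ∧ c₁ * p ^ c₂ ≤ y₀ ∧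
        noiseRate c k (c₁ * p ^ c₂) = p := by
  set N : ℕ := 4 * c * k with hN
  have hN0 : N ≠ 0 := by positivity
  set κ : ℝ := ((1024 * 2 ^ c) ^ c * (2 * k)) ^ k with hκ
  have hκ0 : 0 < κ := by positivity
  have hκ1 : 1 ≤ κ := by
    refine one_le_pow₀ ?_
    have h1 : (1 : ℝ) ≤ 2 ^ c := one_le_pow₀ (by norm_num)
    have h2 : (1 : ℝ) ≤ (1024 * 2 ^ c) ^ c := one_le_pow₀ (by linarith)
    have h3 : (1 : ℝ) ≤ k := by exact_mod_cast hk
    nlinarith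
  -- The noise rate is a monomial in `y`, so `y = κ ^ (1 / N) * p ^ (1 / N)` inverts it. This gives
  -- `c₁` and `c₂`, and the threshold is the value at `y₀`.
  have hrate : ∀ y : ℝ, noiseRate c k y = y ^ N / κ := by
    intro y
    have hk0 : (k : ℝ) ≠ 0 := by positivity
    rw [noiseRate, div_pow (y ^ 4), div_div, div_pow, ← hκ, ← pow_mul, ← pow_mul, hN, mul_assoc]
  have hroot : ∀ y : ℝ, 0 ≤ y → κ ^ (N : ℝ)⁻¹ * (y ^ N / κ) ^ (N : ℝ)⁻¹ = y := by
    intro y hy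
    rw [← Real.mul_rpow hκ0.le (by positivity), mul_div_cancel₀ _ hκ0.ne',
      Real.pow_rpow_inv_natCast hy hN0]
  have hpow : ∀ p : ℝ, 0 ≤ p → (κ ^ (N : ℝ)⁻¹ * p ^ (N : ℝ)⁻¹) ^ N / κ = p := by
    intro p hp
    rw [mul_pow, Real.rpow_inv_natCast_pow hκ0.le hN0, Real.rpow_inv_natCast_pow hp hN0,
      mul_div_cancel_left₀ _ hκ0.ne']
  refine ⟨y₀ ^ N / κ, κ ^ (N : ℝ)⁻¹, (N : ℝ)⁻¹, by positivity, ?_, by positivity, by positivity, ?_,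
    fun p hp hlt => ⟨by positivity, ?_, ?_⟩⟩
  · rw [div_lt_one hκ0]
    exact (pow_lt_one₀ hy₀.le hy₀1 hN0).trans_le hκ1
  · rw [hroot _ hy₀.le]
    exact hy₀1
  · rw [← hroot _ hy₀.le]
    gcongr
  · rw [hrate, hpow p hp]

end SSPrep

theorem mainTheorem4 (ℓ w : ℕ) :
    ∃ (pstar c c₁ c₂ : ℝ) (A D : ℕ),
      0 < pstar ∧ pstar < 1 ∧ 0 < c ∧ 0 < c₁ ∧ 0 < c₂ ∧ c₁ * pstar ^ c₂ < 1 ∧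
      ∀ (T n m : ℕ), 1 ≤ T →
      ∀ (Q : SSPrep.CSSCode n), Q.IsLDPC ℓ →
      ∀ (B : Q.LogicalBasis) (S : SSPrep.CSSGenerators m), S.ZSparse w →
      ∀ (ψ : SSPrep.State (Fin m)), S.IsStabilizerState ψ →
      ∃ (a : ℕ) (W : SSPrep.Procedure (Fin m × Fin n) a)
        (rep : W.Errors → SSPrep.PauliOp (Fin m × Fin n)) (success : Set W.Errors),
        a ≤ A * (m * n * T) ∧
        W.depth ≤ D ∧
        W.Prepares rep (B.encode ψ) ∧
        ∀ (p : ℝ), 0 ≤ p → p < pstar →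
        ∀ (μ : PMF W.Errors), (∀ t, SSPrep.LocalStochastic μ (fun E => E t) p) →
          1 - (m * n * T : ℝ) * (2 : ℝ) ^ (-(c * (min Q.distance T : ℕ))) ≤
            SSPrep.prob μ success ∧
          SSPrep.LocalStochasticOn μ success rep (c₁ * p ^ c₂) := by
  -- A common sparsity bound: `ℓ` for the checks of the code and `w + 2` for the time complex, where
  -- the 2 comes from the repetition codes.
  set s := ℓ + w + 2 with hs
  have hmax := SSPrep.maxRate_mul_le ℓ (2 * (2 * s) * (2 * (2 * s)))
  have hpos := SSPrep.maxRate_pos ℓ (2 * (2 * s) * (2 * (2 * s)))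
  have hlt : SSPrep.maxRate ℓ (2 * (2 * s) * (2 * (2 * s))) < 1 := by
    have h1 := mul_nonneg hpos.le (Nat.cast_nonneg (α := ℝ) ℓ)
    have h2 := mul_nonneg hpos.le (sq_nonneg (((2 * (2 * s) * (2 * (2 * s)) : ℕ) : ℝ)))
    nlinarith
  obtain ⟨pstar, c₁, c₂, h1, h2, h3, h4, h5, hrate⟩ := SSPrep.exists_rate (2 * s + 1)
    (2 * s * (2 * s) + 1 + 1) (Nat.succ_pos _) (Nat.succ_pos _) hpos hlt
  refine ⟨pstar, 1, c₁, c₂, 2 + 2 * ℓ, 2 * s * (2 * s) + 1, h1, h2, one_pos, h3, h4, h5, ?_⟩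
  intro T n m hT Q hQ B S hS ψ hψ
  obtain ⟨a, W, rep, success, ha, hW, hprep, hprob⟩ := SSPrep.exists_procedure hT hQ B hS hψ
    (s := s) (by omega) (by omega)
  refine ⟨a, W, rep, success, ha, hW.le, hprep, fun p hp hlt μ hμ => ?_⟩
  obtain ⟨hy, hy', hp'⟩ := hrate p hp hlt
  refine hprob _ hy hy' μ ?_
  rw [hp']
  exact hμ
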